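/- Let $W=\mathrm{Cox}(\widetilde G_2)=\langle s_1,s_2,s_3\mid s_i^2,\ (s_1s_2)^3,\ (s_2s_3)^6,\ (s_1s_3)^2\rangle$ be the euclidean Coxeter group of type $\widetilde G_2$, let $R$ be its set of reflections (all conjugates of the $s_i$), and let $\mathrm{Art}(\widetilde G_2)=\langle \sigma_1,\sigma_2,\sigma_3\mid \sigma_1\sigma_2\sigma_1=\sigma_2\sigma_1\sigma_2,\ (\sigma_2\sigma_3)^3=(\sigma_3\sigma_2)^3,\ \sigma_1\sigma_3=\sigma_3\sigma_1\rangle$ be the corresponding Artin group. A Coxeter element is a product of $s_1,s_2,s_3$, each used once, in some order. Let $d$ be the distance in the right Cayley graph $\mathrm{Cay}(W,R)$. For a Coxeter element $w$, the interval $[1,w]$ is the set of $u\in W$ with $d(1,u)+d(u,w)=d(1,w)$, ordered by $u\le v$ iff $d(1,u)+d(u,v)+d(v,w)=d(1,w)$; it is also regarded as the directed graph, with edges labeled by $R$, formed by all minimal length directed paths from $1$ to $w$ in $\mathrm{Cay}(W,R)$. Let $R_0\subseteq R$ be the set of its labels. The dual Artin group $\mathrm{Art}^*(\widetilde G_2,w)$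 is the group generated by $R_0$ subject to the relations given by the closed loops in $[1,w]$, and the dual monoid $M_w$ is the monoid generated by $R_0$ subject to the relations $U=V$ whenever $U$ and $V$ are the words read along two directed paths in $[1,w]$ with the same endpoints. Theorem (Type $G$). Any two Coxeter elements of $W$ are conjugate in $W$ (so that, up to relabeling, there is a unique dual presentation). For every Coxeter element $w$ of $W$: 1. The poset $[1,w]$ is a lattice, that is, any two elements have a meet and a join. 2. The interval $[1,w]$ encodes a dual presentation of $\mathrm{Art}(\widetilde G_2)$: one has $s_i\in R_0$ for all $i$, and $\sigma_i\mapsto s_i$ extends to an isomorphism $\mathrm{Art}(\widetilde G_2)\to\mathrm{Art}^*(\widetilde G_2,w)$. 3. This dual presentation is a Garside presentation, in the sense that allows infinitely many simple elements (quasi-Garside). That is, all the words read along directed paths from $1$ to $w$ in $[1,w]$ represent one and the same element $\Delta$ of $M_w$; the monoid $M_w$ is left and right cancellative; there is $\lambda\colon M_w\to\mathbb N$ with $\lambda(a)+\lambda(b)\le\lambda(ab)$ for all $a,b$ and $\lambda(a)\ne0$ for $a\neq1$; any two elements of $M_w$ have a greatest common divisor and a least common multiple both for left and for right divisibility; the left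 divisors of $\Delta$ coincide with its right divisors and generate $M_w$; evaluation in $W$ is an isomorphism from the set of divisors of $\Delta$, ordered by left divisibility, onto the poset $[1,w]$; and $\mathrm{Art}^*(\widetilde G_2,w)$ is the group of fractions of $M_w$, that is, the natural homomorphism $\iota\colon M_w\to\mathrm{Art}^*(\widetilde G_2,w)$ is injective and every element of $\mathrm{Art}^*(\widetilde G_2,w)$ can be written both as $\iota(a)^{-1}\iota(b)$ and as $\iota(a')\iota(b')^{-1}$ with $a,b,a',b'\in M_w$. -/

import Mathlib

/-! ### Marked groups, their Cayley graphs and intervals -/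

/-- The length of `g` over `A`: the least length of a word in elements of `A` with product `g`.
(Only used when `A` generates the group as a monoid, so that such words exist.) -/
noncomputable def wordLength {G : Type*} [Group G] (A : Set G) (g : G) : ℕ :=
  sInf {n : ℕ | ∃ l : List G, (∀ a ∈ l, a ∈ A) ∧ l.prod = g ∧ l.length = n}

/-- The distance in the right Cayley graph `Cay(G, A)`, whose edges go from `g` to `g * a`
for `a ∈ A`. -/
noncomputable def cayleyDist {G : Type*} [Group G] (A : Set G) (g h : G) : ℕ :=
  wordLength A (g⁻¹ * h)

/-- The interval `[1, g]` in `Cay(G, A)`: all elements between `1` and `g`. -/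
def CayleyInterval {G : Type*} [Group G] (A : Set G) (g : G) : Type _ :=
  {u : G // cayleyDist A 1 u + cayleyDist A u g = cayleyDist A 1 g}

/-- The order of the interval: `u ≤ v` when `d(1,u) + d(u,v) + d(v,g) = d(1,g)`. -/
instance cayleyIntervalLE {G : Type*} [Group G] (A : Set G) (g : G) :
    LE (CayleyInterval A g) where
  le u v := cayleyDist A 1 u.1 + cayleyDist A u.1 v.1 + cayleyDist A v.1 g = cayleyDist A 1 g

section Order

variable {G : Type*} [Group G] {A : Set G}

theorem exists_minimal_word (hA : Submonoid.closure A = ⊤) (g : G) :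
    ∃ l : List G, (∀ a ∈ l, a ∈ A) ∧ l.prod = g ∧ l.length = wordLength A g := by
  have hne : {n : ℕ | ∃ l : List G, (∀ a ∈ l, a ∈ A) ∧ l.prod = g ∧ l.length = n}.Nonempty := by
    have hg : g ∈ Submonoid.closure A := by rw [hA]; trivial
    obtain ⟨l, hl, hp⟩ := Submonoid.exists_list_of_mem_closure hg
    exact ⟨l.length, l, hl, hp, rfl⟩
  exact Nat.sInf_mem hne

theorem wordLength_le (l : List G) (hl : ∀ a ∈ l, a ∈ A) : wordLength A l.prod ≤ l.length :=
  Nat.sInf_le ⟨l, hl, rfl, rfl⟩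

theorem cayleyDist_self (A : Set G) (g : G) : cayleyDist A g g = 0 := by
  have h := wordLength_le (A := A) ([] : List G) (by simp)
  simpa [cayleyDist] using h

theorem cayleyDist_triangle (hA : Submonoid.closure A = ⊤) (g h k : G) :
    cayleyDist A g k ≤ cayleyDist A g h + cayleyDist A h k := by
  obtain ⟨l, hl, hlp, hln⟩ := exists_minimal_word hA (g⁻¹ * h)
  obtain ⟨m, hm, hmp, hmn⟩ := exists_minimal_word hA (h⁻¹ * k)
  have h1 := wordLength_le (A := A) (l ++ m) (by
    intro a ha
    rcases List.mem_append.1 ha with ha | ha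
    · exact hl a ha
    · exact hm a ha)
  have h2 : (l ++ m).prod = g⁻¹ * k := by rw [List.prod_append, hlp, hmp]; group
  rw [h2, List.length_append, hln, hmn] at h1
  exact h1

theorem eq_of_cayleyDist_eq_zero (hA : Submonoid.closure A = ⊤) {g h : G}
    (h0 : cayleyDist A g h = 0) : g = h := by
  obtain ⟨l, _, hlp, hln⟩ := exists_minimal_word hA (g⁻¹ * h)
  have hl0 : l = [] := List.length_eq_zero_iff.1 (hln.trans h0)
  rw [hl0, List.prod_nil] at hlp
  exact inv_mul_eq_one.1 hlp.symm

/-- If `A` generates `G`, then the interval is partially ordered. -/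
abbrev cayleyIntervalPartialOrder (hA : Submonoid.closure A = ⊤) (g : G) :
    PartialOrder (CayleyInterval A g) where
  toLE := cayleyIntervalLE A g
  le_refl u := by
    change cayleyDist A 1 u.1 + cayleyDist A u.1 u.1 + cayleyDist A u.1 g = cayleyDist A 1 g
    rw [cayleyDist_self]
    exact u.2
  le_trans u v t huv hvt := by
    change cayleyDist A 1 u.1 + cayleyDist A u.1 v.1 + cayleyDist A v.1 g = cayleyDist A 1 g at huv
    change cayleyDist A 1 v.1 + cayleyDist A v.1 t.1 + cayleyDist A t.1 g = cayleyDist A 1 g at hvt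
    change cayleyDist A 1 u.1 + cayleyDist A u.1 t.1 + cayleyDist A t.1 g = cayleyDist A 1 g
    have h1 := v.2
    have h2 := cayleyDist_triangle hA u.1 v.1 t.1
    have h3 := cayleyDist_triangle hA 1 u.1 g
    have h4 := cayleyDist_triangle hA u.1 t.1 g
    omega
  le_antisymm u v huv hvu := by
    change cayleyDist A 1 u.1 + cayleyDist A u.1 v.1 + cayleyDist A v.1 g = cayleyDist A 1 g at huv
    change cayleyDist A 1 v.1 + cayleyDist A v.1 u.1 + cayleyDist A u.1 g = cayleyDist A 1 g at hvu
    have h1 := v.2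
    have h2 := u.2
    exact Subtype.ext (eq_of_cayleyDist_eq_zero hA (by omega))

end Order

/-- A poset in which every pair of elements has a meet and a join. -/
def IsLatticePoset (P : Type*) [PartialOrder P] : Prop :=
  ∀ a b : P, (∃ m, IsGLB {a, b} m) ∧ ∃ j, IsLUB {a, b} j

/-! ### Interval groups and interval monoids -/

/-- The edge of `Cay(G, A)` from `u` to `u * r` lies on a minimal length directed path
from `1` to `g`, that is, it is an edge of `[1, g]` viewed as a labeled directed graph. -/
def IsIntervalEdge {G : Type*} [Group G] (A : Set G) (g u r : G) : Prop :=
  r ∈ A ∧ cayleyDist A 1 u + 1 + cayleyDist A (u * r) g = cayleyDist A 1 g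

/-- The elements of `A` that occur as labels of edges in `[1, g]`. -/
def IntervalLabel {G : Type*} [Group G] (A : Set G) (g : G) : Type _ :=
  {r : G // ∃ u, IsIntervalEdge A g u r}

/-- `IsIntervalPath A g u v x`: the word `x` is read along an undirected edge path from `u` to `v`
in the labeled directed graph `[1, g]`; an edge traversed against its direction contributes the
inverse of its label. -/
inductive IsIntervalPath {G : Type*} [Group G] (A : Set G) (g : G) :
    G → G → FreeGroup (IntervalLabel A g) → Prop
  | nil (u : G) : IsIntervalPath A g u u 1
  | forward {u v : G} {x : FreeGroup (IntervalLabel A g)} (r : IntervalLabel A g)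
      (hx : IsIntervalPath A g u v x) (hr : IsIntervalEdge A g v r.1) :
      IsIntervalPath A g u (v * r.1) (x * FreeGroup.of r)
  | backward {u v : G} {x : FreeGroup (IntervalLabel A g)} (r : IntervalLabel A g)
      (hx : IsIntervalPath A g u (v * r.1) x) (hr : IsIntervalEdge A g v r.1) :
      IsIntervalPath A g u v (x * (FreeGroup.of r)⁻¹)

/-- `IsDirectedIntervalPath A g u v x`: the positive word `x` is read along a directed path from
`u` to `v` in `[1, g]`. -/
inductive IsDirectedIntervalPath {G : Type*} [Group G] (A : Set G) (g : G) :
    G → G → FreeMonoid (IntervalLabel A g) → Prop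
  | nil (u : G) : IsDirectedIntervalPath A g u u 1
  | snoc {u v : G} {x : FreeMonoid (IntervalLabel A g)} (r : IntervalLabel A g)
      (hx : IsDirectedIntervalPath A g u v x) (hr : IsIntervalEdge A g v r.1) :
      IsDirectedIntervalPath A g u (v * r.1) (x * FreeMonoid.of r)

/-- The words read along closed loops in `[1, g]`. -/
def intervalLoops {G : Type*} [Group G] (A : Set G) (g : G) :
    Set (FreeGroup (IntervalLabel A g)) :=
  {x | ∃ u : G, IsIntervalPath A g u u x}

/-- The interval group `G_g`: generated by the labels of `[1, g]`, subject to the relations visible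
as closed loops in `[1, g]`. -/
abbrev IntervalGroup {G : Type*} [Group G] (A : Set G) (g : G) : Type _ :=
  PresentedGroup (intervalLoops A g)

/-- The bigon relations: `U = V` for directed paths in `[1, g]` with the same endpoints. -/
def IntervalBigon {G : Type*} [Group G] (A : Set G) (g : G)
    (U V : FreeMonoid (IntervalLabel A g)) : Prop :=
  ∃ u v : G, IsDirectedIntervalPath A g u v U ∧ IsDirectedIntervalPath A g u v V

/-- The interval monoid: generated by the labels of `[1, g]`, subject to the bigon relations. -/
abbrev IntervalMonoid {G : Type*} [Group G] (A : Set G) (g : G) : Type _ :=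
  PresentedMonoid (IntervalBigon A g)

section IntervalMaps

variable {G : Type*} [Group G] {A : Set G} {g : G}

theorem IsDirectedIntervalPath.mul_eq {u v : G} {x : FreeMonoid (IntervalLabel A g)}
    (h : IsDirectedIntervalPath A g u v x) :
    u * FreeMonoid.lift (fun r : IntervalLabel A g => r.1) x = v := by
  induction h with
  | nil => simp
  | snoc r _ _ ih => rw [map_mul, FreeMonoid.lift_eval_of, ← mul_assoc, ih]

theorem IsDirectedIntervalPath.append_path {u v : G} {x : FreeMonoid (IntervalLabel A g)}
    (h : IsDirectedIntervalPath A g u v x) {t : G} {y : FreeGroup (IntervalLabel A g)}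
    (hy : IsIntervalPath A g t u y) :
    IsIntervalPath A g t v (y * FreeMonoid.lift FreeGroup.of x) := by
  induction h with
  | nil => simpa using hy
  | snoc r _ hr ih =>
    rw [map_mul, FreeMonoid.lift_eval_of, ← mul_assoc]
    exact IsIntervalPath.forward r ih hr

theorem IsDirectedIntervalPath.append_reverse {u v : G} {x : FreeMonoid (IntervalLabel A g)}
    (h : IsDirectedIntervalPath A g u v x) {t : G} {y : FreeGroup (IntervalLabel A g)}
    (hy : IsIntervalPath A g t v y) :
    IsIntervalPath A g t u (y * (FreeMonoid.lift FreeGroup.of x)⁻¹) := by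
  induction h generalizing y with
  | nil => simpa using hy
  | snoc r _ hr ih =>
    rw [map_mul, FreeMonoid.lift_eval_of, mul_inv_rev, ← mul_assoc]
    exact ih (IsIntervalPath.backward r hy hr)

theorem intervalBigon_group_eq {U V : FreeMonoid (IntervalLabel A g)}
    (h : IntervalBigon A g U V) :
    FreeMonoid.lift (fun r => (PresentedGroup.of r : IntervalGroup A g)) U =
      FreeMonoid.lift (fun r => (PresentedGroup.of r : IntervalGroup A g)) V := by
  obtain ⟨u, v, hU, hV⟩ := h
  have hloop := hV.append_reverse (hU.append_path (IsIntervalPath.nil (A := A) (g := g) u))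
  rw [one_mul] at hloop
  have hmk : ∀ x : FreeMonoid (IntervalLabel A g),
      FreeMonoid.lift (fun r => (PresentedGroup.of r : IntervalGroup A g)) x =
        PresentedGroup.mk (intervalLoops A g) (FreeMonoid.lift FreeGroup.of x) := by
    intro x
    have : FreeMonoid.lift (fun r => (PresentedGroup.of r : IntervalGroup A g)) =
        (PresentedGroup.mk (intervalLoops A g)).comp (FreeMonoid.lift FreeGroup.of) :=
      FreeMonoid.hom_eq (fun r => by simp [PresentedGroup.of])
    rw [this]; rfl
  have h1 := (PresentedGroup.one_of_mem (rels := intervalLoops A g) ⟨u, hloop⟩)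
  rw [hmk, hmk]
  rw [map_mul, map_inv] at h1
  exact mul_inv_eq_one.1 h1

end IntervalMaps

/-- The natural homomorphism from the interval monoid to the interval group with the same
generators. -/
def intervalMonoidToGroup {G : Type*} [Group G] (A : Set G) (g : G) :
    IntervalMonoid A g →* IntervalGroup A g :=
  PresentedMonoid.lift (fun r => PresentedGroup.of r) (fun _ _ h => intervalBigon_group_eq h)

/-- Evaluation of an element of the interval monoid in the group `G`. -/
def intervalMonoidEval {G : Type*} [Group G] (A : Set G) (g : G) : IntervalMonoid A g →* G :=
  PresentedMonoid.lift (fun r => r.1) (fun _ _ h => by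
    obtain ⟨u, v, hU, hV⟩ := h
    exact mul_left_cancel (hU.mul_eq.trans hV.mul_eq.symm))

/-! ### Garside structures (finiteness of the set of divisors is not required) -/

/-- `a` is a left divisor of `b`. -/
def IsLeftDivisor {M : Type*} [Monoid M] (a b : M) : Prop := ∃ c, b = a * c

/-- `a` is a right divisor of `b`. -/
def IsRightDivisor {M : Type*} [Monoid M] (a b : M) : Prop := ∃ c, b = c * a

/-- Any two elements have a greatest common divisor and a least common multiple for the
divisibility relation `r`. -/
def HasGcdsAndLcms {M : Type*} (r : M → M → Prop) : Prop :=
  ∀ a b : M, (∃ d, r d a ∧ r d b ∧ ∀ c, r c a → r c b → r c d) ∧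
    ∃ m, r a m ∧ r b m ∧ ∀ c, r a c → r b c → r m c

/-- `(M, Δ)` is a Garside monoid in the sense that allows infinitely many divisors of `Δ`
(a "quasi-Garside monoid"). -/
structure IsGarsideMonoid (M : Type*) [Monoid M] (Δ : M) : Prop where
  left_cancel : ∀ a b c : M, a * b = a * c → b = c
  right_cancel : ∀ a b c : M, b * a = c * a → b = c
  superadditive_length : ∃ f : M → ℕ, (∀ a b, f a + f b ≤ f (a * b)) ∧ ∀ a, a ≠ 1 → f a ≠ 0
  left_lattice : HasGcdsAndLcms (IsLeftDivisor : M → M → Prop)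
  right_lattice : HasGcdsAndLcms (IsRightDivisor : M → M → Prop)
  divisors_coincide : ∀ a : M, IsLeftDivisor a Δ ↔ IsRightDivisor a Δ
  divisors_generate : Submonoid.closure {a : M | IsLeftDivisor a Δ} = ⊤

/-- `ι` presents `H` as the group of fractions of `M`. -/
structure IsGroupOfFractions {M H : Type*} [Monoid M] [Group H] (ι : M →* H) : Prop where
  injective : Function.Injective ι
  left_fraction : ∀ h : H, ∃ a b : M, h = (ι a)⁻¹ * ι b
  right_fraction : ∀ h : H, ∃ a b : M, h = ι a * (ι b)⁻¹

/-- The presentation attached to the interval `[1, g]` is a Garside presentation: the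
interval monoid is a Garside monoid, with Garside element `Δ` the common value of the words read
along directed paths from `1` to `g`; evaluation in `G` identifies the divisors of `Δ`, ordered by
left divisibility, with the interval `[1, g]`; and the interval group is the group of fractions of
the interval monoid. -/
def IsGarsideInterval {G : Type*} [Group G] (A : Set G) (g : G) : Prop :=
  ∃ Δ : IntervalMonoid A g,
    (∃ U, IsDirectedIntervalPath A g 1 g U) ∧
    (∀ U, IsDirectedIntervalPath A g 1 g U → PresentedMonoid.mk (IntervalBigon A g) U = Δ) ∧
    IsGarsideMonoid (IntervalMonoid A g) Δ ∧
    (∃ e : {a : IntervalMonoid A g // IsLeftDivisor a Δ} ≃ CayleyInterval A g,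
      (∀ a, (e a).1 = intervalMonoidEval A g a.1) ∧
      ∀ a b, IsLeftDivisor a.1 b.1 ↔ e a ≤ e b) ∧
    IsGroupOfFractions (intervalMonoidToGroup A g)

/-! ### Coxeter groups, Artin groups and dual Artin groups -/

namespace CoxeterMatrix

/-- The set of reflections of the Coxeter group of `M`: all conjugates of standard generators. -/
def reflections {B : Type*} (M : CoxeterMatrix B) : Set M.Group :=
  {t | M.toCoxeterSystem.IsReflection t}

theorem closure_reflections {B : Type*} (M : CoxeterMatrix B) :
    Submonoid.closure M.reflections = ⊤ := by
  refine top_unique ?_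
  rw [← M.toCoxeterSystem.submonoid_closure_range_simple]
  refine Submonoid.closure_mono ?_
  rintro _ ⟨i, rfl⟩
  exact M.toCoxeterSystem.isReflection_simple i

/-- `w` is the product of all the standard generators, each used once, in some order. -/
def IsCoxeterElement {B : Type*} (M : CoxeterMatrix B) (w : M.Group) : Prop :=
  ∃ l : List B, l.Nodup ∧ (∀ i, i ∈ l) ∧ M.toCoxeterSystem.wordProd l = w

/-- The interval `[1, w]` in the Cayley graph of the Coxeter group with respect to all
reflections. -/
abbrev DualInterval {B : Type*} (M : CoxeterMatrix B) (w : M.Group) : Type _ :=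
  CayleyInterval M.reflections w

instance dualIntervalPartialOrder {B : Type*} (M : CoxeterMatrix B) (w : M.Group) :
    PartialOrder (M.DualInterval w) :=
  cayleyIntervalPartialOrder M.closure_reflections w

/-- The dual Artin group with respect to `w`. -/
abbrev DualArtinGroup {B : Type*} (M : CoxeterMatrix B) (w : M.Group) : Type _ :=
  IntervalGroup M.reflections w

/-- The Artin relators: for all `i`, `j`, the two alternating words of length `M i j` agree.
(An entry `0` stands for `∞` and gives the trivial relator, as does `i = j`.) -/
def artinRelators {B : Type*} (M : CoxeterMatrix B) : Set (FreeGroup B) :=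
  {x | ∃ i j : B,
    x = ((CoxeterSystem.alternatingWord i j (M i j)).map FreeGroup.of).prod *
      ((CoxeterSystem.alternatingWord j i (M i j)).map FreeGroup.of).prod⁻¹}

/-- The Artin group of `M`. -/
abbrev ArtinGroup {B : Type*} (M : CoxeterMatrix B) : Type _ :=
  PresentedGroup M.artinRelators

/-- The interval `[1, w]` encodes a dual presentation of the Artin group: the standard generators
of the Coxeter group are among the labels of `[1, w]`, and the resulting map of generators extends
to an isomorphism from the Artin group onto the dual Artin group. -/
def EncodesDualPresentation {B : Type*} (M : CoxeterMatrix B) (w : M.Group) : Prop :=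
  ∃ hS : ∀ i : B, ∃ u, IsIntervalEdge M.reflections w u (M.simple i),
    ∃ φ : M.ArtinGroup ≃* M.DualArtinGroup w,
      ∀ i : B, φ (PresentedGroup.of i) = PresentedGroup.of ⟨M.simple i, hS i⟩

/-- The Coxeter matrix of the extended Dynkin diagram `G̃₂`: a path with three vertices whose edges
have labels `3` and `6`. -/
def affineG₂ : CoxeterMatrix (Fin 3) where
  M := !![1, 3, 2;
          3, 1, 6;
          2, 6, 1]
  isSymm := by ext i j; fin_cases i <;> fin_cases j <;> rfl
  diagonal := by decide
  off_diagonal := by intro i j h; fin_cases i <;> fin_cases j <;> simp_all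

end CoxeterMatrix

/-! The proof has a general half, on intervals in marked groups, and a half specific to `G̃₂`.

General half. Let the generating set be closed under conjugation and let [1, g] be a lattice. The
interval monoid acts on pairs (t, x), read as products t·x with t simple: a simple s absorbs from t
the largest prefix c for which s·c is still simple (`simpleAct_mul`). Acting on (1, 1) splits every
element into a greatest simple left divisor and a remainder. This gives left cancellation, heads
and, together with joins in [1, g], left lcms (`exists_head`, `exists_left_lcm`). Conjugation by g
induces an automorphism of the monoid that is conjugation by Δ. Since every element divides a power
of Δ, the left-handed results carry over to the right, and Ore localization embeds the monoid in the
interval group. So the Garside property follows from the lattice property.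

Specific half. The Coxeter group acts faithfully on the coroot lattice ℤ², and s₃s₁s₂ acts as a
glide reflection. Its reflection length is 3, so its interval is governed by the triples of
reflections with this product. They obey the table `DualChain`, with three families a_k, b_k, c_k
that the glide shifts in k, and two mirrors h₀, h₁ parallel to its axis, which it exchanges. A
bounded poset of height three fails to be a lattice only if two atoms lie below two common coatoms,
and the table excludes this (`DualIncident.eq_or_eq`).

For the isomorphism, Hurwitz moves in the interval yield the Artin relations in the dual group.
Conversely, the labels are sent to conjugates of Artin group elements under powers of δ = σ₃σ₁σ₂.
All triples in the table reduce to four basic ones by conjugation and cyclic rotation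
(`dualValue_chain`), which defines a map back, left inverse to the first. Surjectivity holds because
the image contains Δ, hence all a_k, b_k, c_k, and then h from a factorization of Δ into h and two
b's. The other Coxeter elements are reached by cyclic rotation and s₁s₃ = s₃s₁. -/

/-! ### Word length and the prefix order -/

/-- `A` generates the group as a monoid and is closed under conjugation. -/
structure IsConjGenerating {G : Type*} [Group G] (A : Set G) : Prop where
  closure_eq_top : Submonoid.closure A = ⊤
  conj_mem : ∀ k a : G, a ∈ A → k * a * k⁻¹ ∈ A

/-- `u` is a prefix of `v`: some word of minimal length for `v` starts with a word for `u`. -/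
def PrefixLE {G : Type*} [Group G] (A : Set G) (u v : G) : Prop :=
  wordLength A u + wordLength A (u⁻¹ * v) = wordLength A v

section WordLength

variable {G : Type*} [Group G] {A : Set G}

theorem cayleyDist_one_left (A : Set G) (u : G) : cayleyDist A 1 u = wordLength A u := by
  simp [cayleyDist]

theorem wordLength_one (A : Set G) : wordLength A 1 = 0 := by
  simpa using wordLength_le (A := A) ([] : List G) (by simp)

theorem wordLength_le_one {a : G} (ha : a ∈ A) : wordLength A a ≤ 1 := by
  simpa using wordLength_le (A := A) [a] (by simpa using ha)

namespace IsConjGenerating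

variable (h : IsConjGenerating A)
include h

theorem wordLength_mul_le (x y : G) :
    wordLength A (x * y) ≤ wordLength A x + wordLength A y := by
  obtain ⟨l, hl, rfl, hn⟩ := exists_minimal_word h.closure_eq_top x
  obtain ⟨m, hm, rfl, hk⟩ := exists_minimal_word h.closure_eq_top y
  rw [← hn, ← hk, ← List.prod_append, ← List.length_append]
  exact wordLength_le _ (by simpa [or_imp, forall_and] using ⟨hl, hm⟩)

theorem eq_one_of_wordLength_eq_zero {x : G} (h0 : wordLength A x = 0) : x = 1 := by
  obtain ⟨l, hl, rfl, hn⟩ := exists_minimal_word h.closure_eq_top x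
  rw [h0] at hn
  rw [List.length_eq_zero_iff.1 hn, List.prod_nil]

theorem wordLength_conj_le (k x : G) : wordLength A (k * x * k⁻¹) ≤ wordLength A x := by
  obtain ⟨l, hl, rfl, hn⟩ := exists_minimal_word h.closure_eq_top x
  have e : k * l.prod * k⁻¹ = (l.map (MulAut.conj k)).prod := by
    rw [← map_list_prod, MulAut.conj_apply]
  rw [e, ← hn, ← List.length_map (MulAut.conj k)]
  apply wordLength_le
  intro a ha
  obtain ⟨b, hb, rfl⟩ := List.mem_map.1 ha
  exact h.conj_mem k b (hl b hb)

theorem wordLength_conj (k x : G) : wordLength A (k * x * k⁻¹) = wordLength A x := by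
  refine le_antisymm (h.wordLength_conj_le k x) ?_
  have := h.wordLength_conj_le k⁻¹ (k * x * k⁻¹)
  rwa [show k⁻¹ * (k * x * k⁻¹) * k⁻¹⁻¹ = x by group] at this

theorem exists_eq_mul_of_wordLength_eq_succ {x : G} {n : ℕ} (hx : wordLength A x = n + 1) :
    ∃ y a, a ∈ A ∧ x = y * a ∧ wordLength A y = n := by
  obtain ⟨l, hl, rfl, hn⟩ := exists_minimal_word h.closure_eq_top x
  rw [hx] at hn
  obtain ⟨m, a, rfl⟩ := List.eq_nil_or_concat l |>.resolve_left (by rintro rfl; simp at hn)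
  rw [List.prod_concat] at *
  simp only [List.concat_eq_append, List.length_append, List.length_singleton] at hn
  have ha : a ∈ A := hl a (by simp)
  have h1 := wordLength_le (A := A) m (fun b hb => hl b (by simp [hb]))
  have h2 := h.wordLength_mul_le m.prod a
  have h3 := wordLength_le_one ha
  exact ⟨m.prod, a, ha, rfl, by omega⟩

end IsConjGenerating

namespace PrefixLE

theorem one_left (A : Set G) (v : G) : PrefixLE A 1 v := by simp [PrefixLE, wordLength_one]

protected theorem refl (A : Set G) (v : G) : PrefixLE A v v := by simp [PrefixLE, wordLength_one]

variable (h : IsConjGenerating A)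
include h

protected theorem trans {u v w : G} (huv : PrefixLE A u v) (hvw : PrefixLE A v w) :
    PrefixLE A u w := by
  have h1 := h.wordLength_mul_le (u⁻¹ * v) (v⁻¹ * w)
  have h2 := h.wordLength_mul_le u (u⁻¹ * w)
  rw [show u⁻¹ * v * (v⁻¹ * w) = u⁻¹ * w by group] at h1
  rw [mul_inv_cancel_left] at h2
  simp only [PrefixLE] at *
  omega

protected theorem antisymm {u v : G} (huv : PrefixLE A u v) (hvu : PrefixLE A v u) : u = v := by
  simp only [PrefixLE] at *
  exact inv_mul_eq_one.1 (h.eq_one_of_wordLength_eq_zero (by omega))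

/-- Left translation by t is an order isomorphism from [1, y] onto [t, ty] when t is a prefix of ty.
This lemma and the next two are its ingredients. -/
theorem mul_left {t x y : G} (ht : PrefixLE A t (t * y)) (hxy : PrefixLE A x y) :
    PrefixLE A (t * x) (t * y) := by
  have h1 := h.wordLength_mul_le (t * x) (x⁻¹ * y)
  have h2 := h.wordLength_mul_le t x
  rw [show t * x * (x⁻¹ * y) = t * y by group] at h1
  simp only [PrefixLE, inv_mul_cancel_left, mul_inv_rev, mul_assoc] at *
  omega

theorem left_of_mul {t x y : G} (ht : PrefixLE A t (t * y)) (hxy : PrefixLE A x y) :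
    PrefixLE A t (t * x) := by
  have h1 := h.wordLength_mul_le (t * x) (x⁻¹ * y)
  have h2 := h.wordLength_mul_le t x
  rw [show t * x * (x⁻¹ * y) = t * y by group] at h1
  simp only [PrefixLE, inv_mul_cancel_left] at *
  omega

theorem of_mul_left {t x y : G} (ht : PrefixLE A t (t * x)) (hxy : PrefixLE A (t * x) (t * y)) :
    PrefixLE A x y := by
  have h1 := h.wordLength_mul_le x (x⁻¹ * y)
  have h2 := h.wordLength_mul_le t y
  rw [mul_inv_cancel_left] at h1
  simp only [PrefixLE, mul_inv_rev, mul_assoc, inv_mul_cancel_left] at *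
  omega

/-- The complement of u⁻¹v in v is v⁻¹uv, a conjugate of u, hence of the same length. Prefixes and
suffixes therefore coincide, the balancedness needed of a Garside element. -/
theorem suffix {u v : G} (huv : PrefixLE A u v) : PrefixLE A (u⁻¹ * v) v := by
  have h1 := h.wordLength_conj v⁻¹ u
  have e : (u⁻¹ * v)⁻¹ * v = v⁻¹ * u * v⁻¹⁻¹ := by group
  simp only [PrefixLE] at *
  rw [e, h1]
  omega

theorem right_of_mul {u v : G} (huv : PrefixLE A u (u * v)) : PrefixLE A v (u * v) := by
  simpa using suffix h huv

end PrefixLE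

end WordLength

/-! ### Directed paths and simple elements -/

section Paths

variable {G : Type*} [Group G] {A : Set G} {g : G}

theorem mem_cayleyInterval_iff (u : G) :
    cayleyDist A 1 u + cayleyDist A u g = cayleyDist A 1 g ↔ PrefixLE A u g := by
  simp [cayleyDist, PrefixLE]

theorem isIntervalEdge_iff (h : IsConjGenerating A) (u r : G) :
    IsIntervalEdge A g u r ↔
      r ∈ A ∧ wordLength A r = 1 ∧ PrefixLE A u (u * r) ∧ PrefixLE A (u * r) g := by
  have h1 := h.wordLength_mul_le u r
  have h2 := h.wordLength_mul_le (u * r) ((u * r)⁻¹ * g)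
  rw [mul_inv_cancel_left] at h2
  simp only [IsIntervalEdge, cayleyDist_one_left, PrefixLE, inv_mul_cancel_left]
  simp only [cayleyDist]
  constructor
  · rintro ⟨hr, he⟩
    have h3 := wordLength_le_one hr
    exact ⟨hr, by omega, by omega, by omega⟩
  · rintro ⟨hr, h3, h4, h5⟩
    exact ⟨hr, by omega⟩

theorem cayleyInterval_le_iff (u v : CayleyInterval A g) :
    u ≤ v ↔ PrefixLE A u.1 v.1 := by
  have hv := (mem_cayleyInterval_iff v.1).1 v.2
  change cayleyDist A 1 u.1 + cayleyDist A u.1 v.1 + cayleyDist A v.1 g = cayleyDist A 1 g ↔ _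
  simp only [cayleyDist_one_left, PrefixLE] at *
  simp only [cayleyDist]
  omega

theorem exists_isDirectedIntervalPath (h : IsConjGenerating A) {u v : G} (huv : PrefixLE A u v)
    (hv : PrefixLE A v g) : ∃ U, IsDirectedIntervalPath A g u v U := by
  generalize hn : wordLength A (u⁻¹ * v) = n
  induction n generalizing v with
  | zero =>
    obtain rfl := inv_mul_eq_one.1 (h.eq_one_of_wordLength_eq_zero hn)
    exact ⟨1, .nil _⟩
  | succ n ih =>
    obtain ⟨y, a, ha, e, hy⟩ := h.exists_eq_mul_of_wordLength_eq_succ hn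
    obtain rfl : v = u * y * a := by rw [mul_assoc, ← e, mul_inv_cancel_left]
    have h1 := h.wordLength_mul_le u y
    have h2 := h.wordLength_mul_le (u * y) a
    have h3 := wordLength_le_one ha
    have h4 : PrefixLE A (u * y) (u * y * a) := by
      simp only [PrefixLE, inv_mul_cancel_left] at *; omega
    have h5 : PrefixLE A u (u * y) := by
      simp only [PrefixLE, inv_mul_cancel_left] at *; omega
    obtain ⟨U, hU⟩ := ih h5 (h4.trans h hv) (by simpa using hy)
    have he : IsIntervalEdge A g (u * y) a :=
      (isIntervalEdge_iff h _ _).2 ⟨ha, by simp only [PrefixLE, inv_mul_cancel_left] at *; omega,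
        h4, hv⟩
    exact ⟨_, .snoc ⟨a, _, he⟩ hU he⟩

/-- The case u = v stands apart because the empty path is allowed at every vertex, even outside [1,
g]. -/
theorem IsDirectedIntervalPath.eq_or_le (h : IsConjGenerating A) {u v : G}
    {U : FreeMonoid (IntervalLabel A g)} (hU : IsDirectedIntervalPath A g u v U) :
    u = v ∨ PrefixLE A u v ∧ PrefixLE A v g := by
  induction hU with
  | nil => exact .inl rfl
  | snoc r _ hr ih =>
    obtain ⟨_, _, h1, h2⟩ := (isIntervalEdge_iff h _ _).1 hr
    rcases ih with rfl | ⟨h3, h4⟩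
    · exact .inr ⟨h1, h2⟩
    · exact .inr ⟨h3.trans h h1, h2⟩

/-- Left translation carries edges of [1, v] to edges of [u, uv]. It lets a word for v be appended
to a word for u in `simpleElement_mul`. -/
theorem IsDirectedIntervalPath.translate (h : IsConjGenerating A) {u v : G}
    {U : FreeMonoid (IntervalLabel A g)} (hU : IsDirectedIntervalPath A g 1 v U)
    (huv : PrefixLE A u (u * v)) (hg : PrefixLE A (u * v) g) :
    IsDirectedIntervalPath A g u (u * v) U := by
  generalize h1 : (1 : G) = t at hU
  induction hU with
  | nil => subst h1; rw [mul_one]; exact .nil _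
  | snoc r _ hr ih =>
    obtain ⟨ha, hl, h3, h4⟩ := (isIntervalEdge_iff h _ _).1 hr
    have h5 := huv.mul_left h h3
    rw [← mul_assoc] at h5 hg ⊢
    exact .snoc r (ih (huv.left_of_mul h h3) (h5.trans h hg))
      ((isIntervalEdge_iff h _ _).2 ⟨ha, hl, h5, hg⟩)

open Classical in
/-- The element of the interval monoid represented by the directed paths from `1` to `u`. -/
noncomputable def simpleElement (A : Set G) (g u : G) : IntervalMonoid A g :=
  if hu : ∃ U, IsDirectedIntervalPath A g 1 u U then
    PresentedMonoid.mk (IntervalBigon A g) hu.choose else 1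

/-- Two directed paths from 1 to u form a bigon, so the choice of path in the definition is
immaterial. -/
theorem simpleElement_eq {u : G} {U : FreeMonoid (IntervalLabel A g)}
    (hU : IsDirectedIntervalPath A g 1 u U) :
    simpleElement A g u = PresentedMonoid.mk (IntervalBigon A g) U := by
  have hu : ∃ U, IsDirectedIntervalPath A g 1 u U := ⟨U, hU⟩
  rw [simpleElement, dif_pos hu]
  exact PresentedMonoid.mk_eq_mk_of_rel ⟨1, u, hu.choose_spec, hU⟩

theorem simpleElement_one : simpleElement A g 1 = 1 := by
  rw [simpleElement_eq (.nil 1), map_one]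

theorem simpleElement_mul (h : IsConjGenerating A) {u v : G} (huv : PrefixLE A u (u * v))
    (hg : PrefixLE A (u * v) g) :
    simpleElement A g u * simpleElement A g v = simpleElement A g (u * v) := by
  obtain ⟨U, hU⟩ := exists_isDirectedIntervalPath h (.one_left A u) (huv.trans h hg)
  obtain ⟨V, hV⟩ := exists_isDirectedIntervalPath h (.one_left A v)
    ((huv.right_of_mul h).trans h hg)
  have hV' := hV.translate h huv hg
  have : IsDirectedIntervalPath A g 1 (u * v) (U * V) := by
    generalize u * v = t at hV'
    clear hV hg huv
    induction hV' with
    | nil => rwa [mul_one]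
    | snoc r _ hr ih => rw [← mul_assoc]; exact .snoc r ih hr
  rw [simpleElement_eq hU, simpleElement_eq hV, simpleElement_eq this, map_mul]

theorem IntervalLabel.prefixLE (h : IsConjGenerating A) (r : IntervalLabel A g) :
    PrefixLE A r.1 g := by
  obtain ⟨u, hu⟩ := r.2
  obtain ⟨_, _, h1, h2⟩ := (isIntervalEdge_iff h _ _).1 hu
  exact (h1.right_of_mul h).trans h h2

theorem IntervalLabel.wordLength_eq (h : IsConjGenerating A) (r : IntervalLabel A g) :
    wordLength A r.1 = 1 := by
  obtain ⟨u, hu⟩ := r.2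
  exact ((isIntervalEdge_iff h _ _).1 hu).2.1

theorem IntervalLabel.mem (r : IntervalLabel A g) : r.1 ∈ A := by
  obtain ⟨u, hu⟩ := r.2
  exact hu.1

theorem IntervalLabel.isIntervalEdge (h : IsConjGenerating A) (r : IntervalLabel A g) :
    IsIntervalEdge A g 1 r.1 :=
  (isIntervalEdge_iff h _ _).2 ⟨r.mem, r.wordLength_eq h, .one_left _ _,
    by simpa using r.prefixLE h⟩

theorem simpleElement_label (h : IsConjGenerating A) (r : IntervalLabel A g) :
    simpleElement A g r.1 = PresentedMonoid.of (IntervalBigon A g) r := by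
  have := IsDirectedIntervalPath.snoc r (.nil 1) (r.isIntervalEdge h)
  rw [one_mul, one_mul] at this
  exact simpleElement_eq this

theorem IntervalMonoid.induction (h : IsConjGenerating A) {p : IntervalMonoid A g → Prop}
    (one : p 1) (mul : ∀ u x, PrefixLE A u g → p x → p (simpleElement A g u * x))
    (x : IntervalMonoid A g) : p x := by
  refine PresentedMonoid.inductionOn x fun U => ?_
  induction U using FreeMonoid.recOn with
  | one => rwa [map_one]
  | of_mul r U ih =>
    rw [map_mul]
    have := mul r.1 _ (r.prefixLE h) ih
    rwa [simpleElement_label h] at this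

theorem intervalMonoidEval_simpleElement (h : IsConjGenerating A) {u : G} (hu : PrefixLE A u g) :
    intervalMonoidEval A g (simpleElement A g u) = u := by
  obtain ⟨U, hU⟩ := exists_isDirectedIntervalPath h (.one_left A u) hu
  rw [simpleElement_eq hU]
  have := hU.mul_eq
  rwa [one_mul] at this

end Paths

/-! ### Left divisibility in the monoid of an interval with meets and joins -/

/-- `m` computes meets in the interval `[1, g]` for the prefix order. -/
structure IsPrefixMeet {G : Type*} [Group G] (A : Set G) (g : G) (m : G → G → G) : Prop where
  le_left : ∀ u v, PrefixLE A u g → PrefixLE A v g → PrefixLE A (m u v) u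
  le_right : ∀ u v, PrefixLE A u g → PrefixLE A v g → PrefixLE A (m u v) v
  le_meet : ∀ u v c, PrefixLE A u g → PrefixLE A v g → PrefixLE A c u → PrefixLE A c v →
    PrefixLE A c (m u v)

/-- Any two elements of `[1, g]` have a join for the prefix order. -/
def HasPrefixJoins {G : Type*} [Group G] (A : Set G) (g : G) : Prop :=
  ∀ u v, PrefixLE A u g → PrefixLE A v g → ∃ j, PrefixLE A u j ∧ PrefixLE A v j ∧ PrefixLE A j g ∧
    ∀ c, PrefixLE A c g → PrefixLE A u c → PrefixLE A v c → PrefixLE A j c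

section Action

variable {G : Type*} [Group G] {A : Set G} {g : G} {m : G → G → G}
  (h : IsConjGenerating A) (hm : IsPrefixMeet A g m)

namespace IsPrefixMeet

include h hm

/-- As tx is below g, x is below t⁻¹g, so only the part of y below t⁻¹g matters for the meet with x.
On [1, t⁻¹g], translation by t preserves order both ways and hence meets. -/
theorem meet_mul {t x y : G} (ht : PrefixLE A t (t * x)) (htx : PrefixLE A (t * x) g)
    (hy : PrefixLE A y g) : m (t * x) (t * m (t⁻¹ * g) y) = t * m x y := by
  have htg := ht.trans h htx
  have htc : PrefixLE A (t⁻¹ * g) g := htg.suffix h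
  have hx := (ht.right_of_mul h).trans h htx
  have htg' : PrefixLE A t (t * (t⁻¹ * g)) := by rwa [mul_inv_cancel_left]
  have hc1 := hm.le_left _ _ htc hy
  have hc2 := hm.le_right _ _ htc hy
  set c := m (t⁻¹ * g) y
  have ht' : PrefixLE A t (t * c) := htg'.left_of_mul h hc1
  have hcg : PrefixLE A (t * c) g := by simpa using htg'.mul_left h hc1
  have h1 := hm.le_left _ _ htx hcg
  have h2 := hm.le_right _ _ htx hcg
  have h3 := hm.le_meet _ _ _ htx hcg ht ht'
  obtain ⟨n, hn⟩ : ∃ n, m (t * x) (t * c) = t * n := ⟨t⁻¹ * m (t * x) (t * c), by group⟩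
  rw [hn] at h1 h2 h3 ⊢
  have k1 := hm.le_left _ _ hx hy
  have k2 := hm.le_right _ _ hx hy
  refine PrefixLE.antisymm h ?_ ?_
  · exact PrefixLE.mul_left h (ht.left_of_mul h k1) (hm.le_meet _ _ _ hx hy
      (PrefixLE.of_mul_left h h3 h1) ((PrefixLE.of_mul_left h h3 h2).trans h hc2))
  · have k3 : PrefixLE A (t * m x y) (t * x) := ht.mul_left h k1
    have k4 : PrefixLE A t (t * m x y) := ht.left_of_mul h k1
    have k5 : PrefixLE A (m x y) (t⁻¹ * g) :=
      PrefixLE.of_mul_left h k4 (by simpa using k3.trans h htx)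
    have k6 : PrefixLE A (m x y) c := hm.le_meet _ _ _ htc hy k5 k2
    have := hm.le_meet _ _ _ htx hcg k3 (ht'.mul_left h k6)
    rwa [hn] at this

end IsPrefixMeet

/-- The action of a simple element `s` on pairs `(t, x)`, thought of as products `t * x` with `t`
simple: the part of `t` that can be absorbed into `s` is moved to the first factor. -/
noncomputable def simpleAct (s : {u // PrefixLE A u g}) :
    {u // PrefixLE A u g} × IntervalMonoid A g → {u // PrefixLE A u g} × IntervalMonoid A g :=
  fun p =>
  (⟨s.1 * m (s.1⁻¹ * g) p.1.1, by
    have hs : PrefixLE A s.1 (s.1 * (s.1⁻¹ * g)) := by rw [mul_inv_cancel_left]; exact s.2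
    simpa using hs.mul_left h (hm.le_left _ _ (s.2.suffix h) p.1.2)⟩,
   simpleElement A g ((m (s.1⁻¹ * g) p.1.1)⁻¹ * p.1.1) * p.2)

theorem simpleAct_one : simpleAct h hm ⟨1, .one_left A g⟩ = id := by
  funext ⟨⟨t, ht⟩, x⟩
  have e : m g t = t := (hm.le_right _ _ (.refl A g) ht).antisymm h
    (hm.le_meet _ _ _ (.refl A g) ht ht (.refl A t))
  simp [simpleAct, e, simpleElement_one]

/-- Let c be the part of y absorbed by t and k the part absorbed by st. After t has absorbed c, the
element s absorbs tk from tc, by `meet_mul`. Both routes end with first factor stk. -/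
theorem simpleAct_mul {s t : G} (hst : PrefixLE A s (s * t)) (hg : PrefixLE A (s * t) g) :
    simpleAct h hm ⟨s * t, hg⟩ = simpleAct h hm ⟨s, hst.trans h hg⟩ ∘
      simpleAct h hm ⟨t, (hst.right_of_mul h).trans h hg⟩ := by
  funext ⟨⟨y, hy⟩, x⟩
  have hsg := hst.trans h hg
  have htg := (hst.right_of_mul h).trans h hg
  have hs' : PrefixLE A s (s * (s⁻¹ * g)) := by rwa [mul_inv_cancel_left]
  have ht' : PrefixLE A t (s⁻¹ * g) := PrefixLE.of_mul_left h hst (by rwa [mul_inv_cancel_left])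
  have e1 : s⁻¹ * g = t * ((s * t)⁻¹ * g) := by group
  have ht'' : PrefixLE A t (t * ((s * t)⁻¹ * g)) := by rwa [← e1]
  have e2 := hm.meet_mul h ht'' (by rw [← e1]; exact hsg.suffix h) hy
  rw [← e1] at e2
  have hk := hm.le_right _ _ (hg.suffix h) hy
  have hc := hm.le_right _ _ (htg.suffix h) hy
  -- What st absorbs is part of what t absorbs, so k⁻¹y splits with additive lengths as
  -- (k⁻¹c)(c⁻¹y), and the second factors agree.
  have hkc : PrefixLE A (m ((s * t)⁻¹ * g) y) (m (t⁻¹ * g) y) := by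
    refine hm.le_meet _ _ _ (htg.suffix h) hy ?_ hk
    have k1 := hm.le_left _ _ (hg.suffix h) hy
    refine PrefixLE.of_mul_left h (ht''.left_of_mul h k1) ?_
    rw [mul_inv_cancel_left]
    exact (ht''.mul_left h k1).trans h (by rw [← e1]; exact hsg.suffix h)
  simp only [simpleAct, Function.comp_apply]
  refine Prod.ext (Subtype.ext ?_) ?_
  · simp only [e2, mul_assoc]
  · simp only [e2]
    rw [← mul_assoc]
    congr 1
    have e3 : (t * m ((s * t)⁻¹ * g) y)⁻¹ * (t * m (t⁻¹ * g) y) =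
        (m ((s * t)⁻¹ * g) y)⁻¹ * m (t⁻¹ * g) y := by group
    rw [e3]
    have e4 : (m ((s * t)⁻¹ * g) y)⁻¹ * y =
        ((m ((s * t)⁻¹ * g) y)⁻¹ * m (t⁻¹ * g) y) * ((m (t⁻¹ * g) y)⁻¹ * y) := by group
    rw [e4]
    symm
    apply simpleElement_mul h
    · rw [← e4]
      refine PrefixLE.of_mul_left h (t := m ((s * t)⁻¹ * g) y) ?_ ?_
      · rwa [mul_inv_cancel_left]
      · rwa [mul_inv_cancel_left, mul_inv_cancel_left]
    · rw [← e4]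
      exact (hk.suffix h).trans h hy

/-- The action of a label of the interval. -/
noncomputable def labelAct (r : IntervalLabel A g) :
    Function.End ({u // PrefixLE A u g} × IntervalMonoid A g) :=
  simpleAct h hm ⟨r.1, r.prefixLE h⟩

/-- By `simpleAct_mul` the letters of a path compose to the action of one simple element, which
depends only on the endpoints. Hence both sides of a bigon act equally. -/
theorem lift_labelAct_eq {u v : G} {U : FreeMonoid (IntervalLabel A g)}
    (hU : IsDirectedIntervalPath A g u v U) (x : G) (hx : PrefixLE A x g) (e : x = u⁻¹ * v) :
    FreeMonoid.lift (labelAct h hm) U = simpleAct h hm ⟨x, hx⟩ := by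
  induction hU generalizing x with
  | nil =>
    obtain rfl : x = 1 := by rw [e, inv_mul_cancel]
    rw [map_one, simpleAct_one]
    rfl
  | @snoc v U r hU hr ih =>
    obtain ⟨ha, hl, h3, h4⟩ := (isIntervalEdge_iff h _ _).1 hr
    obtain rfl : x = u⁻¹ * v * r.1 := by rw [e, mul_assoc]
    have hv : PrefixLE A (u⁻¹ * v) (u⁻¹ * v * r.1) := by
      rcases hU.eq_or_le h with rfl | ⟨h5, -⟩
      · rw [inv_mul_cancel]; exact .one_left _ _
      · refine PrefixLE.of_mul_left h (t := u) ?_ ?_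
        · rwa [mul_inv_cancel_left]
        · rwa [mul_assoc, mul_inv_cancel_left, mul_inv_cancel_left]
    rw [map_mul, FreeMonoid.lift_eval_of, ih _ (hv.trans h hx) rfl, simpleAct_mul h hm hv hx]
    rfl

/-- The action of the interval monoid extending the action of the simple elements. -/
noncomputable def monoidActHom :
    IntervalMonoid A g →* Function.End ({u // PrefixLE A u g} × IntervalMonoid A g) :=
  PresentedMonoid.lift (labelAct h hm) (by
    rintro U V ⟨u, v, hU, hV⟩
    have hx : PrefixLE A (u⁻¹ * v) g := by
      rcases hU.eq_or_le h with rfl | ⟨h1, h2⟩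
      · rw [inv_mul_cancel]; exact .one_left _ _
      · exact (h1.suffix h).trans h h2
    exact (lift_labelAct_eq h hm hU _ hx rfl).trans (lift_labelAct_eq h hm hV _ hx rfl).symm)

/-- The action of an element of the interval monoid. -/
noncomputable def monoidAct (x : IntervalMonoid A g) :
    {u // PrefixLE A u g} × IntervalMonoid A g → {u // PrefixLE A u g} × IntervalMonoid A g :=
  monoidActHom h hm x

theorem monoidAct_one (p : {u // PrefixLE A u g} × IntervalMonoid A g) :
    monoidAct h hm 1 p = p := by
  rw [monoidAct, map_one]; rfl

theorem monoidAct_simpleElement_mul {s : G} (hs : PrefixLE A s g) (x : IntervalMonoid A g)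
    (p : {u // PrefixLE A u g} × IntervalMonoid A g) :
    monoidAct h hm (simpleElement A g s * x) p = simpleAct h hm ⟨s, hs⟩ (monoidAct h hm x p) := by
  obtain ⟨U, hU⟩ := exists_isDirectedIntervalPath h (.one_left A s) hs
  have := lift_labelAct_eq h hm hU s hs (by simp)
  rw [monoidAct, map_mul, simpleElement_eq hU, ← this]
  rfl

/-- Each step only moves a factor from one coordinate to the other, so the product is the expected
one. Starting from (1, 1), this factors x as a simple element times a remainder. -/
theorem simpleElement_mul_monoidAct (x : IntervalMonoid A g)
    (p : {u // PrefixLE A u g} × IntervalMonoid A g) :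
    simpleElement A g (monoidAct h hm x p).1.1 * (monoidAct h hm x p).2 =
      x * (simpleElement A g p.1.1 * p.2) := by
  induction x using IntervalMonoid.induction h with
  | one => rw [monoidAct_one, one_mul]
  | mul s x hs ih =>
    rw [monoidAct_simpleElement_mul h hm hs, mul_assoc, ← ih]
    generalize monoidAct h hm x p = q
    obtain ⟨⟨t, ht⟩, y⟩ := q
    simp only [simpleAct]
    have hs' : PrefixLE A s (s * (s⁻¹ * g)) := by rwa [mul_inv_cancel_left]
    have h1 := hm.le_left _ _ (hs.suffix h) ht
    have h2 := hm.le_right _ _ (hs.suffix h) ht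
    have h3 := hs'.mul_left h h1
    rw [mul_inv_cancel_left] at h3
    rw [← simpleElement_mul h (hs'.left_of_mul h h1) h3]
    have h4 := simpleElement_mul h (u := m (s⁻¹ * g) t) (v := (m (s⁻¹ * g) t)⁻¹ * t)
      (by rwa [mul_inv_cancel_left]) (by rwa [mul_inv_cancel_left])
    rw [mul_inv_cancel_left] at h4
    simp only [← h4, mul_assoc]

end Action

/-! ### Cancellation, heads and least common multiples -/

section Divisibility

variable {G : Type*} [Group G] {A : Set G} {g : G} {m : G → G → G}
  (h : IsConjGenerating A) (hm : IsPrefixMeet A g m)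

include h hm

/-- If z acts on (1, 1) with result (t, a), then s·z gives (sc, c⁻¹t·a), where c is the part
absorbed by s. The first coordinate reveals c, and then the second recovers t·a = z. -/
theorem simpleElement_mul_left_cancel {s : G} (hs : PrefixLE A s g) {x y : IntervalMonoid A g}
    (e : simpleElement A g s * x = simpleElement A g s * y) : x = y := by
  have key : ∀ z, monoidAct h hm (simpleElement A g s * z) (⟨1, .one_left A g⟩, 1) =
      simpleAct h hm ⟨s, hs⟩ (monoidAct h hm z (⟨1, .one_left A g⟩, 1)) := fun z =>
    monoidAct_simpleElement_mul h hm hs z _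
  have hval : ∀ z, simpleElement A g (monoidAct h hm z (⟨1, .one_left A g⟩, 1)).1.1 *
      (monoidAct h hm z (⟨1, .one_left A g⟩, 1)).2 = z := fun z => by
    rw [simpleElement_mul_monoidAct, simpleElement_one, one_mul, mul_one]
  have h1 := key x
  rw [e, key y] at h1
  rw [← hval x, ← hval y]
  generalize monoidAct h hm x (⟨1, .one_left A g⟩, 1) = p at *
  generalize monoidAct h hm y (⟨1, .one_left A g⟩, 1) = q at *
  obtain ⟨⟨t, ht⟩, a⟩ := p
  obtain ⟨⟨u, hu⟩, b⟩ := q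
  simp only [simpleAct] at h1
  have h2 := congrArg (fun z => z.1.1) h1
  have h3 := congrArg Prod.snd h1
  simp only [mul_right_inj] at h2 h3
  have key2 : ∀ w, PrefixLE A w g → simpleElement A g (m (s⁻¹ * g) w) *
      simpleElement A g ((m (s⁻¹ * g) w)⁻¹ * w) = simpleElement A g w := fun w hw => by
    have h2 := hm.le_right _ _ (hs.suffix h) hw
    rw [simpleElement_mul h (by rwa [mul_inv_cancel_left]) (by rwa [mul_inv_cancel_left]),
      mul_inv_cancel_left]
  rw [← key2 t ht, ← key2 u hu, mul_assoc, mul_assoc, ← h3, h2]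

theorem intervalMonoid_left_cancel (a b c : IntervalMonoid A g) (e : a * b = a * c) : b = c := by
  induction a using IntervalMonoid.induction h with
  | one => simpa using e
  | mul s x hs ih =>
    rw [mul_assoc, mul_assoc] at e
    exact ih (simpleElement_mul_left_cancel h hm hs e)

/-- The head is the first coordinate of x acting on (1, 1). If x = s·y, that coordinate is s times
an absorbed part, hence above s. -/
theorem exists_head (x : IntervalMonoid A g) : ∃ t, PrefixLE A t g ∧
    IsLeftDivisor (simpleElement A g t) x ∧
    ∀ s, PrefixLE A s g → IsLeftDivisor (simpleElement A g s) x → PrefixLE A s t := by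
  refine ⟨(monoidAct h hm x (⟨1, .one_left A g⟩, 1)).1.1,
    (monoidAct h hm x (⟨1, .one_left A g⟩, 1)).1.2, ?_, ?_⟩
  · refine ⟨(monoidAct h hm x (⟨1, .one_left A g⟩, 1)).2, ?_⟩
    rw [simpleElement_mul_monoidAct, simpleElement_one, one_mul, mul_one]
  · rintro s hs ⟨y, rfl⟩
    rw [monoidAct_simpleElement_mul h hm hs]
    have hs' : PrefixLE A s (s * (s⁻¹ * g)) := by rwa [mul_inv_cancel_left]
    exact hs'.left_of_mul h (hm.le_left _ _ (hs.suffix h)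
      (monoidAct h hm y (⟨1, .one_left A g⟩, 1)).1.2)

theorem prefixLE_of_isLeftDivisor {s t : G} (hs : PrefixLE A s g) (ht : PrefixLE A t g)
    (hst : IsLeftDivisor (simpleElement A g s) (simpleElement A g t)) : PrefixLE A s t := by
  obtain ⟨y, hy⟩ := hst
  have h1 : (monoidAct h hm (simpleElement A g t) (⟨1, .one_left A g⟩, 1)).1.1 = t := by
    have : m (t⁻¹ * g) 1 = 1 := (hm.le_right _ _ (ht.suffix h) (.one_left A g)).antisymm h
      (.one_left _ _)
    rw [← mul_one (simpleElement A g t), monoidAct_simpleElement_mul h hm ht, monoidAct_one]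
    simp [simpleAct, this]
  rw [← h1, hy, monoidAct_simpleElement_mul h hm hs]
  have hs' : PrefixLE A s (s * (s⁻¹ * g)) := by rwa [mul_inv_cancel_left]
  exact hs'.left_of_mul h (hm.le_left _ _ (hs.suffix h)
      (monoidAct h hm y (⟨1, .one_left A g⟩, 1)).1.2)

theorem eq_simpleElement_of_isLeftDivisor {v : G} (hv : PrefixLE A v g) {x : IntervalMonoid A g}
    (hx : IsLeftDivisor x (simpleElement A g v)) :
    ∃ u, PrefixLE A u v ∧ x = simpleElement A g u := by
  induction x using IntervalMonoid.induction h generalizing v with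
  | one => exact ⟨1, .one_left A v, simpleElement_one.symm⟩
  | mul s x hs ih =>
    obtain ⟨y, hy⟩ := hx
    have hsv := prefixLE_of_isLeftDivisor h hm hs hv ⟨x * y, by rw [hy, mul_assoc]⟩
    have hsv' : PrefixLE A s (s * (s⁻¹ * v)) := by rwa [mul_inv_cancel_left]
    have e := simpleElement_mul h hsv' (by rwa [mul_inv_cancel_left])
    rw [mul_inv_cancel_left, hy, mul_assoc] at e
    obtain ⟨u, hu, rfl⟩ := ih ((hsv.suffix h).trans h hv)
      ⟨y, simpleElement_mul_left_cancel h hm hs e⟩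
    have h1 := hsv'.mul_left h hu
    rw [mul_inv_cancel_left] at h1
    exact ⟨s * u, h1, simpleElement_mul h (hsv'.left_of_mul h hu) (h1.trans h hv)⟩

omit hm in
theorem isLeftDivisor_of_prefixLE {s t : G} (hst : PrefixLE A s t) (ht : PrefixLE A t g) :
    IsLeftDivisor (simpleElement A g s) (simpleElement A g t) :=
  ⟨simpleElement A g (s⁻¹ * t), by
    rw [simpleElement_mul h (by rwa [mul_inv_cancel_left]) (by rwa [mul_inv_cancel_left]),
      mul_inv_cancel_left]⟩

variable (hj : HasPrefixJoins A g)
include hj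

/-- For y = t·z, the join j of s and t closes one square, and t⁻¹j replaces s in the induction along
z. A common multiple has a head above s and t, hence above j, so joins inside [1, g] suffice for
minimality. -/
theorem exists_lcm_simpleElement (y : IntervalMonoid A g) (s : G) (hs : PrefixLE A s g) :
    ∃ s' y', simpleElement A g s * y' = y * simpleElement A g s' ∧
      ∀ c, IsLeftDivisor (simpleElement A g s) c → IsLeftDivisor y c →
        IsLeftDivisor (y * simpleElement A g s') c := by
  induction y using IntervalMonoid.induction h generalizing s with
  | one => exact ⟨s, 1, by simp, fun c hc _ => by simpa using hc⟩
  | mul t z ht ih =>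
    obtain ⟨j, hsj, htj, hjg, hmin⟩ := hj s t hs ht
    have e0 : simpleElement A g s * simpleElement A g (s⁻¹ * j) = simpleElement A g j := by
      rw [simpleElement_mul h (by rwa [mul_inv_cancel_left]) (by rwa [mul_inv_cancel_left]),
        mul_inv_cancel_left]
    have e1 : simpleElement A g t * simpleElement A g (t⁻¹ * j) = simpleElement A g j := by
      rw [simpleElement_mul h (by rwa [mul_inv_cancel_left]) (by rwa [mul_inv_cancel_left]),
        mul_inv_cancel_left]
    obtain ⟨s', z', hz, hzmin⟩ := ih (t⁻¹ * j) ((htj.suffix h).trans h hjg)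
    refine ⟨s', simpleElement A g (s⁻¹ * j) * z', ?_, ?_⟩
    · rw [← mul_assoc, e0, ← e1, mul_assoc, hz, mul_assoc]
    · rintro c hsc ⟨e, rfl⟩
      obtain ⟨k, hk, ⟨f, hf⟩, hkmax⟩ := exists_head h hm (simpleElement A g t * z * e)
      have h1 := hkmax s hs hsc
      have h2 := hkmax t ht ⟨z * e, by rw [mul_assoc]⟩
      obtain ⟨d, hd⟩ := isLeftDivisor_of_prefixLE h (hmin k hk h1 h2) hk
      rw [hd, ← e1, mul_assoc, mul_assoc, mul_assoc] at hf
      obtain ⟨q, hq⟩ := hzmin (z * e)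
        ⟨d * f, simpleElement_mul_left_cancel h hm ht hf⟩ ⟨e, rfl⟩
      exact ⟨q, by rw [mul_assoc, hq]; simp only [mul_assoc]⟩

/-- The same tiling in the other direction: each simple factor of x is pushed across all of y by
`exists_lcm_simpleElement`, and the complement y' of y meets the remaining factors. -/
theorem exists_left_lcm (x y : IntervalMonoid A g) :
    ∃ x' y', x * y' = y * x' ∧
      ∀ c, IsLeftDivisor x c → IsLeftDivisor y c → IsLeftDivisor (x * y') c := by
  induction x using IntervalMonoid.induction h generalizing y with
  | one => exact ⟨1, y, by simp, fun c _ hc => by simpa using hc⟩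
  | mul s z hs ih =>
    obtain ⟨s', y', h1, h2⟩ := exists_lcm_simpleElement h hm hj y s hs
    obtain ⟨b, a, h3, h4⟩ := ih y'
    refine ⟨simpleElement A g s' * b, a, ?_, ?_⟩
    · rw [mul_assoc, h3, ← mul_assoc, h1, mul_assoc]
    · rintro c ⟨e, rfl⟩ hc
      obtain ⟨f, hf⟩ := h2 _ ⟨z * e, by rw [mul_assoc]⟩ hc
      rw [← h1, mul_assoc, mul_assoc] at hf
      obtain ⟨q, hq⟩ := h4 (z * e) ⟨e, rfl⟩ ⟨f, simpleElement_mul_left_cancel h hm hs hf⟩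
      exact ⟨q, by rw [mul_assoc, hq]; simp only [mul_assoc]⟩

end Divisibility

/-! ### Conjugate intervals -/

section Conjugation

variable {G : Type*} [Group G] {A : Set G}

theorem IsConjGenerating.cayleyDist_conj (h : IsConjGenerating A) (k u v : G) :
    cayleyDist A (k * u * k⁻¹) (k * v * k⁻¹) = cayleyDist A u v := by
  rw [cayleyDist, cayleyDist, ← h.wordLength_conj k (u⁻¹ * v)]
  congr 1
  group

theorem PrefixLE.conj (h : IsConjGenerating A) (k : G) {u v : G} (huv : PrefixLE A u v) :
    PrefixLE A (k * u * k⁻¹) (k * v * k⁻¹) := by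
  have h1 := h.wordLength_conj k (u⁻¹ * v)
  rw [show k * (u⁻¹ * v) * k⁻¹ = (k * u * k⁻¹)⁻¹ * (k * v * k⁻¹) by group] at h1
  simp only [PrefixLE] at *
  rw [h1, h.wordLength_conj, h.wordLength_conj, huv]

variable {g g' k : G}

theorem IsIntervalEdge.conj (h : IsConjGenerating A) (hg : g' = k * g * k⁻¹) {u r : G}
    (hr : IsIntervalEdge A g u r) : IsIntervalEdge A g' (k * u * k⁻¹) (k * r * k⁻¹) := by
  refine ⟨h.conj_mem k r hr.1, ?_⟩
  have e1 : (1 : G) = k * 1 * k⁻¹ := by group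
  rw [e1, hg, show k * u * k⁻¹ * (k * r * k⁻¹) = k * (u * r) * k⁻¹ by group, h.cayleyDist_conj,
    h.cayleyDist_conj, h.cayleyDist_conj, hr.2]

/-- Conjugation by `k` on the labels of an interval. -/
def IntervalLabel.conj (h : IsConjGenerating A) (hg : g' = k * g * k⁻¹)
    (r : IntervalLabel A g) : IntervalLabel A g' :=
  ⟨k * r.1 * k⁻¹, by
    obtain ⟨u, hu⟩ := r.2
    exact ⟨_, hu.conj h hg⟩⟩

theorem IsDirectedIntervalPath.conj (h : IsConjGenerating A) (hg : g' = k * g * k⁻¹) {u v : G}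
    {U : FreeMonoid (IntervalLabel A g)} (hU : IsDirectedIntervalPath A g u v U) :
    IsDirectedIntervalPath A g' (k * u * k⁻¹) (k * v * k⁻¹)
      (FreeMonoid.map (IntervalLabel.conj h hg) U) := by
  induction hU with
  | nil => rw [map_one]; exact .nil _
  | @snoc v U r hU hr ih =>
    have := IsDirectedIntervalPath.snoc (r.conj h hg) ih (hr.conj h hg)
    rw [map_mul, FreeMonoid.map_of, show k * (v * r.1) * k⁻¹ = k * v * k⁻¹ * (k * r.1 * k⁻¹) by
      group]
    exact this

/-- Conjugation by `k` as a homomorphism of interval monoids. -/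
def intervalMonoidConj (h : IsConjGenerating A) (hg : g' = k * g * k⁻¹) :
    IntervalMonoid A g →* IntervalMonoid A g' :=
  PresentedMonoid.lift (fun r => PresentedMonoid.of _ (r.conj h hg)) (by
    rintro U V ⟨u, v, hU, hV⟩
    have key : FreeMonoid.lift (fun r : IntervalLabel A g =>
        PresentedMonoid.of (IntervalBigon A g') (r.conj h hg)) =
        (PresentedMonoid.mk (IntervalBigon A g')).comp (FreeMonoid.map (IntervalLabel.conj h hg)) :=
      FreeMonoid.hom_eq fun r => rfl
    rw [key]
    exact PresentedMonoid.mk_eq_mk_of_rel ⟨_, _, hU.conj h hg, hV.conj h hg⟩)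

theorem intervalMonoidConj_of (h : IsConjGenerating A) (hg : g' = k * g * k⁻¹)
    (r : IntervalLabel A g) : intervalMonoidConj h hg (PresentedMonoid.of _ r) =
      PresentedMonoid.of _ (r.conj h hg) := rfl

theorem intervalMonoidConj_simpleElement (h : IsConjGenerating A) (hg : g' = k * g * k⁻¹) {u : G}
    (hu : PrefixLE A u g) : intervalMonoidConj h hg (simpleElement A g u) =
      simpleElement A g' (k * u * k⁻¹) := by
  obtain ⟨U, hU⟩ := exists_isDirectedIntervalPath h (.one_left A u) hu
  have hU' := hU.conj h hg
  rw [show k * 1 * k⁻¹ = (1 : G) by group] at hU'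
  rw [simpleElement_eq hU, simpleElement_eq hU']
  have key : (intervalMonoidConj h hg).comp (PresentedMonoid.mk (IntervalBigon A g)) =
      (PresentedMonoid.mk (IntervalBigon A g')).comp (FreeMonoid.map (IntervalLabel.conj h hg)) :=
    FreeMonoid.hom_eq fun r => rfl
  exact DFunLike.congr_fun key U

theorem intervalMonoidConj_conj (h : IsConjGenerating A) {k' : G} (hk : k' * k = 1)
    (hg : g' = k * g * k⁻¹) (hg' : g = k' * g' * k'⁻¹) (x : IntervalMonoid A g) :
    intervalMonoidConj h hg' (intervalMonoidConj h hg x) = x := by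
  have : (intervalMonoidConj h hg').comp (intervalMonoidConj h hg) = MonoidHom.id _ := by
    refine PresentedMonoid.ext _ fun r => ?_
    simp only [MonoidHom.comp_apply, intervalMonoidConj_of, MonoidHom.id_apply]
    congr 1
    refine Subtype.ext ?_
    obtain rfl : k' = k⁻¹ := eq_inv_of_mul_eq_one_left hk
    simp only [IntervalLabel.conj]
    group
  exact DFunLike.congr_fun this x

end Conjugation

/-! ### The length function -/

section Length

variable {G : Type*} [Group G] {A : Set G} {g : G} (h : IsConjGenerating A)

theorem IsDirectedIntervalPath.wordLength_eq (h : IsConjGenerating A) {u v : G}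
    {U : FreeMonoid (IntervalLabel A g)}
    (hU : IsDirectedIntervalPath A g u v U) :
    (FreeMonoid.lift (fun _ : IntervalLabel A g => Multiplicative.ofAdd 1) U).toAdd +
      wordLength A u = wordLength A v := by
  induction hU with
  | nil => simp
  | snoc r _ hr ih =>
    obtain ⟨_, h1, h2, _⟩ := (isIntervalEdge_iff h _ _).1 hr
    simp only [PrefixLE, inv_mul_cancel_left] at h2
    rw [map_mul, FreeMonoid.lift_eval_of, toAdd_mul, toAdd_ofAdd]
    omega

/-- The length of an element of the interval monoid, as a word in the labels. -/
noncomputable def intervalMonoidLength : IntervalMonoid A g →* Multiplicative ℕ :=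
  PresentedMonoid.lift (fun _ => Multiplicative.ofAdd 1) (by
    rintro U V ⟨u, v, hU, hV⟩
    have h1 := hU.wordLength_eq h
    have h2 := hV.wordLength_eq h
    exact Multiplicative.toAdd.injective (by omega))

theorem eq_one_of_intervalMonoidLength_eq_one (x : IntervalMonoid A g)
    (hx : intervalMonoidLength h x = 1) : x = 1 := by
  revert hx
  refine PresentedMonoid.inductionOn x fun U => ?_
  induction U using FreeMonoid.recOn with
  | one => intro _; exact map_one _
  | of_mul r U ih =>
    intro hx
    rw [map_mul, map_mul] at hx
    have := congrArg Multiplicative.toAdd hx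
    rw [toAdd_mul, toAdd_one] at this
    have h1 : (intervalMonoidLength h (PresentedMonoid.mk (IntervalBigon A g)
      (FreeMonoid.of r))).toAdd = 1 := rfl
    omega

end Length

/-! ### The Garside element -/

section GarsideElement

variable {G : Type*} [Group G] {A : Set G} {g : G}

/-- Both sides equal s·(s⁻¹p)·(p⁻¹sp), because p factors as s·(s⁻¹p) and also as (s⁻¹p)·(p⁻¹sp). -/
theorem simpleElement_mul_simpleElement_of_le (h : IsConjGenerating A) {s p : G}
    (hs : PrefixLE A s p) (hp : PrefixLE A p g) :
    simpleElement A g s * simpleElement A g p =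
      simpleElement A g p * simpleElement A g (p⁻¹ * s * p) := by
  have e1 : simpleElement A g s * simpleElement A g (s⁻¹ * p) = simpleElement A g p := by
    rw [simpleElement_mul h (by rwa [mul_inv_cancel_left]) (by rwa [mul_inv_cancel_left]),
      mul_inv_cancel_left]
  have e2 : s⁻¹ * p * (p⁻¹ * s * p) = p := by group
  have e3 : simpleElement A g (s⁻¹ * p) * simpleElement A g (p⁻¹ * s * p) =
      simpleElement A g p := by
    rw [simpleElement_mul h (by rw [e2]; exact hs.suffix h) (by rwa [e2]), e2]
  rw [← e1, mul_assoc, e3, e1]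

/-- Conjugation by the Garside element. -/
def garsideConj (h : IsConjGenerating A) : IntervalMonoid A g →* IntervalMonoid A g :=
  intervalMonoidConj h (k := g⁻¹) (by group)

/-- The inverse of conjugation by the Garside element. -/
def garsideConjInv (h : IsConjGenerating A) : IntervalMonoid A g →* IntervalMonoid A g :=
  intervalMonoidConj h (k := g) (by group)

theorem garsideConj_garsideConjInv (h : IsConjGenerating A) (x : IntervalMonoid A g) :
    garsideConj h (garsideConjInv h x) = x :=
  intervalMonoidConj_conj h (by group) _ _ x

theorem garsideConjInv_garsideConj (h : IsConjGenerating A) (x : IntervalMonoid A g) :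
    garsideConjInv h (garsideConj h x) = x :=
  intervalMonoidConj_conj h (by group) _ _ x

theorem mul_garsideElement (h : IsConjGenerating A) (x : IntervalMonoid A g) :
    x * simpleElement A g g = simpleElement A g g * garsideConj h x := by
  induction x using IntervalMonoid.induction h with
  | one => simp
  | mul s x hs ih =>
    rw [mul_assoc, ih, ← mul_assoc, simpleElement_mul_simpleElement_of_le h hs (.refl A g), map_mul, mul_assoc]
    congr 2
    rw [garsideConj, intervalMonoidConj_simpleElement h _ hs, inv_inv]

theorem garsideElement_mul (h : IsConjGenerating A) (x : IntervalMonoid A g) :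
    simpleElement A g g * x = garsideConjInv h x * simpleElement A g g := by
  rw [mul_garsideElement h, garsideConj_garsideConjInv]

theorem mul_garsideElement_pow (h : IsConjGenerating A) (n : ℕ) (x : IntervalMonoid A g) :
    x * simpleElement A g g ^ n = simpleElement A g g ^ n * (garsideConj h)^[n] x := by
  induction n generalizing x with
  | zero => simp
  | succ n ih =>
    rw [pow_succ', ← mul_assoc, mul_garsideElement h, mul_assoc, ih, ← mul_assoc,
      Function.iterate_succ_apply]

theorem garsideElement_pow_mul (h : IsConjGenerating A) (n : ℕ) (x : IntervalMonoid A g) :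
    simpleElement A g g ^ n * x = (garsideConjInv h)^[n] x * simpleElement A g g ^ n := by
  induction n generalizing x with
  | zero => simp
  | succ n ih =>
    rw [pow_succ, mul_assoc, garsideElement_mul h, ← mul_assoc, ih, mul_assoc,
      Function.iterate_succ_apply]

theorem exists_mul_eq_garsideElement (h : IsConjGenerating A) {s : G} (hs : PrefixLE A s g) :
    ∃ z, simpleElement A g s * z = simpleElement A g g :=
  ⟨_, by
    rw [simpleElement_mul h (v := s⁻¹ * g) (by rwa [mul_inv_cancel_left])
      (by rw [mul_inv_cancel_left]; exact .refl _ _), mul_inv_cancel_left]⟩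

theorem exists_mul_eq_garsideElement' (h : IsConjGenerating A) {s : G} (hs : PrefixLE A s g) :
    ∃ z, z * simpleElement A g s = simpleElement A g g := by
  have h1 := (hs.conj h g).suffix h
  have h2 : g * g * g⁻¹ = g := by group
  rw [h2] at h1
  have h3 := hs.conj h g
  rw [h2] at h3
  have e : (g * s * g⁻¹)⁻¹ * g * s = g * s⁻¹ * s := by group
  refine ⟨simpleElement A g ((g * s * g⁻¹)⁻¹ * g), ?_⟩
  have e : (g * s * g⁻¹)⁻¹ * g * s = g := by group
  rw [simpleElement_mul h (by rwa [e]) (by rw [e]; exact .refl _ _), e]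

/-- Each simple factor has a complement in Δ. Moving that complement past the power already built
only twists it by the Garside automorphism. -/
theorem exists_mul_eq_garsideElement_pow (h : IsConjGenerating A) (x : IntervalMonoid A g) :
    ∃ n y, x * y = simpleElement A g g ^ n := by
  induction x using IntervalMonoid.induction h with
  | one => exact ⟨0, 1, by simp⟩
  | mul s x hs ih =>
    obtain ⟨n, y, hy⟩ := ih
    obtain ⟨z, hz⟩ := exists_mul_eq_garsideElement h hs
    refine ⟨n + 1, y * (garsideConj h)^[n] z, ?_⟩
    rw [mul_assoc, ← mul_assoc x, hy, ← mul_garsideElement_pow, ← mul_assoc, hz, pow_succ']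

theorem exists_mul_eq_garsideElement_pow' (h : IsConjGenerating A) (x : IntervalMonoid A g) :
    ∃ n y, y * x = simpleElement A g g ^ n := by
  -- `IntervalMonoid.induction` splits simple factors off on the left, so for complements on the
  -- left the claim is generalized over the part x already processed.
  suffices H : ∀ x : IntervalMonoid A g, (∃ n y, y * x = simpleElement A g g ^ n) →
      ∀ z : IntervalMonoid A g, ∃ n y, y * (x * z) = simpleElement A g g ^ n by
    simpa using H 1 ⟨0, 1, by simp⟩ x
  intro x hx z
  induction z using IntervalMonoid.induction h generalizing x with
  | one => simpa using hx
  | mul s z hs ih =>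
    rw [← mul_assoc]
    refine ih _ ?_
    obtain ⟨n, y, hy⟩ := hx
    obtain ⟨w, hw⟩ := exists_mul_eq_garsideElement' h hs
    refine ⟨n + 1, (garsideConjInv h)^[n] w * y, ?_⟩
    rw [← mul_assoc, mul_assoc _ y, hy, ← garsideElement_pow_mul h, mul_assoc, hw, pow_succ]

end GarsideElement

/-! ### Gcds, lcms and right divisibility -/

section Lattice

variable {G : Type*} [Group G] {A : Set G} {g : G} {m : G → G → G}
  (h : IsConjGenerating A) (hm : IsPrefixMeet A g m)

include h hm

/-- Completing a to a power of Δ and moving this power to the left reduces the claim to left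
cancellation and injectivity of the Garside automorphism. -/
theorem intervalMonoid_right_cancel (a b c : IntervalMonoid A g) (e : b * a = c * a) : b = c := by
  obtain ⟨n, y, hy⟩ := exists_mul_eq_garsideElement_pow h a
  have e1 : b * simpleElement A g g ^ n = c * simpleElement A g g ^ n := by
    rw [← hy, ← mul_assoc, e, mul_assoc]
  rw [mul_garsideElement_pow h, mul_garsideElement_pow h] at e1
  have inj : Function.Injective (garsideConj h : IntervalMonoid A g → IntervalMonoid A g) :=
    Function.LeftInverse.injective (garsideConjInv_garsideConj h)
  exact inj.iterate n (intervalMonoid_left_cancel h hm _ _ _ e1)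

variable (hj : HasPrefixJoins A g)
include hj

theorem hasGcdsAndLcms_isLeftDivisor :
    HasGcdsAndLcms (IsLeftDivisor : IntervalMonoid A g → IntervalMonoid A g → Prop) := by
  have lcm : ∀ a b : IntervalMonoid A g, ∃ m, IsLeftDivisor a m ∧ IsLeftDivisor b m ∧
      ∀ c, IsLeftDivisor a c → IsLeftDivisor b c → IsLeftDivisor m c := fun a b => by
    obtain ⟨x', y', e, hmin⟩ := exists_left_lcm h hm hj a b
    exact ⟨a * y', ⟨y', rfl⟩, ⟨x', e⟩, hmin⟩
  refine fun a b => ⟨?_, lcm a b⟩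
  -- A common divisor of maximal length is a gcd: its lcm with another common divisor is again a
  -- common divisor, so it cannot be longer.
  let S : Set ℕ := {n | ∃ d, IsLeftDivisor d a ∧ IsLeftDivisor d b ∧
    (intervalMonoidLength h d).toAdd = n}
  have hlen : ∀ d e : IntervalMonoid A g, (intervalMonoidLength h (d * e)).toAdd =
      (intervalMonoidLength h d).toAdd + (intervalMonoidLength h e).toAdd := fun d e => by
    rw [map_mul, toAdd_mul]
  have hS : S.Nonempty := ⟨_, 1, ⟨a, by simp⟩, ⟨b, by simp⟩, rfl⟩
  have hb : BddAbove S := by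
    refine ⟨(intervalMonoidLength h a).toAdd, ?_⟩
    rintro n ⟨d, ⟨e, rfl⟩, -, rfl⟩
    rw [hlen]; omega
  obtain ⟨d, hda, hdb, hd⟩ := Nat.sSup_mem hS hb
  refine ⟨d, hda, hdb, fun c hca hcb => ?_⟩
  obtain ⟨k, ⟨e, rfl⟩, hck, hk⟩ := lcm d c
  have h1 : (intervalMonoidLength h (d * e)).toAdd ≤ sSup S :=
    le_csSup hb ⟨_, hk a hda hca, hk b hdb hcb, rfl⟩
  rw [hlen] at h1
  have h2 : e = 1 := eq_one_of_intervalMonoidLength_eq_one h e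
    (Multiplicative.toAdd.injective (by rw [toAdd_one]; omega))
  rwa [h2, mul_one] at hck

theorem hasGcdsAndLcms_isRightDivisor :
    HasGcdsAndLcms (IsRightDivisor : IntervalMonoid A g → IntervalMonoid A g → Prop) := by
  have common : ∀ a b : IntervalMonoid A g, ∃ n a' b', a' * a = simpleElement A g g ^ n ∧
      b' * b = simpleElement A g g ^ n := fun a b => by
    obtain ⟨i, x, hx⟩ := exists_mul_eq_garsideElement_pow' h a
    obtain ⟨j, y, hy⟩ := exists_mul_eq_garsideElement_pow' h b
    exact ⟨i + j, simpleElement A g g ^ j * x, simpleElement A g g ^ i * y,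
      by rw [mul_assoc, hx, ← pow_add, add_comm], by rw [mul_assoc, hy, ← pow_add]⟩
  have gcd : ∀ a b : IntervalMonoid A g, ∃ d, IsRightDivisor d a ∧ IsRightDivisor d b ∧
      ∀ c, IsRightDivisor c a → IsRightDivisor c b → IsRightDivisor c d := fun a b => by
    obtain ⟨n, a', b', ha, hb⟩ := common a b
    -- Right gcds are complements of left lcms: if a'a = b'b = Δⁿ and l is the left lcm of a' and
    -- b', then Δⁿ = l·d with d the right gcd of a and b.
    obtain ⟨-, l, ⟨e, rfl⟩, ⟨f, hf⟩, hmin⟩ := hasGcdsAndLcms_isLeftDivisor h hm hj a' b'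
    obtain ⟨d, hd⟩ := hmin _ ⟨a, ha.symm⟩ ⟨b, hb.symm⟩
    refine ⟨d, ⟨e, ?_⟩, ⟨f, ?_⟩, ?_⟩
    · exact intervalMonoid_left_cancel h hm a' _ _ (by rw [ha, hd, mul_assoc])
    · exact intervalMonoid_left_cancel h hm b' _ _ (by rw [hb, hd, hf, mul_assoc])
    · rintro c ⟨p, rfl⟩ ⟨q, rfl⟩
      have e1 : a' * p = b' * q :=
        intervalMonoid_right_cancel h hm c _ _ (by rw [mul_assoc, mul_assoc, ha, hb])
      obtain ⟨k, hk⟩ := hmin (a' * p) ⟨p, rfl⟩ ⟨q, e1⟩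
      refine ⟨k, intervalMonoid_left_cancel h hm (a' * e) _ _ ?_⟩
      rw [← hd, ← ha, ← mul_assoc, ← mul_assoc, hk]
  refine fun a b => ⟨gcd a b, ?_⟩
  obtain ⟨n, a', b', ha, hb⟩ := common a b
  -- Dually, a common left multiple of minimal length is the lcm: its right gcd with another one is
  -- still a common multiple.
  let S : Set ℕ := {n | ∃ d, IsRightDivisor a d ∧ IsRightDivisor b d ∧
    (intervalMonoidLength h d).toAdd = n}
  have hlen : ∀ d e : IntervalMonoid A g, (intervalMonoidLength h (d * e)).toAdd =
      (intervalMonoidLength h d).toAdd + (intervalMonoidLength h e).toAdd := fun d e => by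
    rw [map_mul, toAdd_mul]
  have hS : S.Nonempty := ⟨_, _, ⟨a', ha.symm⟩, ⟨b', hb.symm⟩, rfl⟩
  obtain ⟨d, hda, hdb, hd⟩ := Nat.sInf_mem hS
  refine ⟨d, hda, hdb, fun c hca hcb => ?_⟩
  obtain ⟨k, ⟨e, he⟩, hkc, hk⟩ := gcd d c
  have h1 : sInf S ≤ (intervalMonoidLength h k).toAdd :=
    Nat.sInf_le ⟨k, hk a hda hca, hk b hdb hcb, rfl⟩
  rw [← hd, he, hlen] at h1
  have h2 : e = 1 := eq_one_of_intervalMonoidLength_eq_one h e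
    (Multiplicative.toAdd.injective (by rw [toAdd_one]; omega))
  rwa [he, h2, one_mul]

theorem isGarsideMonoid_intervalMonoid :
    IsGarsideMonoid (IntervalMonoid A g) (simpleElement A g g) where
  left_cancel := intervalMonoid_left_cancel h hm
  right_cancel := intervalMonoid_right_cancel h hm
  superadditive_length := ⟨fun x => (intervalMonoidLength h x).toAdd,
    fun a b => by simp,
    fun a ha h0 => ha (eq_one_of_intervalMonoidLength_eq_one h a
      (Multiplicative.toAdd.injective h0))⟩
  left_lattice := hasGcdsAndLcms_isLeftDivisor h hm hj
  right_lattice := hasGcdsAndLcms_isRightDivisor h hm hj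
  divisors_coincide a := by
    constructor
    · rintro ⟨y, hy⟩
      refine ⟨garsideConjInv h y, intervalMonoid_right_cancel h hm y _ _ ?_⟩
      rw [mul_assoc, ← hy, garsideElement_mul h]
    · rintro ⟨y, hy⟩
      refine ⟨garsideConj h y, intervalMonoid_left_cancel h hm y _ _ ?_⟩
      rw [← mul_assoc, ← hy, mul_garsideElement h]
  divisors_generate := by
    refine top_unique ?_
    rw [← PresentedMonoid.closure_range_of]
    refine Submonoid.closure_mono ?_
    rintro _ ⟨r, rfl⟩
    obtain ⟨z, hz⟩ := exists_mul_eq_garsideElement h (r.prefixLE h)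
    exact ⟨z, by rw [← hz, simpleElement_label h]⟩

end Lattice

/-! ### The group of fractions -/

section Fractions

variable {G : Type*} [Group G] {A : Set G} {g : G}

theorem IsIntervalPath.lift_eq {H : Type*} [Group H] (f : IntervalLabel A g → H) (N : G → H)
    (hN : ∀ u (r : IntervalLabel A g), IsIntervalEdge A g u r.1 → N (u * r.1) = N u * f r)
    {u v : G} {x : FreeGroup (IntervalLabel A g)} (hx : IsIntervalPath A g u v x) :
    FreeGroup.lift f x = (N u)⁻¹ * N v := by
  induction hx with
  | nil => simp
  | forward r _ hr ih => rw [map_mul, ih, FreeGroup.lift_apply_of, hN _ r hr, mul_assoc]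
  | backward r _ hr ih =>
    rw [map_mul, ih, map_inv, FreeGroup.lift_apply_of, hN _ r hr, mul_assoc, mul_assoc, mul_inv_cancel,
      mul_one]

/-- A function on the group whose increments along the edges of `[1, g]` depend only on the label
defines a homomorphism on the interval group. -/
def IntervalGroup.liftPotential {H : Type*} [Group H] (f : IntervalLabel A g → H) (N : G → H)
    (hN : ∀ u (r : IntervalLabel A g), IsIntervalEdge A g u r.1 → N (u * r.1) = N u * f r) :
    IntervalGroup A g →* H :=
  PresentedGroup.toGroup (f := f) (by
    rintro x ⟨u, hx⟩
    rw [hx.lift_eq f N hN, inv_mul_cancel])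

theorem IntervalGroup.liftPotential_of {H : Type*} [Group H] (f : IntervalLabel A g → H)
    (N : G → H)
    (hN : ∀ u (r : IntervalLabel A g), IsIntervalEdge A g u r.1 → N (u * r.1) = N u * f r)
    (r : IntervalLabel A g) :
    IntervalGroup.liftPotential f N hN (PresentedGroup.of r) = f r :=
  PresentedGroup.toGroup.of _

theorem intervalMonoidToGroup_of (r : IntervalLabel A g) :
    intervalMonoidToGroup A g (PresentedMonoid.of _ r) = PresentedGroup.of r := rfl

variable {m : G → G → G}

theorem isGroupOfFractions_intervalMonoidToGroup (h : IsConjGenerating A)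
    (hm : IsPrefixMeet A g m) (hj : HasPrefixJoins A g) :
    IsGroupOfFractions (intervalMonoidToGroup A g) := by
  have right_mul : ∀ a b : IntervalMonoid A g, ∃ c d, c * a = d * b := fun a b => by
    obtain ⟨-, l, ⟨c, hc⟩, ⟨d, hd⟩, -⟩ := hasGcdsAndLcms_isRightDivisor h hm hj a b
    exact ⟨c, d, hc.symm.trans hd⟩
  have left_fraction : ∀ x : IntervalGroup A g, ∃ a b : IntervalMonoid A g,
      x = (intervalMonoidToGroup A g a)⁻¹ * intervalMonoidToGroup A g b := fun x => by
    have hx : x ∈ Subgroup.closure (Set.range (PresentedGroup.of (rels := intervalLoops A g))) := by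
      rw [PresentedGroup.closure_range_of]; trivial
    induction hx using Subgroup.closure_induction_right with
    | one => exact ⟨1, 1, by simp⟩
    | mul_right x y _ hy ih =>
      obtain ⟨r, rfl⟩ := hy
      obtain ⟨a, b, rfl⟩ := ih
      exact ⟨a, b * PresentedMonoid.of _ r, by
        rw [map_mul, intervalMonoidToGroup_of, mul_assoc]⟩
    | mul_inv_cancel x y _ hy ih =>
      obtain ⟨r, rfl⟩ := hy
      obtain ⟨a, b, rfl⟩ := ih
      -- The Ore condition c·b = d·r turns b·r⁻¹ into c⁻¹·d.
      obtain ⟨c, d, hcd⟩ := right_mul b (PresentedMonoid.of _ r)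
      refine ⟨c * a, d, ?_⟩
      have := congrArg (intervalMonoidToGroup A g) hcd
      rw [map_mul, map_mul, intervalMonoidToGroup_of] at this
      rw [mul_assoc, map_mul, mul_inv_rev, mul_assoc]
      congr 1
      rw [eq_inv_mul_iff_mul_eq, ← mul_assoc]
      rw [this, mul_inv_cancel_right]
  refine ⟨?_, left_fraction, fun x => ?_⟩
  · choose c d hcd using right_mul
    let _ : OreLocalization.OreSet (⊤ : Submonoid (IntervalMonoid A g)) :=
      { ore_right_cancel := fun a b s e => ⟨1, by rw [intervalMonoid_right_cancel h hm _ _ _ e]⟩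
        oreNum := fun r s => d r s
        oreDenom := fun r s => ⟨c r s, trivial⟩
        ore_eq := fun r s => hcd r s }
    let unit : IntervalMonoid A g →
        (OreLocalization (⊤ : Submonoid (IntervalMonoid A g)) (IntervalMonoid A g))ˣ :=
      fun x => OreLocalization.numeratorUnit ⟨x, trivial⟩
    have unit_val : ∀ x, (unit x).1 = OreLocalization.numeratorHom x := fun x => rfl
    have unit_mul : ∀ x y, unit (x * y) = unit x * unit y := fun x y =>
      Units.ext (by rw [Units.val_mul, unit_val, unit_val, unit_val, map_mul])
    -- The potential sending u to its simple element maps the interval group to the units of the Ore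
    -- localization. On the monoid this map is the canonical one, which is injective by
    -- cancellation.
    let F := IntervalGroup.liftPotential (A := A) (g := g)
      (fun r => unit (PresentedMonoid.of _ r)) (fun u => unit (simpleElement A g u))
      (fun u r hr => by
        obtain ⟨_, _, h1, h2⟩ := (isIntervalEdge_iff h _ _).1 hr
        rw [← unit_mul, ← simpleElement_label h, simpleElement_mul h h1 h2])
    have hF : ((Units.coeHom _).comp F).comp (intervalMonoidToGroup A g) =
        (OreLocalization.numeratorHom : IntervalMonoid A g →* _) := by
      refine PresentedMonoid.ext _ fun r => ?_
      rw [MonoidHom.comp_apply, MonoidHom.comp_apply, intervalMonoidToGroup_of,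
        IntervalGroup.liftPotential_of]
      rfl
    intro a b hab
    have e1 : (OreLocalization.numeratorHom a :
        OreLocalization (⊤ : Submonoid (IntervalMonoid A g)) (IntervalMonoid A g)) =
        OreLocalization.numeratorHom b := by
      rw [← hF, MonoidHom.comp_apply, hab]
      rfl
    rw [OreLocalization.numeratorHom_apply, OreLocalization.numeratorHom_apply,
      OreLocalization.oreDiv_eq_iff] at e1
    obtain ⟨u, v, h1, h2⟩ := e1
    simp only [Submonoid.smul_def, smul_eq_mul, OneMemClass.coe_one, mul_one] at h1 h2
    rw [h2] at h1
    exact (intervalMonoid_left_cancel h hm _ _ _ h1).symm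
  · obtain ⟨a, b, rfl⟩ := left_fraction x
    obtain ⟨x', y', e, -⟩ := exists_left_lcm h hm hj a b
    refine ⟨y', x', ?_⟩
    have := congrArg (intervalMonoidToGroup A g) e
    rw [map_mul, map_mul] at this
    rw [inv_mul_eq_iff_eq_mul, ← mul_assoc, this, mul_inv_cancel_right]

end Fractions

/-! ### Lattice intervals are Garside -/

theorem isGarsideInterval_of_hasPrefixJoins {G : Type*} [Group G] {A : Set G} {g : G}
    {m : G → G → G} (h : IsConjGenerating A) (hm : IsPrefixMeet A g m)
    (hj : HasPrefixJoins A g) : IsGarsideInterval A g := by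
  refine ⟨simpleElement A g g, exists_isDirectedIntervalPath h (.one_left A g) (.refl A g),
    fun U hU => (simpleElement_eq hU).symm, isGarsideMonoid_intervalMonoid h hm hj, ?_,
    isGroupOfFractions_intervalMonoidToGroup h hm hj⟩
  have key : ∀ a : {a : IntervalMonoid A g // IsLeftDivisor a (simpleElement A g g)},
      PrefixLE A (intervalMonoidEval A g a.1) g ∧
        a.1 = simpleElement A g (intervalMonoidEval A g a.1) := fun a => by
    obtain ⟨u, hu, e⟩ := eq_simpleElement_of_isLeftDivisor h hm (.refl A g) a.2
    rw [e, intervalMonoidEval_simpleElement h hu]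
    exact ⟨hu, rfl⟩
  refine ⟨⟨fun a => ⟨intervalMonoidEval A g a.1, (mem_cayleyInterval_iff _).2 (key a).1⟩,
    fun u => ⟨simpleElement A g u.1, isLeftDivisor_of_prefixLE h
      ((mem_cayleyInterval_iff _).1 u.2) (.refl A g)⟩, fun a => Subtype.ext (key a).2.symm,
    fun u => Subtype.ext
      (intervalMonoidEval_simpleElement h ((mem_cayleyInterval_iff _).1 u.2))⟩,
    fun a => rfl, fun a b => ?_⟩
  rw [cayleyInterval_le_iff]
  change _ ↔ PrefixLE A (intervalMonoidEval A g a.1) (intervalMonoidEval A g b.1)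
  constructor
  · intro hab
    rw [(key a).2, (key b).2] at hab
    exact prefixLE_of_isLeftDivisor h hm (key a).1 (key b).1 hab
  · intro hab
    rw [(key a).2, (key b).2]
    exact isLeftDivisor_of_prefixLE h hab (key b).1

theorem isGarsideInterval_of_isLatticePoset {G : Type*} [Group G] {A : Set G} {g : G}
    (h : IsConjGenerating A)
    (hL : @IsLatticePoset (CayleyInterval A g) (cayleyIntervalPartialOrder h.closure_eq_top g)) :
    IsGarsideInterval A g := by
  classical
  have hmeet : ∀ u v, ∃ m, PrefixLE A u g → PrefixLE A v g → PrefixLE A m u ∧ PrefixLE A m v ∧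
      ∀ c, PrefixLE A c u → PrefixLE A c v → PrefixLE A c m := fun u v => by
    by_cases huv : PrefixLE A u g ∧ PrefixLE A v g
    · obtain ⟨hu, hv⟩ := huv
      obtain ⟨⟨m, hm⟩, -⟩ := hL ⟨u, (mem_cayleyInterval_iff u).2 hu⟩
        ⟨v, (mem_cayleyInterval_iff v).2 hv⟩
      refine ⟨m.1, fun _ _ => ⟨?_, ?_, fun c hcu hcv => ?_⟩⟩
      · exact (cayleyInterval_le_iff _ _).1 (hm.1 (Set.mem_insert _ _))
      · exact (cayleyInterval_le_iff _ _).1 (hm.1 (Set.mem_insert_of_mem _ rfl))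
      · refine (cayleyInterval_le_iff ⟨c, (mem_cayleyInterval_iff c).2 (hcu.trans h hu)⟩ m).1
          (hm.2 ?_)
        rintro _ (rfl | rfl)
        · exact (cayleyInterval_le_iff _ _).2 hcu
        · exact (cayleyInterval_le_iff _ _).2 hcv
    · exact ⟨1, fun hu hv => absurd ⟨hu, hv⟩ huv⟩
  choose m hm using hmeet
  refine isGarsideInterval_of_hasPrefixJoins (m := m) h
    ⟨fun u v hu hv => (hm u v hu hv).1, fun u v hu hv => (hm u v hu hv).2.1,
      fun u v c hu hv => (hm u v hu hv).2.2 c⟩ fun u v hu hv => ?_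
  obtain ⟨-, j, hj⟩ := hL ⟨u, (mem_cayleyInterval_iff u).2 hu⟩
    ⟨v, (mem_cayleyInterval_iff v).2 hv⟩
  refine ⟨j.1, ?_, ?_, (mem_cayleyInterval_iff _).1 j.2, fun c hcg hcu hcv => ?_⟩
  · exact (cayleyInterval_le_iff _ _).1 (hj.1 (Set.mem_insert _ _))
  · exact (cayleyInterval_le_iff _ _).1 (hj.1 (Set.mem_insert_of_mem _ rfl))
  · refine (cayleyInterval_le_iff j ⟨c, (mem_cayleyInterval_iff c).2 hcg⟩).1 (hj.2 ?_)
    rintro _ (rfl | rfl)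
    · exact (cayleyInterval_le_iff _ _).2 hcu
    · exact (cayleyInterval_le_iff _ _).2 hcv

/-! ### The reflections of the affine Weyl group of type `G₂` acting on the coroot lattice -/

/-- The positive coroots of `G₂`, named after their coordinates in the basis of simple coroots. -/
inductive G₂Coroot
  | v10 | v01 | v31 | v11 | v32 | v21

/-- The affine reflection `x ↦ x - (f x - n) v`, where `v` is a coroot and `f` its root. -/
def affineReflectionFun : G₂Coroot → ℤ → ℤ × ℤ → ℤ × ℤ
  | .v10, n, z => (3 * z.2 - z.1 + n, z.2)
  | .v01, n, z => (z.1, z.1 - z.2 + n)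
  | .v31, n, z => (3 * z.2 - 2 * z.1 + 3 * n, 2 * z.2 - z.1 + n)
  | .v11, n, z => (2 * z.1 - 3 * z.2 + n, z.1 - 2 * z.2 + n)
  | .v32, n, z => (z.1 - 3 * z.2 + 3 * n, 2 * n - z.2)
  | .v21, n, z => (2 * n - z.1, z.2 - z.1 + n)

theorem affineReflectionFun_involutive (v : G₂Coroot) (n : ℤ) :
    Function.Involutive (affineReflectionFun v n) := by
  intro z
  cases v <;> simp only [affineReflectionFun] <;> ext <;> ring

/-- The affine reflection of a coroot and a level, as a permutation of the coroot lattice. -/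
def affineReflection (v : G₂Coroot) (n : ℤ) : Equiv.Perm (ℤ × ℤ) :=
  (affineReflectionFun_involutive v n).toPerm

theorem affineReflection_apply (v : G₂Coroot) (n : ℤ) (z : ℤ × ℤ) :
    affineReflection v n z = affineReflectionFun v n z := rfl

theorem affineReflection_mul_self (v : G₂Coroot) (n : ℤ) :
    affineReflection v n * affineReflection v n = 1 :=
  Equiv.ext (affineReflectionFun_involutive v n)

/-- The glide reflection given by the Coxeter element `s₃ s₁ s₂`. -/
def affineGlide : Equiv.Perm (ℤ × ℤ) :=
  affineReflection .v01 0 * (affineReflection .v21 1 * affineReflection .v10 0)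

theorem affineGlide_apply (z : ℤ × ℤ) : affineGlide z = (z.1 - 3 * z.2 + 2, 1 - z.2) := by
  simp only [affineGlide, Equiv.Perm.mul_apply, affineReflection_apply, affineReflectionFun]
  ext <;> ring

/-- The labels of the dual presentation: `a`, `b`, `c` are the conjugates of `s₂`, `s₁`, `s₃` under
the powers of the glide reflection, and `h` are the reflections in lines parallel to its axis. -/
inductive DualLabel
  | a (k : ℤ) | b (k : ℤ) | c (k : ℤ) | h (k : ℤ)

/-- The label of an affine reflection. -/
def affineLabel : G₂Coroot → ℤ → DualLabel
  | .v10, n => .a (-n)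
  | .v01, n => .c (2 * n)
  | .v31, n => .c (1 - 2 * n)
  | .v11, n => .b (2 * n - 1)
  | .v32, n => .h n
  | .v21, n => .b (2 - 2 * n)

/-- Parity separates the coroots sharing a letter: even c from `v01` and odd c from `v31`, even b
from `v21` and odd b from `v11`. -/
theorem affineLabel_injective {u v : G₂Coroot} {m n : ℤ} (h : affineLabel u m = affineLabel v n) :
    u = v ∧ m = n := by
  cases u <;> cases v <;>
    simp only [affineLabel, DualLabel.a.injEq, DualLabel.b.injEq, DualLabel.c.injEq,
      DualLabel.h.injEq, reduceCtorEq] at h <;>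
    first
    | (exfalso; omega)
    | exact ⟨rfl, by omega⟩

/-- The triples of reflections whose product is the glide reflection. -/
def DualChain : DualLabel → DualLabel → DualLabel → Prop
  | .a i, .b j, .c k => j = i + 1 ∧ k = i + 1
  | .a i, .c j, .b k => j = i + 1 ∧ k = i + 1
  | .b i, .a j, .c k => j = i ∧ k = i + 1
  | .b i, .b j, .c k => j = i - 1 ∧ k = i
  | .b i, .b j, .h k => j = i + 2 ∧ (k = 0 ∨ k = 1) ∧ (i - k) % 2 = 0
  | .b i, .c j, .a k => j = i ∧ k = i
  | .b i, .c j, .b k => j = i + 1 ∧ k = i + 2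
  | .b i, .h j, .b k => (j = 0 ∨ j = 1) ∧ (i - j) % 2 = 0 ∧ k = i - 1
  | .c i, .a j, .b k => j = i ∧ k = i + 1
  | .c i, .b j, .a k => j = i ∧ k = i
  | .c i, .b j, .b k => j = i + 1 ∧ k = i
  | .h i, .b j, .b k => (i = 0 ∨ i = 1) ∧ (j - i) % 2 = 1 ∧ k = j + 2
  | _, _, _ => False

/-- Values at (0, 0), (1, 0) and (0, 1) determine an affine map. Comparing them leaves, for each of
the 216 triples of coroots, a linear system over ℤ in the three levels. -/
theorem dualChain_of_mul_eq {u v w : G₂Coroot} {l m n : ℤ}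
    (e : affineReflection u l * affineReflection v m * affineReflection w n = affineGlide) :
    DualChain (affineLabel u l) (affineLabel v m) (affineLabel w n) := by
  have h0 := Equiv.congr_fun e (0, 0)
  have h1 := Equiv.congr_fun e (1, 0)
  have h2 := Equiv.congr_fun e (0, 1)
  simp only [Equiv.Perm.mul_apply, affineGlide_apply, affineReflection_apply, Prod.ext_iff]
    at h0 h1 h2
  clear e
  obtain ⟨h0, h0'⟩ := h0
  obtain ⟨h1, h1'⟩ := h1
  obtain ⟨h2, h2'⟩ := h2
  cases u <;> cases v <;> cases w <;> simp only [affineReflectionFun] at h0 h0' h1 h1' h2 h2' <;>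
    first
    | (exfalso; omega)
    | (simp only [affineLabel, DualChain]; omega)

/-- The first and last terms of the triples of reflections whose product is the glide
reflection. -/
def DualIncident : DualLabel → DualLabel → Prop
  | .a i, .c k => k = i + 1
  | .a i, .b k => k = i + 1
  | .b i, .c k => k = i ∨ k = i + 1
  | .b i, .h k => (k = 0 ∨ k = 1) ∧ (i - k) % 2 = 0
  | .b i, .a k => k = i
  | .b i, .b k => k = i + 2 ∨ k = i - 1
  | .c i, .b k => k = i ∨ k = i + 1
  | .c i, .a k => k = i
  | .h i, .b k => (i = 0 ∨ i = 1) ∧ (k - i) % 2 = 1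
  | _, _ => False

theorem DualChain.incident {x y z : DualLabel} (h : DualChain x y z) : DualIncident x z := by
  cases x <;> cases y <;> cases z <;> simp only [DualChain, DualIncident] at h ⊢ <;> omega

/-- Absence of 4-cycles in the incidence relation between first and last factors: this is the
combinatorial content of the lattice property. -/
theorem DualIncident.eq_or_eq {x x' z z' : DualLabel} (h₁ : DualIncident x z)
    (h₂ : DualIncident x' z) (h₃ : DualIncident x z') (h₄ : DualIncident x' z') :
    x = x' ∨ z = z' := by
  cases x <;> cases z <;> simp only [DualIncident] at h₁ <;>
    cases x' <;> simp only [DualIncident] at h₂ <;>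
    cases z' <;> simp only [DualIncident] at h₃ h₄ <;>
    simp only [DualLabel.a.injEq, DualLabel.b.injEq, DualLabel.c.injEq, DualLabel.h.injEq,
      reduceCtorEq, or_false, false_or] <;> omega

/-! ### The Coxeter group of type `G̃₂` acts faithfully on the coroot lattice -/

theorem Equiv.addRight_zpow_apply {V : Type*} [AddGroup V] (t : V) (n : ℤ) (z : V) :
    (Equiv.addRight t ^ n) z = z + n • t := by
  induction n with
  | zero => simp
  | succ n ih =>
    rw [add_comm, zpow_add, zpow_one, Equiv.Perm.mul_apply, ih, add_comm, add_zsmul, one_zsmul,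
      ← add_assoc, Equiv.coe_addRight]
  | pred n ih =>
    rw [sub_eq_add_neg, add_comm, zpow_add, zpow_neg_one, Equiv.Perm.mul_apply, ih, add_comm,
      add_zsmul, neg_one_zsmul, ← add_assoc, Equiv.Perm.inv_eq_iff_eq]
    exact (neg_add_cancel_right _ _).symm

section Translations

variable {G : Type*} [Group G] {a b c : G}

/-- In a group generated by `a`, `b`, `c` satisfying the Coxeter relations of type `G̃₂`, the
translation `T₁` and its conjugate `T₂`: commutation relations. -/
theorem affineG₂_translation_relations (ha : a * a = 1) (hc : c * c = 1)
    (hbc : c * b = b * c) (hab : b * a * b = a * b * a)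
    (hac : c * a * c * a * c * a = a * c * a * c * a * c) {T₁ T₂ : G}
    (h₁ : T₁ = b * a * c * a * c * a) (h₂ : T₂ = a * T₁ * a) :
    SemiconjBy a T₁ T₂ ∧ SemiconjBy a T₂ T₁ ∧ Commute c T₁ ∧ SemiconjBy c T₂ (T₁ * T₂⁻¹) ∧
      Commute T₁ T₂ ∧ b = T₁ * (a * (c * (a * (c * a)))) := by
  have haa : ∀ x, a * (a * x) = x := fun x => by rw [← mul_assoc, ha, one_mul]
  have hcc : ∀ x, c * (c * x) = x := fun x => by rw [← mul_assoc, hc, one_mul]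
  have hcb : ∀ x, c * (b * x) = b * (c * x) := fun x => by rw [← mul_assoc, hbc, mul_assoc]
  have hbab : ∀ x, b * (a * (b * x)) = a * (b * (a * x)) := fun x => by
    simpa only [mul_assoc] using congrArg (· * x) hab
  have h6 : ∀ x, c * (a * (c * (a * (c * (a * x))))) = a * (c * (a * (c * (a * (c * x))))) :=
    fun x => by simpa only [mul_assoc] using congrArg (· * x) hac
  have h7 : ∀ x, a * (b * (a * (c * (a * (b * (a * x)))))) = b * (a * (c * (a * (b * x)))) :=
    fun x => by rw [← hbab x, hcb, hbab, haa]
  simp only [mul_assoc] at h₁ hab hac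
  have k2 : T₂ = a * (b * (a * (c * (a * c)))) := by
    rw [h₂, h₁]; simp only [mul_assoc, ha, mul_one]
  have hcomm : Commute T₁ T₂ := by
    rw [Commute, SemiconjBy, h₁, k2]
    simp only [mul_assoc, haa, hcb, h7, hac]
  refine ⟨?_, ?_, ?_, ?_, hcomm, ?_⟩
  · rw [SemiconjBy, h₂]; simp only [mul_assoc, ha, mul_one]
  · rw [SemiconjBy, h₂]; simp only [mul_assoc, haa]
  · rw [Commute, SemiconjBy, h₁]; simp only [mul_assoc, hcb, hac]
  · rw [SemiconjBy, hcomm.inv_right.eq, mul_assoc, eq_inv_mul_iff_mul_eq, k2, h₁]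
    simp only [mul_assoc, haa, hcc, hcb, hbab]
  · rw [h₁]; simp only [mul_assoc, haa, hcc, ha, mul_one]

end Translations

namespace CoxeterMatrix

theorem affineG₂_simple_mul_self (i : Fin 3) : affineG₂.simple i * affineG₂.simple i = 1 :=
  affineG₂.toCoxeterSystem.simple_mul_simple_self i

theorem affineG₂_simple_comm :
    affineG₂.simple 2 * affineG₂.simple 0 = affineG₂.simple 0 * affineG₂.simple 2 := by
  have h : (affineG₂.simple 0 * affineG₂.simple 2) ^ 2 = 1 :=
    affineG₂.toCoxeterSystem.simple_mul_simple_pow 0 2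
  have h0 := affineG₂_simple_mul_self 0
  have h2 := affineG₂_simple_mul_self 2
  rw [pow_two, mul_eq_one_iff_eq_inv, mul_inv_rev, inv_eq_of_mul_eq_one_left h0,
    inv_eq_of_mul_eq_one_left h2] at h
  exact h.symm

theorem affineG₂_simple_braid₃ : affineG₂.simple 0 * affineG₂.simple 1 * affineG₂.simple 0 =
    affineG₂.simple 1 * affineG₂.simple 0 * affineG₂.simple 1 := by
  have h : (affineG₂.simple 0 * affineG₂.simple 1) ^ 3 = 1 :=
    affineG₂.toCoxeterSystem.simple_mul_simple_pow 0 1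
  have h0 := affineG₂_simple_mul_self 0
  have h1 := affineG₂_simple_mul_self 1
  have e : affineG₂.simple 0 * affineG₂.simple 1 * affineG₂.simple 0 *
      (affineG₂.simple 1 * affineG₂.simple 0 * affineG₂.simple 1) = 1 := by
    rw [← h]; simp only [pow_succ, pow_zero, one_mul, mul_assoc]
  rw [mul_eq_one_iff_eq_inv] at e
  simpa only [mul_inv_rev, inv_eq_of_mul_eq_one_left h0, inv_eq_of_mul_eq_one_left h1,
    mul_assoc] using e

theorem affineG₂_simple_pow_six : (affineG₂.simple 2 * affineG₂.simple 1) ^ 6 = 1 :=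
  affineG₂.toCoxeterSystem.simple_mul_simple_pow 2 1

theorem affineG₂_simple_braid₆ :
    affineG₂.simple 2 * affineG₂.simple 1 * affineG₂.simple 2 * affineG₂.simple 1 *
      affineG₂.simple 2 * affineG₂.simple 1 =
    affineG₂.simple 1 * affineG₂.simple 2 * affineG₂.simple 1 * affineG₂.simple 2 *
      affineG₂.simple 1 * affineG₂.simple 2 := by
  have h2 := affineG₂_simple_mul_self 2
  have h1 := affineG₂_simple_mul_self 1
  have e := affineG₂_simple_pow_six
  rw [show 6 = 3 + 3 from rfl, pow_add, mul_eq_one_iff_eq_inv] at e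
  simpa only [pow_succ, pow_zero, one_mul, mul_inv_rev, inv_eq_of_mul_eq_one_left h2,
    inv_eq_of_mul_eq_one_left h1, mul_assoc] using e

/-- The action of the Coxeter group of type `G̃₂` on the coroot lattice. -/
def affineG₂Action : affineG₂.Group →* Equiv.Perm (ℤ × ℤ) :=
  affineG₂.toCoxeterSystem.lift
    -- The affine node s₁ gets the only mirror missing the origin. The reflections s₂ and s₃ fix the
    -- origin and generate the finite part.
    ⟨![affineReflection .v21 1, affineReflection .v10 0, affineReflection .v01 0], by
      have h6 : (affineReflection .v10 0 * affineReflection .v01 0) ^ 6 = 1 := by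
        ext z <;> simp only [pow_succ, pow_zero, one_mul, Equiv.Perm.mul_apply, Equiv.Perm.one_apply,
          affineReflection_apply, affineReflectionFun] <;> ring
      have h6' : (affineReflection .v01 0 * affineReflection .v10 0) ^ 6 = 1 := by
        ext z <;> simp only [pow_succ, pow_zero, one_mul, Equiv.Perm.mul_apply, Equiv.Perm.one_apply,
          affineReflection_apply, affineReflectionFun] <;> ring
      have h3 : (affineReflection .v21 1 * affineReflection .v10 0) ^ 3 = 1 := by
        ext z <;> simp only [pow_succ, pow_zero, one_mul, Equiv.Perm.mul_apply, Equiv.Perm.one_apply,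
          affineReflection_apply, affineReflectionFun] <;> ring
      have h3' : (affineReflection .v10 0 * affineReflection .v21 1) ^ 3 = 1 := by
        ext z <;> simp only [pow_succ, pow_zero, one_mul, Equiv.Perm.mul_apply, Equiv.Perm.one_apply,
          affineReflection_apply, affineReflectionFun] <;> ring
      have h2 : (affineReflection .v21 1 * affineReflection .v01 0) ^ 2 = 1 := by
        ext z <;> simp only [pow_succ, pow_zero, one_mul, Equiv.Perm.mul_apply, Equiv.Perm.one_apply,
          affineReflection_apply, affineReflectionFun] <;> ring
      have h2' : (affineReflection .v01 0 * affineReflection .v21 1) ^ 2 = 1 := by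
        ext z <;> simp only [pow_succ, pow_zero, one_mul, Equiv.Perm.mul_apply, Equiv.Perm.one_apply,
          affineReflection_apply, affineReflectionFun] <;> ring
      have h1 : ∀ v n, (affineReflection v n * affineReflection v n) ^ 1 = 1 := fun v n => by
        rw [pow_one, affineReflection_mul_self]
      intro i j
      fin_cases i <;> fin_cases j
      exacts [h1 _ _, h3, h2, h3', h1 _ _, h6, h2', h6', h1 _ _]⟩

theorem affineG₂Action_simple_zero :
    affineG₂Action (affineG₂.simple 0) = affineReflection .v21 1 :=
  affineG₂.toCoxeterSystem.lift_apply_simple _ 0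

theorem affineG₂Action_simple_one :
    affineG₂Action (affineG₂.simple 1) = affineReflection .v10 0 :=
  affineG₂.toCoxeterSystem.lift_apply_simple _ 1

theorem affineG₂Action_simple_two :
    affineG₂Action (affineG₂.simple 2) = affineReflection .v01 0 :=
  affineG₂.toCoxeterSystem.lift_apply_simple _ 2

theorem affineG₂_induction {p : affineG₂.Group → Prop} (one : p 1)
    (h0 : ∀ u, p u → p (affineG₂.simple 0 * u)) (h1 : ∀ u, p u → p (affineG₂.simple 1 * u))
    (h2 : ∀ u, p u → p (affineG₂.simple 2 * u)) (u : affineG₂.Group) : p u := by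
  refine affineG₂.toCoxeterSystem.simple_induction_left u one fun u i hu => ?_
  fin_cases i
  exacts [h0 u hu, h1 u hu, h2 u hu]

theorem affineG₂_dihedral_normal_form {d : affineG₂.Group}
    (hd : d ∈ Subgroup.closure {affineG₂.simple 1, affineG₂.simple 2}) :
    ∃ k : ℤ, d = (affineG₂.simple 2 * affineG₂.simple 1) ^ k ∨
      d = (affineG₂.simple 2 * affineG₂.simple 1) ^ k * affineG₂.simple 1 := by
  have ha := affineG₂_simple_mul_self 1
  have hc := affineG₂_simple_mul_self 2
  set a := affineG₂.simple 1
  set c := affineG₂.simple 2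
  have hs : SemiconjBy a (c * a) (c * a)⁻¹ := by
    rw [SemiconjBy, mul_inv_rev, inv_eq_of_mul_eq_one_left ha, inv_eq_of_mul_eq_one_left hc,
      mul_assoc]
  have hk : ∀ k : ℤ, a * (c * a) ^ k = (c * a) ^ (-k) * a := fun k => by
    rw [(hs.zpow_right k).eq, inv_zpow, zpow_neg]
  have step : ∀ x : affineG₂.Group, (∃ k : ℤ, x = (c * a) ^ k ∨ x = (c * a) ^ k * a) →
      ∃ k : ℤ, a * x = (c * a) ^ k ∨ a * x = (c * a) ^ k * a := by
    rintro _ ⟨k, rfl | rfl⟩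
    · exact ⟨-k, .inr (hk k)⟩
    · exact ⟨-k, .inl (by rw [← mul_assoc, hk, mul_assoc, ha, mul_one])⟩
  have step' : ∀ x : affineG₂.Group, (∃ k : ℤ, x = (c * a) ^ k ∨ x = (c * a) ^ k * a) →
      ∃ k : ℤ, c * x = (c * a) ^ k ∨ c * x = (c * a) ^ k * a := by
    intro x hx
    have e : c * x = c * a * (a * x) := by rw [mul_assoc, ← mul_assoc a, ha, one_mul]
    obtain ⟨k, hk | hk⟩ := step x hx
    · exact ⟨1 + k, .inl (by rw [e, hk, zpow_add, zpow_one])⟩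
    · exact ⟨1 + k, .inr (by rw [e, hk, zpow_add, zpow_one, ← mul_assoc])⟩
  induction hd using Subgroup.closure_induction_left with
  | one => exact ⟨0, .inl (by simp)⟩
  | mul_left x hx y _ ih =>
    rcases hx with rfl | rfl
    · exact step y ih
    · exact step' y ih
  | inv_mul_cancel x hx y _ ih =>
    rcases hx with rfl | rfl
    · rw [inv_eq_of_mul_eq_one_left ha]; exact step y ih
    · rw [inv_eq_of_mul_eq_one_left hc]; exact step' y ih

/-- Every element is T₁^m T₂^n d with d in the finite group generated by s₂, s₃. The origin is fixed
by d and detects m and n, since T₁ and T₂ act by the independent translations (2, 1) and (1, 1). The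
remaining twelve candidates for d are tested on (1, 0) and (0, 1). -/
theorem affineG₂Action_injective : Function.Injective affineG₂Action := by
  rw [injective_iff_map_eq_one]
  have hcl1 : affineG₂.simple 1 ∈ Subgroup.closure {affineG₂.simple 1, affineG₂.simple 2} :=
    Subgroup.subset_closure (Set.mem_insert _ _)
  have hcl2 : affineG₂.simple 2 ∈ Subgroup.closure {affineG₂.simple 1, affineG₂.simple 2} :=
    Subgroup.subset_closure (Set.mem_insert_of_mem _ rfl)
  obtain ⟨r1, r2, r3, r4, r5, r6⟩ := affineG₂_translation_relations (affineG₂_simple_mul_self 1)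
    (affineG₂_simple_mul_self 2) affineG₂_simple_comm
    affineG₂_simple_braid₃ affineG₂_simple_braid₆ rfl rfl
  generalize hT₁ : affineG₂.simple 0 * affineG₂.simple 1 * affineG₂.simple 2 *
    affineG₂.simple 1 * affineG₂.simple 2 * affineG₂.simple 1 = T₁ at *
  generalize hT₂ : affineG₂.simple 1 * T₁ * affineG₂.simple 1 = T₂ at *
  have t1 : affineG₂Action T₁ = Equiv.addRight ((2, 1) : ℤ × ℤ) := by
    rw [← hT₁]
    ext z <;> simp only [map_mul, affineG₂Action_simple_zero, affineG₂Action_simple_one,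
      affineG₂Action_simple_two, Equiv.Perm.mul_apply, affineReflection_apply, affineReflectionFun,
      Equiv.coe_addRight, Prod.fst_add, Prod.snd_add] <;> ring
  have t2 : affineG₂Action T₂ = Equiv.addRight ((1, 1) : ℤ × ℤ) := by
    rw [← hT₂]
    ext z <;> simp only [map_mul, affineG₂Action_simple_one, t1,
      Equiv.Perm.mul_apply, affineReflection_apply, affineReflectionFun,
      Equiv.coe_addRight, Prod.fst_add, Prod.snd_add]
    ring
  have step1 : ∀ u : affineG₂.Group, (∃ m n : ℤ, ∃ d ∈ Subgroup.closure
      {affineG₂.simple 1, affineG₂.simple 2}, u = T₁ ^ m * T₂ ^ n * d) → ∃ m n : ℤ,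
      ∃ d ∈ Subgroup.closure {affineG₂.simple 1, affineG₂.simple 2},
        affineG₂.simple 1 * u = T₁ ^ m * T₂ ^ n * d := by
    rintro _ ⟨m, n, d, hd, rfl⟩
    refine ⟨n, m, affineG₂.simple 1 * d, mul_mem hcl1 hd, ?_⟩
    have e := ((r1.zpow_right m).mul_right (r2.zpow_right n)).eq
    rw [← mul_assoc, e, ((r5.symm.zpow_zpow m n)).eq, mul_assoc]
  have step2 : ∀ u : affineG₂.Group, (∃ m n : ℤ, ∃ d ∈ Subgroup.closure
      {affineG₂.simple 1, affineG₂.simple 2}, u = T₁ ^ m * T₂ ^ n * d) → ∃ m n : ℤ,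
      ∃ d ∈ Subgroup.closure {affineG₂.simple 1, affineG₂.simple 2},
        affineG₂.simple 2 * u = T₁ ^ m * T₂ ^ n * d := by
    rintro _ ⟨m, n, d, hd, rfl⟩
    refine ⟨m + n, -n, affineG₂.simple 2 * d, mul_mem hcl2 hd, ?_⟩
    have r3' : SemiconjBy (affineG₂.simple 2) T₁ T₁ := r3
    have e := ((r3'.zpow_right m).mul_right (r4.zpow_right n)).eq
    rw [← mul_assoc, e, (r5.inv_right).mul_zpow, zpow_add, inv_zpow']
    simp only [mul_assoc]
  have nf : ∀ u : affineG₂.Group, ∃ m n : ℤ, ∃ d ∈ Subgroup.closure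
      {affineG₂.simple 1, affineG₂.simple 2}, u = T₁ ^ m * T₂ ^ n * d := by
    refine affineG₂_induction ⟨0, 0, 1, one_mem _, by simp⟩ ?_ step1 step2
    intro u hu
    -- By `r6`, s₁ = T₁·s₂s₃s₂s₃s₂, so multiplication by s₁ is five steps already treated followed
    -- by one translation.
    obtain ⟨m, n, d, hd, e⟩ := step1 _ (step2 _ (step1 _ (step2 _ (step1 u hu))))
    refine ⟨1 + m, n, d, hd, ?_⟩
    rw [r6, zpow_add, zpow_one]
    simp only [mul_assoc] at e ⊢
    rw [e]
  intro u hu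
  obtain ⟨m, n, d, hd, rfl⟩ := nf u
  have hd0 : affineG₂Action d (0, 0) = (0, 0) := by
    clear hu
    induction hd using Subgroup.closure_induction with
    | mem x hx =>
      rcases hx with rfl | rfl
      · rw [affineG₂Action_simple_one]; rfl
      · rw [affineG₂Action_simple_two]; rfl
    | one => rw [map_one]; rfl
    | mul x y _ _ hx hy => rw [map_mul, Equiv.Perm.mul_apply, hy, hx]
    | inv x _ hx => rw [map_inv, Equiv.Perm.inv_eq_iff_eq, hx]
  have h0 := Equiv.congr_fun hu (0, 0)
  rw [map_mul, map_mul, map_zpow, map_zpow, t1, t2, Equiv.Perm.mul_apply, hd0,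
    Equiv.Perm.mul_apply, Equiv.addRight_zpow_apply, Equiv.addRight_zpow_apply, Equiv.Perm.one_apply, Prod.ext_iff] at h0
  simp only [Prod.smul_mk, smul_eq_mul, Prod.mk_add_mk] at h0
  obtain rfl : m = 0 := by omega
  obtain rfl : n = 0 := by omega
  rw [zpow_zero, zpow_zero, one_mul, one_mul] at hu ⊢
  obtain ⟨k, hk⟩ := affineG₂_dihedral_normal_form hd
  -- The rotation s₃s₂ has sixth power 1, so finitely many exponents remain.
  have hmod : (affineG₂.simple 2 * affineG₂.simple 1) ^ k =
      (affineG₂.simple 2 * affineG₂.simple 1) ^ (k % 6).toNat := by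
    rw [← zpow_natCast, Int.toNat_of_nonneg (Int.emod_nonneg k (by norm_num))]
    conv_lhs => rw [← Int.emod_add_mul_ediv k 6, zpow_add, zpow_mul]
    have := affineG₂_simple_pow_six
    rw [← zpow_natCast] at this
    rw [show ((6 : ℤ)) = ((6 : ℕ) : ℤ) from rfl, this, one_zpow, mul_one]
  rw [hmod] at hk
  have hr : (k % 6).toNat < 6 := by omega
  generalize (k % 6).toNat = r at hk hr
  have e1 := Equiv.congr_fun hu (1, 0)
  have e2 := Equiv.congr_fun hu (0, 1)
  rcases hk with rfl | rfl
  · interval_cases r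
    · rw [pow_zero]
    all_goals
      simp [pow_succ, affineG₂Action_simple_one,
        affineG₂Action_simple_two, affineReflection_apply, affineReflectionFun] at e1 e2
  · interval_cases r <;>
      simp [pow_succ, affineG₂Action_simple_one,
        affineG₂Action_simple_two, affineReflection_apply, affineReflectionFun] at e1 e2

end CoxeterMatrix

/-! ### Intervals of height three -/

section HeightThree

variable {G : Type*} [Group G] {A : Set G} {g : G}

theorem PrefixLE.wordLength_le {u v : G} (huv : PrefixLE A u v) :
    wordLength A u ≤ wordLength A v := by
  simp only [PrefixLE] at huv; omega

theorem PrefixLE.eq_of_wordLength_le (h : IsConjGenerating A) {u v : G} (huv : PrefixLE A u v)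
    (hl : wordLength A v ≤ wordLength A u) : u = v := by
  simp only [PrefixLE] at huv
  exact inv_mul_eq_one.1 (h.eq_one_of_wordLength_eq_zero (by omega))

theorem IsConjGenerating.mem_of_wordLength_eq_one (h : IsConjGenerating A) {u : G}
    (hu : wordLength A u = 1) : u ∈ A := by
  obtain ⟨y, a, ha, rfl, hy⟩ := h.exists_eq_mul_of_wordLength_eq_succ hu
  rwa [h.eq_one_of_wordLength_eq_zero hy, one_mul]

/-- An interval with the interpolation property is a lattice. -/
theorem isLatticePoset_of_interpolation (h : IsConjGenerating A)
    (H : ∀ a b c d, PrefixLE A c g → PrefixLE A d g → PrefixLE A a c → PrefixLE A a d →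
      PrefixLE A b c → PrefixLE A b d →
      ∃ z, PrefixLE A a z ∧ PrefixLE A b z ∧ PrefixLE A z c ∧ PrefixLE A z d) :
    @IsLatticePoset (CayleyInterval A g) (cayleyIntervalPartialOrder h.closure_eq_top g) := by
  intro a b
  have ha := (mem_cayleyInterval_iff a.1).1 a.2
  have hb := (mem_cayleyInterval_iff b.1).1 b.2
  constructor
  -- A longest common lower bound is the meet: interpolating between it and another lower bound
  -- gives an element that cannot be longer, hence is the bound itself. Joins are dual.
  · let S : Set ℕ := {n | ∃ c, PrefixLE A c a.1 ∧ PrefixLE A c b.1 ∧ wordLength A c = n}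
    have hS : S.Nonempty := ⟨_, 1, .one_left _ _, .one_left _ _, rfl⟩
    have hbd : BddAbove S := ⟨wordLength A a.1, by
      rintro n ⟨c, hc, -, rfl⟩; exact hc.wordLength_le⟩
    obtain ⟨c, hca, hcb, hc⟩ := Nat.sSup_mem hS hbd
    refine ⟨⟨c, (mem_cayleyInterval_iff c).2 (hca.trans h ha)⟩, ?_, ?_⟩
    · rintro _ (rfl | rfl)
      exacts [(cayleyInterval_le_iff _ _).2 hca, (cayleyInterval_le_iff _ _).2 hcb]
    · intro d hd
      have hda := (cayleyInterval_le_iff _ _).1 (hd (Set.mem_insert _ _))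
      have hdb := (cayleyInterval_le_iff _ _).1 (hd (Set.mem_insert_of_mem _ rfl))
      obtain ⟨z, hcz, hdz, hza, hzb⟩ := H c d.1 a.1 b.1 ha hb hca hcb hda hdb
      have hz : wordLength A z ≤ sSup S := le_csSup hbd ⟨z, hza, hzb, rfl⟩
      obtain rfl := hcz.eq_of_wordLength_le h (hz.trans hc.ge)
      exact (cayleyInterval_le_iff _ _).2 hdz
  · let S : Set ℕ := {n | ∃ c, PrefixLE A a.1 c ∧ PrefixLE A b.1 c ∧ PrefixLE A c g ∧
      wordLength A c = n}
    have hS : S.Nonempty := ⟨_, g, ha, hb, .refl _ _, rfl⟩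
    obtain ⟨c, hac, hbc, hcg, hc⟩ := Nat.sInf_mem hS
    refine ⟨⟨c, (mem_cayleyInterval_iff c).2 hcg⟩, ?_, ?_⟩
    · rintro _ (rfl | rfl)
      exacts [(cayleyInterval_le_iff _ _).2 hac, (cayleyInterval_le_iff _ _).2 hbc]
    · intro d hd
      have hda := (cayleyInterval_le_iff _ _).1 (hd (Set.mem_insert _ _))
      have hdb := (cayleyInterval_le_iff _ _).1 (hd (Set.mem_insert_of_mem _ rfl))
      have hdg := (mem_cayleyInterval_iff d.1).1 d.2
      obtain ⟨z, haz, hbz, hzc, hzd⟩ := H a.1 b.1 c d.1 hcg hdg hac hda hbc hdb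
      have hz : sInf S ≤ wordLength A z := Nat.sInf_le ⟨z, haz, hbz, hzc.trans h hcg, rfl⟩
      obtain rfl := hzc.eq_of_wordLength_le h (hc.le.trans hz)
      exact (cayleyInterval_le_iff _ _).2 hzd

/-- An interval of height three is a lattice if no two atoms are below two common coatoms. -/
theorem isLatticePoset_of_wordLength_eq_three (h : IsConjGenerating A) (hg : wordLength A g = 3)
    (H : ∀ r ∈ A, ∀ r' ∈ A, ∀ s ∈ A, ∀ s' ∈ A, (∃ y ∈ A, r * y * s = g) →
      (∃ y ∈ A, r' * y * s = g) → (∃ y ∈ A, r * y * s' = g) → (∃ y ∈ A, r' * y * s' = g) →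
      r = r' ∨ s = s') :
    @IsLatticePoset (CayleyInterval A g) (cayleyIntervalPartialOrder h.closure_eq_top g) := by
  refine isLatticePoset_of_interpolation h fun a b c d hc hd hac had hbc hbd => ?_
  by_cases hab : PrefixLE A a b
  · exact ⟨b, hab, .refl _ _, hbc, hbd⟩
  by_cases hba : PrefixLE A b a
  · exact ⟨a, .refl _ _, hba, hac, had⟩
  by_cases hcd : PrefixLE A c d
  · exact ⟨c, hac, hbc, .refl _ _, hcd⟩
  by_cases hdc : PrefixLE A d c
  · exact ⟨d, had, hbd, hdc, .refl _ _⟩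
  -- Only incomparable a, b below incomparable c, d remain. The lengths lie strictly between 0 and 3
  -- and increase strictly, so a, b are atoms and c, d are coatoms.
  exfalso
  have pos : ∀ x y, ¬ PrefixLE A x y → wordLength A x ≠ 0 := fun x y hxy h0 => hxy (by
    rw [h.eq_one_of_wordLength_eq_zero h0]; exact .one_left _ _)
  have lt : ∀ x y, PrefixLE A x y → x ≠ y → wordLength A x < wordLength A y := fun x y hxy hne =>
    lt_of_not_ge fun hl => hne (hxy.eq_of_wordLength_le h hl)
  have p1 := pos a b hab
  have p2 := pos b a hba
  have l1 := lt c g hc (by rintro rfl; exact hdc hd)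
  have l2 := lt d g hd (by rintro rfl; exact hcd hc)
  have l3 := lt a c hac (by rintro rfl; exact hba hbc)
  have l4 := lt b d hbd (by rintro rfl; exact hab had)
  have l5 := lt b c hbc (by rintro rfl; exact hab hac)
  have l6 := lt a d had (by rintro rfl; exact hba hbd)
  have mem : ∀ x y, PrefixLE A x y → wordLength A y = wordLength A x + 1 → x⁻¹ * y ∈ A :=
    fun x y hxy hl => h.mem_of_wordLength_eq_one (by simp only [PrefixLE] at hxy; omega)
  have tri : ∀ x y, PrefixLE A x y → wordLength A y = wordLength A x + 1 →
      ∃ z ∈ A, x * z * (y⁻¹ * g) = g := fun x y hxy hl => ⟨_, mem x y hxy hl, by group⟩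
  rcases H a (h.mem_of_wordLength_eq_one (by omega)) b (h.mem_of_wordLength_eq_one (by omega))
    (c⁻¹ * g) (mem c g hc (by omega)) (d⁻¹ * g) (mem d g hd (by omega))
    (tri a c hac (by omega)) (tri b c hbc (by omega)) (tri a d had (by omega))
    (tri b d hbd (by omega)) with e | e
  · exact hab (e ▸ .refl _ _)
  · rw [mul_left_inj, inv_inj] at e
    exact hcd (e ▸ .refl _ _)

theorem prefixLE_of_mul_mul_eq (h : IsConjGenerating A) (hg : wordLength A g = 3) {r s t : G}
    (hr : r ∈ A) (hs : s ∈ A) (ht : t ∈ A) (e : r * s * t = g) :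
    PrefixLE A r (r * s) ∧ PrefixLE A (r * s) g := by
  have h1 := wordLength_le_one hr
  have h2 := wordLength_le_one hs
  have h3 := wordLength_le_one ht
  have h4 := h.wordLength_mul_le r s
  have h5 := h.wordLength_mul_le (r * s) t
  have e' : (r * s)⁻¹ * g = t := by rw [← e, inv_mul_cancel_left]
  rw [e] at h5
  simp only [PrefixLE, e', inv_mul_cancel_left]
  omega

/-- On an interval of height three, a function on atoms such that all triples of atoms with product
`g` have the same image `δ` extends to the interval group. -/
theorem exists_intervalGroup_hom (h : IsConjGenerating A) (hg : wordLength A g = 3)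
    {H : Type*} [Group H] (ρ : G → H) (δ : H)
    (hρ : ∀ r ∈ A, ∀ s ∈ A, ∀ t ∈ A, r * s * t = g → ρ r * ρ s * ρ t = δ) :
    ∃ ψ : IntervalGroup A g →* H, ∀ r, ψ (PresentedGroup.of r) = ρ r.1 := by
  classical
  -- The potential is prescribed from below on atoms and from above on coatoms, so edges at 1 and at
  -- g are automatic. The edges from atoms to coatoms are exactly the hypothesis on triples.
  let N : G → H := fun u =>
    if wordLength A u = 0 then 1 else if wordLength A u = 1 then ρ u
    else if wordLength A u = 2 then δ * (ρ (u⁻¹ * g))⁻¹ else δ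
  refine ⟨IntervalGroup.liftPotential (fun r => ρ r.1) N fun u r hr => ?_,
    fun r => IntervalGroup.liftPotential_of _ _ _ r⟩
  obtain ⟨hrA, hr1, hur, hurg⟩ := (isIntervalEdge_iff h _ _).1 hr
  have h1 : wordLength A (u * r.1) = wordLength A u + 1 := by
    simp only [PrefixLE, inv_mul_cancel_left] at hur; omega
  have h2 := hurg.wordLength_le
  have h3 : wordLength A (u * r.1) + wordLength A ((u * r.1)⁻¹ * g) = wordLength A g := hurg
  obtain h0 | h0 | h0 : wordLength A u = 0 ∨ wordLength A u = 1 ∨ wordLength A u = 2 := by omega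
  · obtain rfl := h.eq_one_of_wordLength_eq_zero h0
    simp [N, hr1, wordLength_one]
  · have e := hρ u (h.mem_of_wordLength_eq_one h0) r.1 hrA ((u * r.1)⁻¹ * g)
      (h.mem_of_wordLength_eq_one (by omega)) (by group)
    simp only [N, h1, h0]
    norm_num
    simpa [mul_inv_eq_iff_eq_mul] using e.symm
  · have e : u * r.1 = g := hurg.eq_of_wordLength_le h (by omega)
    have e' : u⁻¹ * g = r.1 := (eq_inv_mul_of_mul_eq e).symm
    simp only [N, h1, h0, e']
    norm_num

end HeightThree

/-! ### Reflections of `G̃₂` and the lattice property for s₃s₁s₂. -/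

namespace CoxeterMatrix

theorem isConjGenerating_reflections {B : Type*} (M : CoxeterMatrix B) :
    IsConjGenerating M.reflections :=
  ⟨M.closure_reflections, fun k _ ha => CoxeterSystem.IsReflection.conj ha k⟩

theorem simple_mem_reflections {B : Type*} (M : CoxeterMatrix B) (i : B) :
    M.simple i ∈ M.reflections :=
  M.toCoxeterSystem.isReflection_simple i

/-- The parity homomorphism takes every reflection to 1 in ℤ/2, so it counts reflections modulo 2.
-/
theorem lengthParity_eq_wordLength {B : Type*} (M : CoxeterMatrix B) (u : M.Group) :
    M.toCoxeterSystem.lengthParity u = Multiplicative.ofAdd (wordLength M.reflections u : ZMod 2) := by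
  have hr : ∀ r ∈ M.reflections,
      M.toCoxeterSystem.lengthParity r = Multiplicative.ofAdd (1 : ZMod 2) := by
    rintro _ ⟨v, i, rfl⟩
    rw [map_mul, map_mul, map_inv, mul_inv_cancel_comm, CoxeterSystem.lengthParity_simple]
  obtain ⟨l, hl, rfl, hn⟩ := exists_minimal_word M.closure_reflections u
  rw [← hn]
  clear hn
  induction l with
  | nil => simp
  | cons r l ih =>
    rw [List.prod_cons, map_mul, ih fun a ha => hl a (List.mem_cons_of_mem _ ha),
      hr r (hl r List.mem_cons_self), ← ofAdd_add, List.length_cons, Nat.cast_add, Nat.cast_one,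
      add_comm]

/-- The affine reflections contain the images of the generators and are permuted by conjugation with
each of them; induction on the conjugating element does the rest. -/
theorem exists_affineReflection {r : affineG₂.Group} (hr : r ∈ affineG₂.reflections) :
    ∃ v n, affineG₂Action r = affineReflection v n := by
  obtain ⟨u, i, rfl⟩ := hr
  have conj0 : ∀ v n, ∃ v' n', affineReflection .v21 1 * affineReflection v n *
      affineReflection .v21 1 = affineReflection v' n' := by
    intro v n
    -- The new coroot is the image of the old one under the linear part, up to sign, and the level
    -- is adjusted to the moved mirror.
    let p : G₂Coroot × ℤ := match v with
      | .v10 => (.v11, 1 - n)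
      | .v01 => (.v01, n)
      | .v31 => (.v32, 1 - n)
      | .v11 => (.v10, 1 - n)
      | .v32 => (.v31, 1 - n)
      | .v21 => (.v21, 2 - n)
    refine ⟨p.1, p.2, Equiv.ext fun z => ?_⟩
    cases v <;> ext <;> dsimp only [p] <;>
      simp only [Equiv.Perm.mul_apply, affineReflection_apply, affineReflectionFun] <;> ring
  have conj1 : ∀ v n, ∃ v' n', affineReflection .v10 0 * affineReflection v n *
      affineReflection .v10 0 = affineReflection v' n' := by
    intro v n
    let p : G₂Coroot × ℤ := match v with
      | .v10 => (.v10, -n)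
      | .v01 => (.v31, n)
      | .v31 => (.v01, n)
      | .v11 => (.v21, n)
      | .v32 => (.v32, n)
      | .v21 => (.v11, n)
    refine ⟨p.1, p.2, Equiv.ext fun z => ?_⟩
    cases v <;> ext <;> dsimp only [p] <;>
      simp only [Equiv.Perm.mul_apply, affineReflection_apply, affineReflectionFun] <;> ring
  have conj2 : ∀ v n, ∃ v' n', affineReflection .v01 0 * affineReflection v n *
      affineReflection .v01 0 = affineReflection v' n' := by
    intro v n
    let p : G₂Coroot × ℤ := match v with
      | .v10 => (.v11, n)
      | .v01 => (.v01, -n)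
      | .v31 => (.v32, n)
      | .v11 => (.v10, n)
      | .v32 => (.v31, n)
      | .v21 => (.v21, n)
    refine ⟨p.1, p.2, Equiv.ext fun z => ?_⟩
    cases v <;> ext <;> dsimp only [p] <;>
      simp only [Equiv.Perm.mul_apply, affineReflection_apply, affineReflectionFun] <;> ring
  have key : ∀ j : Fin 3, ∀ r, (∃ v n, affineG₂Action r = affineReflection v n) →
      ∃ v n, affineG₂Action (affineG₂.simple j * r * affineG₂.simple j) = affineReflection v n := by
    rintro j r ⟨v, n, e⟩
    rw [map_mul, map_mul, e]
    fin_cases j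
    · exact affineG₂Action_simple_zero ▸ conj0 v n
    · exact affineG₂Action_simple_one ▸ conj1 v n
    · exact affineG₂Action_simple_two ▸ conj2 v n
  have base : ∃ v n, affineG₂Action (affineG₂.simple i) = affineReflection v n := by
    fin_cases i
    exacts [⟨_, _, affineG₂Action_simple_zero⟩, ⟨_, _, affineG₂Action_simple_one⟩,
      ⟨_, _, affineG₂Action_simple_two⟩]
  refine affineG₂.toCoxeterSystem.simple_induction_left
    (p := fun u => ∃ v n, affineG₂Action (u * affineG₂.simple i * u⁻¹) = affineReflection v n)
    u (by simpa using base) fun u j hu => ?_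
  have e : affineG₂.simple j * u * affineG₂.simple i * (affineG₂.simple j * u)⁻¹ =
      affineG₂.simple j * (u * affineG₂.simple i * u⁻¹) * affineG₂.simple j := by
    rw [mul_inv_rev, inv_eq_of_mul_eq_one_left (affineG₂_simple_mul_self j)]
    simp only [mul_assoc]
  obtain ⟨v, n, h⟩ := key j _ hu
  exact ⟨v, n, by rw [← h, ← e]; rfl⟩

/-- The Coxeter element `s₃ s₁ s₂`. -/
def affineG₂Coxeter : affineG₂.Group :=
  affineG₂.simple 2 * affineG₂.simple 0 * affineG₂.simple 1

theorem affineG₂Action_coxeter : affineG₂Action affineG₂Coxeter = affineGlide := by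
  rw [affineG₂Coxeter, mul_assoc, map_mul, map_mul, affineG₂Action_simple_zero,
    affineG₂Action_simple_one, affineG₂Action_simple_two, affineGlide]

theorem wordLength_affineG₂Coxeter : wordLength affineG₂.reflections affineG₂Coxeter = 3 := by
  have h := affineG₂.isConjGenerating_reflections
  have h1 := affineG₂.lengthParity_eq_wordLength affineG₂Coxeter
  have h2 : affineG₂.toCoxeterSystem.lengthParity affineG₂Coxeter =
      Multiplicative.ofAdd (1 : ZMod 2) := by
    have hs : ∀ i, affineG₂.toCoxeterSystem.lengthParity (affineG₂.simple i) =
      Multiplicative.ofAdd (1 : ZMod 2) := affineG₂.toCoxeterSystem.lengthParity_simple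
    rw [affineG₂Coxeter, map_mul, map_mul, hs, hs, hs]
    rfl
  rw [h2] at h1
  have h3 : ((wordLength affineG₂.reflections affineG₂Coxeter : ℕ) : ZMod 2) = (1 : ℕ) := by
    rw [Nat.cast_one]; exact (Multiplicative.ofAdd.injective h1).symm
  rw [ZMod.natCast_eq_natCast_iff'] at h3
  have h4 : wordLength affineG₂.reflections affineG₂Coxeter ≤ 3 :=
    (wordLength_le (A := affineG₂.reflections)
      [affineG₂.simple 2, affineG₂.simple 0, affineG₂.simple 1]
      (by simp [simple_mem_reflections])).trans_eq' (by simp [affineG₂Coxeter, mul_assoc])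
  -- A single reflection is an involution, but the square of the glide reflection moves the origin
  -- to (1, 0).
  have h5 : wordLength affineG₂.reflections affineG₂Coxeter ≠ 1 := by
    intro h1
    have hm := (h.mem_of_wordLength_eq_one h1).mul_self
    have := congrArg affineG₂Action hm
    rw [map_mul, affineG₂Action_coxeter, map_one] at this
    have := Equiv.congr_fun this (0, 0)
    simp [affineGlide_apply] at this
  omega

theorem dualChain_of_reflections {r s t : affineG₂.Group} (e : r * s * t = affineG₂Coxeter)
    {u v w : G₂Coroot} {l m n : ℤ} (hr : affineG₂Action r = affineReflection u l)
    (hs : affineG₂Action s = affineReflection v m) (ht : affineG₂Action t = affineReflection w n) :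
    DualChain (affineLabel u l) (affineLabel v m) (affineLabel w n) :=
  dualChain_of_mul_eq (by
    rw [← hr, ← hs, ← ht, ← map_mul, ← map_mul, e, affineG₂Action_coxeter])

theorem isLatticePoset_affineG₂Coxeter :
    IsLatticePoset (affineG₂.DualInterval affineG₂Coxeter) := by
  refine isLatticePoset_of_wordLength_eq_three affineG₂.isConjGenerating_reflections
    wordLength_affineG₂Coxeter ?_
  intro r hr r' hr' s hs s' hs' h₁ h₂ h₃ h₄
  obtain ⟨v, n, hv⟩ := exists_affineReflection hr
  obtain ⟨v', n', hv'⟩ := exists_affineReflection hr'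
  obtain ⟨u, m, hu⟩ := exists_affineReflection hs
  obtain ⟨u', m', hu'⟩ := exists_affineReflection hs'
  have key : ∀ {r s v n u m}, affineG₂Action r = affineReflection v n →
      affineG₂Action s = affineReflection u m →
      (∃ y ∈ affineG₂.reflections, r * y * s = affineG₂Coxeter) →
      DualIncident (affineLabel v n) (affineLabel u m) := by
    rintro r s v n u m hr hs ⟨y, hy, e⟩
    obtain ⟨w, l, hw⟩ := exists_affineReflection hy
    exact (dualChain_of_reflections e hr hw hs).incident
  have inj : ∀ {r s v n u m}, affineG₂Action r = affineReflection v n →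
      affineG₂Action s = affineReflection u m → affineLabel v n = affineLabel u m → r = s := by
    intro r s v n u m hr hs e
    obtain ⟨rfl, rfl⟩ := affineLabel_injective e
    exact affineG₂Action_injective (hr.trans hs.symm)
  exact ((key hv hu h₁).eq_or_eq (key hv' hu h₂) (key hv hu' h₃) (key hv' hu' h₄)).imp
    (inj hv hv') (inj hu hu')

end CoxeterMatrix

/-! ### The dual relations in the Artin group of type `G̃₂` -/

section ArtinRelations

variable {H : Type*} [Group H] (a b c : H)

/-- The value of a label in a group with elements `a`, `b`, `c` subject to the Artin relations of
type `G̃₂`: conjugates under the powers of `c * b * a`. -/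
def dualValue : DualLabel → H
  | .a k => (MulAut.conj (c * b * a)⁻¹ ^ k) a
  | .b k => (MulAut.conj (c * b * a)⁻¹ ^ k) b
  | .c k => (MulAut.conj (c * b * a)⁻¹ ^ k) c
  | .h k => (MulAut.conj (c * b * a)⁻¹ ^ k) (c * a * c * a⁻¹ * c⁻¹)

theorem MulAut.conj_inv_zpow_self (δ : H) (k : ℤ) : (MulAut.conj δ⁻¹ ^ k) δ = δ := by
  rw [← map_zpow, MulAut.conj_apply, inv_zpow, inv_inv, (Commute.refl δ).zpow_left k |>.inv_left.eq,
    inv_mul_cancel_right]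

/-- Conjugation by a power of δ fixes δ, so it shifts all three indices of a factorization of δ
together. -/
theorem MulAut.conj_zpow_chain {δ x y z : H} {m n : ℤ}
    (e : x * (MulAut.conj δ⁻¹ ^ m) y * (MulAut.conj δ⁻¹ ^ n) z = δ) (k j l : ℤ) (hj : j = k + m)
    (hl : l = k + n) :
    (MulAut.conj δ⁻¹ ^ k) x * (MulAut.conj δ⁻¹ ^ j) y * (MulAut.conj δ⁻¹ ^ l) z = δ := by
  have := congrArg (MulAut.conj δ⁻¹ ^ k) e
  rwa [MulAut.conj_inv_zpow_self, map_mul, map_mul, ← MulAut.mul_apply, ← MulAut.mul_apply,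
    ← zpow_add, ← zpow_add, ← hj, ← hl] at this

/-- From xyz = δ follows y·z·(δ⁻¹xδ) = δ: the factor moved to the end gains one in its index. -/
theorem MulAut.conj_zpow_chain_rotate {δ x y z : H} {i j l : ℤ}
    (e : (MulAut.conj δ⁻¹ ^ i) x * (MulAut.conj δ⁻¹ ^ j) y * (MulAut.conj δ⁻¹ ^ l) z = δ) :
    (MulAut.conj δ⁻¹ ^ j) y * (MulAut.conj δ⁻¹ ^ l) z * (MulAut.conj δ⁻¹ ^ (i + 1)) x = δ := by
  rw [add_comm, zpow_add, zpow_one, MulAut.mul_apply, MulAut.conj_apply, inv_inv]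
  generalize (MulAut.conj δ⁻¹ ^ i) x = x' at *
  generalize (MulAut.conj δ⁻¹ ^ j) y = y' at *
  generalize (MulAut.conj δ⁻¹ ^ l) z = z' at *
  rw [← e]
  group

variable {a b c}

/-- With δ = cba, every chain is a shift and rotation of one of c₀b₀a₀, b₀c₀a₀, c₀b₁b₀ and b₀b₂h₀.
The third uses the braid relation of a and b, the fourth the relation of length six. -/
theorem dualValue_chain (hbc : b * c = c * b) (hab : a * b * a = b * a * b)
    (hac : c * a * c * a * c * a = a * c * a * c * a * c) {x y z : DualLabel}
    (h : DualChain x y z) :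
    dualValue a b c x * dualValue a b c y * dualValue a b c z = c * b * a := by
  have hb1 : MulAut.conj (c * b * a)⁻¹ b = b * a * b⁻¹ := by
    rw [MulAut.conj_apply, inv_inv]
    have : b * (c * b * a) = c * b * (b * a) := by rw [← mul_assoc, ← mul_assoc, hbc, mul_assoc _ b]
    rw [mul_assoc, this, inv_mul_eq_iff_eq_mul, eq_comm, ← mul_assoc, mul_inv_eq_iff_eq_mul]
    calc c * b * a * (b * a) = c * b * (a * b * a) := by simp only [mul_assoc]
      _ = _ := by rw [hab]; simp only [mul_assoc]
  have hb2 : MulAut.conj (c * b * a)⁻¹ (b * a * b⁻¹) = (c * a)⁻¹ * a * (c * a) := by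
    rw [MulAut.conj_apply, inv_inv, ← hbc]
    group
  -- the four basic chains
  have e1 : c * (MulAut.conj (c * b * a)⁻¹ ^ (0 : ℤ)) b *
      (MulAut.conj (c * b * a)⁻¹ ^ (0 : ℤ)) a = c * b * a := by
    simp only [zpow_zero, MulAut.one_apply]
  have e2 : b * (MulAut.conj (c * b * a)⁻¹ ^ (0 : ℤ)) c *
      (MulAut.conj (c * b * a)⁻¹ ^ (0 : ℤ)) a = c * b * a := by
    simp only [zpow_zero, MulAut.one_apply, hbc]
  have e3 : c * (MulAut.conj (c * b * a)⁻¹ ^ (1 : ℤ)) b *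
      (MulAut.conj (c * b * a)⁻¹ ^ (0 : ℤ)) b = c * b * a := by
    rw [zpow_zero, zpow_one, MulAut.one_apply, hb1, mul_assoc, inv_mul_cancel_right, mul_assoc]
  have e4 : b * (MulAut.conj (c * b * a)⁻¹ ^ (2 : ℤ)) b *
      (MulAut.conj (c * b * a)⁻¹ ^ (0 : ℤ)) (c * a * c * a⁻¹ * c⁻¹) = c * b * a := by
    rw [zpow_zero, MulAut.one_apply, zpow_two, MulAut.mul_apply, hb1, hb2, ← hbc, mul_assoc b,
      mul_assoc b c, mul_right_inj]
    have : a * c * a * c * a * c * a⁻¹ * c⁻¹ = c * a * c * a := by rw [← hac]; group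
    calc (c * a)⁻¹ * a * (c * a) * (c * a * c * a⁻¹ * c⁻¹)
        = (c * a)⁻¹ * (a * c * a * c * a * c * a⁻¹ * c⁻¹) := by simp only [mul_assoc]
      _ = c * a := by rw [this]; group
  -- Conjugating by ca takes b·acaca to δ² and c to h. These commute because c commutes with
  -- b·acaca, a lift of the translation T₁, by the length-six relation and bc = cb.
  have e5 : (MulAut.conj (c * b * a)⁻¹ ^ (2 : ℤ)) (c * a * c * a⁻¹ * c⁻¹) =
      c * a * c * a⁻¹ * c⁻¹ := by
    have key : c * (b * (a * c * a * c * a)) = b * (a * c * a * c * a) * c := by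
      calc c * (b * (a * c * a * c * a)) = c * b * (a * c * a * c * a) := by
            rw [← mul_assoc c b]
        _ = b * (c * a * c * a * c * a) := by rw [← hbc]; simp only [mul_assoc]
        _ = _ := by rw [hac]; simp only [mul_assoc]
    have hδ : (c * b * a) * (c * b * a) = c * a * (b * (a * c * a * c * a)) * (c * a)⁻¹ := by
      have : c * b * a * (c * b * a) * (c * a) = c * a * (b * (a * c * a * c * a)) := by
        calc c * b * a * (c * b * a) * (c * a)
            = c * (b * a * (c * b) * a * c * a) := by simp only [mul_assoc]
          _ = c * ((b * a * b) * c * a * c * a) := by rw [← hbc]; simp only [mul_assoc]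
          _ = _ := by rw [← hab]; simp only [mul_assoc]
      rw [← this, mul_inv_cancel_right]
    rw [zpow_two, ← map_mul, ← mul_inv_rev, MulAut.conj_apply, inv_inv, mul_assoc,
      inv_mul_eq_iff_eq_mul, hδ]
    have hh : c * a * c * a⁻¹ * c⁻¹ = c * a * c * (c * a)⁻¹ := by group
    rw [hh]
    calc c * a * c * (c * a)⁻¹ * (c * a * (b * (a * c * a * c * a)) * (c * a)⁻¹)
        = c * a * (c * (b * (a * c * a * c * a))) * (c * a)⁻¹ := by group
      _ = _ := by rw [key]; group
  -- Hence h depends only on the parity of its index, which matches the parity conditions in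
  -- `DualChain`.
  have hper : ∀ k l : ℤ, (k - l) % 2 = 0 →
      (MulAut.conj (c * b * a)⁻¹ ^ k) (c * a * c * a⁻¹ * c⁻¹) =
        (MulAut.conj (c * b * a)⁻¹ ^ l) (c * a * c * a⁻¹ * c⁻¹) := by
    intro k l hkl
    obtain ⟨m, hm⟩ : ∃ m, k = l + 2 * m := ⟨(k - l) / 2, by omega⟩
    rw [hm, zpow_add, MulAut.mul_apply, zpow_mul]
    congr 1
    have : ∀ φ : MulAut H, ∀ x, φ x = x → ∀ m : ℤ, (φ ^ m) x = x := by
      intro φ x hx m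
      have hmem : φ ^ m ∈ MulAction.stabilizer (MulAut H) x :=
        Subgroup.zpow_mem _ (show φ • x = x from hx) m
      exact hmem
    exact this _ _ e5 m
  have c1 : ∀ k : ℤ, _ := fun k => MulAut.conj_zpow_chain e1 k k k (by ring) (by ring)
  have c2 : ∀ k : ℤ, _ := fun k => MulAut.conj_zpow_chain e2 k k k (by ring) (by ring)
  have c3 : ∀ k : ℤ, _ := fun k => MulAut.conj_zpow_chain e3 k (k + 1) k (by ring) (by ring)
  have c4 : ∀ k : ℤ, _ := fun k => MulAut.conj_zpow_chain e4 k (k + 2) k (by ring) (by ring)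
  cases x <;> cases y <;> cases z <;> simp only [DualChain] at h <;> simp only [dualValue]
  case a.b.c i j k =>
    obtain ⟨rfl, rfl⟩ := h
    exact MulAut.conj_zpow_chain_rotate (MulAut.conj_zpow_chain_rotate (c2 _))
  case a.c.b i j k =>
    obtain ⟨rfl, rfl⟩ := h
    exact MulAut.conj_zpow_chain_rotate (MulAut.conj_zpow_chain_rotate (c1 _))
  case b.a.c i j k =>
    obtain ⟨rfl, rfl⟩ := h
    exact MulAut.conj_zpow_chain_rotate (c1 _)
  case b.b.c i j k =>
    obtain ⟨rfl, rfl⟩ := h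
    have := MulAut.conj_zpow_chain_rotate (c3 (k - 1))
    rwa [sub_add_cancel] at this
  case b.b.h i j k =>
    obtain ⟨rfl, -, h⟩ := h
    rw [← hper i k h]
    exact c4 i
  case b.c.a i j k =>
    obtain ⟨rfl, rfl⟩ := h
    exact c2 _
  case b.c.b i j k =>
    obtain ⟨rfl, rfl⟩ := h
    have := MulAut.conj_zpow_chain_rotate (MulAut.conj_zpow_chain_rotate (c3 i))
    rwa [add_assoc] at this
  case b.h.b i j k =>
    obtain ⟨-, h, rfl⟩ := h
    rw [← hper (i - 2) j (by omega)]
    have := MulAut.conj_zpow_chain_rotate (c4 (i - 2))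
    rwa [sub_add_cancel, show i - 2 + 1 = i - 1 by ring] at this
  case c.a.b i j k =>
    obtain ⟨rfl, rfl⟩ := h
    exact MulAut.conj_zpow_chain_rotate (c2 _)
  case c.b.a i j k =>
    obtain ⟨rfl, rfl⟩ := h
    exact c1 _
  case c.b.b i j k =>
    obtain ⟨rfl, rfl⟩ := h
    exact c3 _
  case h.b.b i j k =>
    obtain ⟨-, h, rfl⟩ := h
    rw [← hper (j - 1) i (by omega)]
    have := MulAut.conj_zpow_chain_rotate (MulAut.conj_zpow_chain_rotate (c4 (j - 1)))
    rwa [sub_add_cancel, show j - 1 + 2 + 1 = j + 2 by ring] at this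

end ArtinRelations

/-! ### Simple elements of the interval group -/

section IntervalGroupElement

variable {G : Type*} [Group G] {A : Set G} {g : G}

/-- The element of the interval group represented by an element of the interval. -/
noncomputable def intervalGroupElement (A : Set G) (g u : G) : IntervalGroup A g :=
  intervalMonoidToGroup A g (simpleElement A g u)

theorem intervalGroupElement_mul (h : IsConjGenerating A) {u v : G}
    (huv : PrefixLE A u (u * v)) (hg : PrefixLE A (u * v) g) :
    intervalGroupElement A g u * intervalGroupElement A g v =
      intervalGroupElement A g (u * v) := by
  rw [intervalGroupElement, intervalGroupElement, ← map_mul, simpleElement_mul h huv hg]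
  rfl

theorem intervalGroupElement_label (h : IsConjGenerating A) (r : IntervalLabel A g) :
    intervalGroupElement A g r.1 = PresentedGroup.of r := by
  rw [intervalGroupElement, simpleElement_label h, intervalMonoidToGroup_of]

theorem intervalGroupElement_mul_of_le (h : IsConjGenerating A) {s p : G}
    (hs : PrefixLE A s p) (hp : PrefixLE A p g) :
    intervalGroupElement A g s * intervalGroupElement A g p =
      intervalGroupElement A g p * intervalGroupElement A g (p⁻¹ * s * p) := by
  simp only [intervalGroupElement, ← map_mul, simpleElement_mul_simpleElement_of_le h hs hp]

theorem isIntervalEdge_one_of_mul_mul_eq (h : IsConjGenerating A) (hg : wordLength A g = 3)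
    {r s t : G} (hr : r ∈ A) (hs : s ∈ A) (ht : t ∈ A) (e : r * s * t = g) :
    IsIntervalEdge A g 1 r := by
  obtain ⟨h1, h2⟩ := prefixLE_of_mul_mul_eq h hg hr hs ht e
  have h3 := wordLength_le_one hr
  have h4 := wordLength_le_one hs
  have h5 := wordLength_le_one ht
  have e' : (r * s)⁻¹ * g = t := by rw [← e, inv_mul_cancel_left]
  refine (isIntervalEdge_iff h _ _).2 ⟨hr, ?_, .one_left _ _, ?_⟩
  · simp only [PrefixLE, e', inv_mul_cancel_left] at h1 h2
    omega
  · rw [one_mul]; exact h1.trans h h2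

theorem intervalGroupElement_mul_of_mul_mul_eq (h : IsConjGenerating A)
    (hg : wordLength A g = 3) {r s t : G} (hr : r ∈ A) (hs : s ∈ A) (ht : t ∈ A)
    (e : r * s * t = g) :
    intervalGroupElement A g r * intervalGroupElement A g s = intervalGroupElement A g (r * s) :=
  let ⟨h1, h2⟩ := prefixLE_of_mul_mul_eq h hg hr hs ht e
  intervalGroupElement_mul h h1 h2

theorem intervalGroupElement_mul_mul_eq (h : IsConjGenerating A)
    (hg : wordLength A g = 3) {r s t : G} (hr : r ∈ A) (hs : s ∈ A) (ht : t ∈ A)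
    (e : r * s * t = g) :
    intervalGroupElement A g r * intervalGroupElement A g s * intervalGroupElement A g t =
      intervalGroupElement A g g := by
  have h2 := (prefixLE_of_mul_mul_eq h hg hr hs ht e).2
  rw [intervalGroupElement_mul_of_mul_mul_eq h hg hr hs ht e,
    intervalGroupElement_mul h (by rwa [e]) (by rw [e]; exact .refl _ _), e]

theorem IsConjGenerating.conj_inv_mem (h : IsConjGenerating A) {k a : G} (ha : a ∈ A) :
    k⁻¹ * a * k ∈ A := by
  simpa using h.conj_mem k⁻¹ a ha

/-- A Hurwitz move: (r, s) and (s, s⁻¹rs) have the same product, and both begin a factorization of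
g. -/
theorem intervalGroupElement_hurwitz (h : IsConjGenerating A) (hg : wordLength A g = 3)
    {r s t : G} (hr : r ∈ A) (hs : s ∈ A) (ht : t ∈ A) (e : r * s * t = g) :
    intervalGroupElement A g r * intervalGroupElement A g s =
      intervalGroupElement A g s * intervalGroupElement A g (s⁻¹ * r * s) := by
  have e' : s * (s⁻¹ * r * s) = r * s := by group
  rw [intervalGroupElement_mul_of_mul_mul_eq h hg hr hs ht e,
    intervalGroupElement_mul_of_mul_mul_eq h hg hs (h.conj_inv_mem hr) ht (by rw [e', e]), e']

/-- Conjugating the pair (r, s) by rs keeps its product, so it still begins a factorization of g and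
moving past rs can be iterated. The case n = 3 yields the braid relation of length six. -/
theorem intervalGroupElement_mul_pow (h : IsConjGenerating A) (hg : wordLength A g = 3)
    {r s t : G} (hr : r ∈ A) (hs : s ∈ A) (ht : t ∈ A) (e : r * s * t = g) (n : ℕ) :
    intervalGroupElement A g r * intervalGroupElement A g (r * s) ^ n =
      intervalGroupElement A g (r * s) ^ n *
        intervalGroupElement A g ((r * s)⁻¹ ^ n * r * (r * s) ^ n) := by
  induction n generalizing r s with
  | zero => simp
  | succ n ih =>
    obtain ⟨h1, h2⟩ := prefixLE_of_mul_mul_eq h hg hr hs ht e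
    have e' : (r * s)⁻¹ * r * (r * s) * ((r * s)⁻¹ * s * (r * s)) = r * s := by group
    have := ih (h.conj_inv_mem (k := r * s) hr) (h.conj_inv_mem (k := r * s) hs) (by rw [e', e])
    rw [e'] at this
    rw [pow_succ', ← mul_assoc, intervalGroupElement_mul_of_le h h1 h2, mul_assoc, this,
      pow_succ (r * s)⁻¹, pow_succ' (r * s)]
    simp only [mul_assoc]

variable {g' k : G}

/-- Conjugation by `k` as a homomorphism of interval groups. -/
noncomputable def intervalGroupConj (h : IsConjGenerating A) (hg : g' = k * g * k⁻¹) :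
    IntervalGroup A g →* IntervalGroup A g' :=
  IntervalGroup.liftPotential (fun r => PresentedGroup.of (r.conj h hg))
    (fun u => intervalGroupElement A g' (k * u * k⁻¹)) fun u r hr => by
      obtain ⟨-, -, h1, h2⟩ := (isIntervalEdge_iff h _ _).1 (hr.conj h hg)
      rw [← intervalGroupElement_label h]
      simp only [IntervalLabel.conj]
      rw [intervalGroupElement_mul h h1 h2]
      congr 1
      group

theorem intervalGroupConj_of (h : IsConjGenerating A) (hg : g' = k * g * k⁻¹)
    (r : IntervalLabel A g) :
    intervalGroupConj h hg (PresentedGroup.of r) = PresentedGroup.of (r.conj h hg) :=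
  IntervalGroup.liftPotential_of _ _ _ r

theorem intervalGroupConj_conj (h : IsConjGenerating A) {k' : G} (hk : k' * k = 1)
    (hg : g' = k * g * k⁻¹) (hg' : g = k' * g' * k'⁻¹) :
    (intervalGroupConj h hg').comp (intervalGroupConj h hg) = MonoidHom.id _ := by
  refine PresentedGroup.ext fun r => ?_
  simp only [MonoidHom.comp_apply, intervalGroupConj_of, MonoidHom.id_apply]
  congr 1
  refine Subtype.ext ?_
  obtain rfl : k' = k⁻¹ := eq_inv_of_mul_eq_one_left hk
  simp only [IntervalLabel.conj]
  group

/-- Conjugation by `k` as an isomorphism of interval groups. -/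
noncomputable def intervalGroupConjEquiv (h : IsConjGenerating A) (hg : g' = k * g * k⁻¹) :
    IntervalGroup A g ≃* IntervalGroup A g' :=
  have hg' : g = k⁻¹ * g' * k⁻¹⁻¹ := by rw [hg]; group
  (intervalGroupConj h hg).toMulEquiv (intervalGroupConj h hg')
    (intervalGroupConj_conj h (inv_mul_cancel k) hg hg')
    (intervalGroupConj_conj h (mul_inv_cancel k) hg' hg)

theorem intervalGroupConjEquiv_of (h : IsConjGenerating A) (hg : g' = k * g * k⁻¹)
    (r : IntervalLabel A g) :
    intervalGroupConjEquiv h hg (PresentedGroup.of r) = PresentedGroup.of (r.conj h hg) :=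
  intervalGroupConj_of h hg r

theorem isLatticePoset_conj (h : IsConjGenerating A) (hg : g' = k * g * k⁻¹)
    (hL : @IsLatticePoset (CayleyInterval A g) (cayleyIntervalPartialOrder h.closure_eq_top g)) :
    @IsLatticePoset (CayleyInterval A g') (cayleyIntervalPartialOrder h.closure_eq_top g') := by
  let _ := cayleyIntervalPartialOrder h.closure_eq_top g
  let _ := cayleyIntervalPartialOrder h.closure_eq_top g'
  have hg' : g = k⁻¹ * g' * k⁻¹⁻¹ := by rw [hg]; group
  let e : CayleyInterval A g ≃o CayleyInterval A g' :=
    { toFun := fun u => ⟨k * u.1 * k⁻¹, (mem_cayleyInterval_iff _).2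
        (hg ▸ ((mem_cayleyInterval_iff _).1 u.2).conj h k)⟩
      invFun := fun u => ⟨k⁻¹ * u.1 * k⁻¹⁻¹, (mem_cayleyInterval_iff _).2
        (hg' ▸ ((mem_cayleyInterval_iff _).1 u.2).conj h k⁻¹)⟩
      left_inv := fun u => Subtype.ext (by group)
      right_inv := fun u => Subtype.ext (by group)
      map_rel_iff' := fun {u v} => by
        rw [cayleyInterval_le_iff, cayleyInterval_le_iff]
        refine ⟨fun huv => ?_, fun huv => huv.conj h k⟩
        have : PrefixLE A (k⁻¹ * (k * u.1 * k⁻¹) * k⁻¹⁻¹) (k⁻¹ * (k * v.1 * k⁻¹) * k⁻¹⁻¹) :=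
          huv.conj h k⁻¹
        convert this using 1 <;> group }
  intro a b
  obtain ⟨⟨m, hm⟩, j, hj⟩ := hL (e.symm a) (e.symm b)
  have himage : e '' {e.symm a, e.symm b} = {a, b} := by
    rw [Set.image_pair, e.apply_symm_apply, e.apply_symm_apply]
  exact ⟨⟨e m, himage ▸ e.isGLB_image'.2 hm⟩, ⟨e j, himage ▸ e.isLUB_image'.2 hj⟩⟩

end IntervalGroupElement

/-! ### Rotating the factors of a Coxeter element. -/

namespace CoxeterMatrix

variable {B : Type*} {M : CoxeterMatrix B} {w w' : M.Group}

theorem encodesDualPresentation_of_mulEquiv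
    (hS : ∀ i : B, ∃ u, IsIntervalEdge M.reflections w u (M.simple i))
    (φ : M.ArtinGroup ≃* M.DualArtinGroup w)
    (hφ : ∀ i, φ (PresentedGroup.of i) = intervalGroupElement M.reflections w (M.simple i)) :
    M.EncodesDualPresentation w :=
  ⟨hS, φ, fun i => (hφ i).trans
    (intervalGroupElement_label M.isConjGenerating_reflections ⟨M.simple i, hS i⟩)⟩

/-- Conjugation by s_i⁻¹ identifies the two dual groups but sends the label s_x to s_i⁻¹s_xs_i.
Conjugating afterwards by the generator s_i of the target restores s_x, by Hurwitz moves there. -/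
theorem EncodesDualPresentation.rotate {i j k : B} (hw : wordLength M.reflections w = 3)
    (hcover : ∀ x, x = i ∨ x = j ∨ x = k)
    (e : w = M.simple i * M.simple j * M.simple k)
    (e' : w' = M.simple j * M.simple k * M.simple i) (H : M.EncodesDualPresentation w) :
    M.EncodesDualPresentation w' := by
  have h := M.isConjGenerating_reflections
  obtain ⟨hS, φ, hφ⟩ := H
  have hi := M.simple_mem_reflections i
  have hj := M.simple_mem_reflections j
  have hk := M.simple_mem_reflections k
  have hconj : w' = (M.simple i)⁻¹ * w * (M.simple i)⁻¹⁻¹ := by rw [e, e']; group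
  have hw' : wordLength M.reflections w' = 3 := by rw [hconj, h.wordLength_conj, hw]
  have hik := h.conj_inv_mem (k := M.simple i) hk
  have hij := h.conj_inv_mem (k := M.simple k * M.simple i) hj
  have e₁ : M.simple j * M.simple i * ((M.simple i)⁻¹ * M.simple k * M.simple i) = w' := by
    rw [e']; group
  have e₂ : M.simple k * M.simple i * ((M.simple k * M.simple i)⁻¹ * M.simple j *
      (M.simple k * M.simple i)) = w' := by rw [e']; group
  have e₃ : M.simple i * ((M.simple i)⁻¹ * M.simple j * M.simple i) *
      ((M.simple i)⁻¹ * M.simple k * M.simple i) = w' := by rw [e']; group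
  have key : ∀ x, intervalGroupElement M.reflections w' (M.simple x) *
      intervalGroupElement M.reflections w' (M.simple i) =
      intervalGroupElement M.reflections w' (M.simple i) *
      intervalGroupElement M.reflections w' ((M.simple i)⁻¹ * M.simple x * M.simple i) := by
    intro x
    rcases hcover x with rfl | rfl | rfl
    · rw [inv_mul_cancel, one_mul]
    · exact intervalGroupElement_hurwitz h hw' hj hi hik e₁
    · exact intervalGroupElement_hurwitz h hw' hk hi hij e₂
  refine encodesDualPresentation_of_mulEquiv (fun x => ⟨1, ?_⟩)
    ((φ.trans (intervalGroupConjEquiv h hconj)).trans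
      (MulAut.conj (intervalGroupElement M.reflections w' (M.simple i)))) fun x => ?_
  · rcases hcover x with rfl | rfl | rfl
    · exact isIntervalEdge_one_of_mul_mul_eq h hw' hi (h.conj_inv_mem hj) hik e₃
    · exact isIntervalEdge_one_of_mul_mul_eq h hw' hj hi hik e₁
    · exact isIntervalEdge_one_of_mul_mul_eq h hw' hk hi hij e₂
  · rw [MulEquiv.trans_apply, MulEquiv.trans_apply, hφ, MulAut.conj_apply, mul_inv_eq_iff_eq_mul,
      key]
    congr 1
    refine (intervalGroupConjEquiv_of h hconj ⟨M.simple x, hS x⟩).trans ?_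
    rw [← intervalGroupElement_label h]
    simp only [IntervalLabel.conj, inv_inv]

end CoxeterMatrix

/-! ### The Artin group of type `G̃₂` -/

theorem affineLabel_eq_of_affineReflection_eq {u v : G₂Coroot} {m n : ℤ}
    (e : affineReflection u m = affineReflection v n) : affineLabel u m = affineLabel v n := by
  have h0 := Equiv.congr_fun e (0, 0)
  have h1 := Equiv.congr_fun e (1, 0)
  have h2 := Equiv.congr_fun e (0, 1)
  simp only [affineReflection_apply, Prod.ext_iff] at h0 h1 h2
  clear e
  obtain ⟨h0, h0'⟩ := h0
  obtain ⟨h1, h1'⟩ := h1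
  obtain ⟨h2, h2'⟩ := h2
  cases u <;> cases v <;> simp only [affineReflectionFun] at h0 h0' h1 h1' h2 h2' <;>
    first
    | (exfalso; omega)
    | (obtain rfl : m = n := by omega
       rfl)

/-- The next label, obtained by conjugation by the glide reflection. -/
def DualLabel.succ : DualLabel → DualLabel
  | .a k => .a (k + 1)
  | .b k => .b (k + 1)
  | .c k => .c (k + 1)
  | .h k => .h (1 - k)

theorem DualLabel.succ_injective : Function.Injective DualLabel.succ := by
  intro x y e
  cases x <;> cases y <;>
    simp only [DualLabel.succ, DualLabel.a.injEq, DualLabel.b.injEq, DualLabel.c.injEq,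
      DualLabel.h.injEq, reduceCtorEq] at e ⊢ <;> omega

/-- The glide shifts the families a, b, c by one. Its axis lies halfway between levels 0 and 1 of
the mirrors h, so level k goes to 1 - k. -/
theorem exists_affineReflection_succ (v : G₂Coroot) (n : ℤ) :
    ∃ v' n', affineReflection v n * affineGlide = affineGlide * affineReflection v' n' ∧
      affineLabel v' n' = (affineLabel v n).succ := by
  let p : G₂Coroot × ℤ := match v with
    | .v10 => (.v10, n - 1)
    | .v01 => (.v31, -n)
    | .v31 => (.v01, 1 - n)
    | .v11 => (.v21, 1 - n)
    | .v32 => (.v32, 1 - n)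
    | .v21 => (.v11, 2 - n)
  refine ⟨p.1, p.2, Equiv.ext fun z => ?_, ?_⟩
  · cases v <;> ext <;> dsimp only [p] <;>
      simp only [Equiv.Perm.mul_apply, affineReflection_apply, affineReflectionFun,
        affineGlide_apply] <;> ring
  · cases v <;> simp only [p, affineLabel, DualLabel.succ, DualLabel.a.injEq, DualLabel.b.injEq,
      DualLabel.c.injEq] <;> ring

namespace CoxeterMatrix

theorem prod_map_alternatingWord_succ {B H : Type*} [Monoid H] (f : B → H) (i j : B) (m : ℕ) :
    ((CoxeterSystem.alternatingWord i j (m + 1)).map f).prod =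
      ((CoxeterSystem.alternatingWord j i m).map f).prod * f j := by
  simp [CoxeterSystem.alternatingWord]

/-- The homomorphism from the Artin group of type `G̃₂` given by elements satisfying the Artin
relations. -/
def affineG₂ArtinLift {H : Type*} [Group H] (x : Fin 3 → H) (h02 : x 0 * x 2 = x 2 * x 0)
    (h01 : x 0 * x 1 * x 0 = x 1 * x 0 * x 1)
    (h21 : x 2 * x 1 * x 2 * x 1 * x 2 * x 1 = x 1 * x 2 * x 1 * x 2 * x 1 * x 2) :
    affineG₂.ArtinGroup →* H :=
  PresentedGroup.toGroup (f := x) (by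
    rintro _ ⟨i, j, rfl⟩
    rw [map_mul, map_inv, mul_inv_eq_one, map_list_prod, map_list_prod, List.map_map, List.map_map]
    have hx : FreeGroup.lift x ∘ FreeGroup.of = x := funext fun i => FreeGroup.lift_apply_of
    rw [hx]
    have r02 : ((CoxeterSystem.alternatingWord (0 : Fin 3) 2 2).map x).prod =
        ((CoxeterSystem.alternatingWord 2 0 2).map x).prod := by
      simpa [prod_map_alternatingWord_succ, CoxeterSystem.alternatingWord] using h02
    have r01 : ((CoxeterSystem.alternatingWord (0 : Fin 3) 1 3).map x).prod =
        ((CoxeterSystem.alternatingWord 1 0 3).map x).prod := by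
      simpa [prod_map_alternatingWord_succ, CoxeterSystem.alternatingWord, ← mul_assoc] using h01.symm
    have r21 : ((CoxeterSystem.alternatingWord (2 : Fin 3) 1 6).map x).prod =
        ((CoxeterSystem.alternatingWord 1 2 6).map x).prod := by
      simpa [prod_map_alternatingWord_succ, CoxeterSystem.alternatingWord, ← mul_assoc] using h21
    fin_cases i <;> fin_cases j
    exacts [rfl, r01, r02, r01.symm, rfl, r21.symm, r02.symm, r21, rfl])

theorem affineG₂ArtinLift_of {H : Type*} [Group H] (x : Fin 3 → H) (h02 : x 0 * x 2 = x 2 * x 0)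
    (h01 : x 0 * x 1 * x 0 = x 1 * x 0 * x 1)
    (h21 : x 2 * x 1 * x 2 * x 1 * x 2 * x 1 = x 1 * x 2 * x 1 * x 2 * x 1 * x 2) (i : Fin 3) :
    affineG₂ArtinLift x h02 h01 h21 (PresentedGroup.of i) = x i :=
  PresentedGroup.toGroup.of _

/-- The standard generators of the Artin group of type `G̃₂`. -/
def affineG₂Artin (i : Fin 3) : affineG₂.ArtinGroup := PresentedGroup.of i

theorem affineG₂_artin_relation (i j : Fin 3) (n : ℕ) (hn : affineG₂ i j = n) :
    ((CoxeterSystem.alternatingWord i j n).map affineG₂Artin).prod =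
      ((CoxeterSystem.alternatingWord j i n).map affineG₂Artin).prod := by
  subst hn
  have := PresentedGroup.one_of_mem (rels := affineG₂.artinRelators) ⟨i, j, rfl⟩
  rw [map_mul, map_inv, mul_inv_eq_one, map_list_prod, map_list_prod, List.map_map,
    List.map_map] at this
  exact this

theorem affineG₂_artin_comm :
    affineG₂Artin 0 * affineG₂Artin 2 = affineG₂Artin 2 * affineG₂Artin 0 := by
  simpa [prod_map_alternatingWord_succ, CoxeterSystem.alternatingWord] using
    affineG₂_artin_relation 0 2 2 rfl

theorem affineG₂_artin_braid₃ : affineG₂Artin 1 * affineG₂Artin 0 * affineG₂Artin 1 =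
    affineG₂Artin 0 * affineG₂Artin 1 * affineG₂Artin 0 := by
  simpa [prod_map_alternatingWord_succ, CoxeterSystem.alternatingWord, mul_assoc] using
    affineG₂_artin_relation 0 1 3 rfl

theorem affineG₂_artin_braid₆ :
    affineG₂Artin 2 * affineG₂Artin 1 * affineG₂Artin 2 * affineG₂Artin 1 * affineG₂Artin 2 *
      affineG₂Artin 1 =
    affineG₂Artin 1 * affineG₂Artin 2 * affineG₂Artin 1 * affineG₂Artin 2 * affineG₂Artin 1 *
      affineG₂Artin 2 := by
  simpa [prod_map_alternatingWord_succ, CoxeterSystem.alternatingWord, mul_assoc] using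
    affineG₂_artin_relation 2 1 6 rfl

end CoxeterMatrix

/-! ### The dual presentation of type `G̃₂` -/

namespace CoxeterMatrix

/-- The Coxeter element `s₃ s₁ s₂` as a product of three reflections, in four ways. -/
theorem affineG₂Coxeter_eq_mul :
    affineG₂.simple 0 * affineG₂.simple 2 * affineG₂.simple 1 = affineG₂Coxeter ∧
    affineG₂.simple 2 * affineG₂.simple 1 *
      ((affineG₂.simple 1)⁻¹ * affineG₂.simple 0 * affineG₂.simple 1) = affineG₂Coxeter ∧
    affineG₂.simple 0 * affineG₂.simple 1 * ((affineG₂.simple 0 * affineG₂.simple 1)⁻¹ *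
      affineG₂.simple 2 * (affineG₂.simple 0 * affineG₂.simple 1)) = affineG₂Coxeter ∧
    affineG₂.simple 1 * ((affineG₂.simple 1)⁻¹ * affineG₂.simple 0 * affineG₂.simple 1) *
      ((affineG₂.simple 0 * affineG₂.simple 1)⁻¹ *
      affineG₂.simple 2 * (affineG₂.simple 0 * affineG₂.simple 1)) = affineG₂Coxeter := by
  refine ⟨by rw [← affineG₂_simple_comm]; rfl, ?_, ?_, ?_⟩ <;> rw [affineG₂Coxeter] <;> group

theorem simple_isIntervalEdge_affineG₂Coxeter (i : Fin 3) :
    IsIntervalEdge affineG₂.reflections affineG₂Coxeter 1 (affineG₂.simple i) := by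
  have h := affineG₂.isConjGenerating_reflections
  obtain ⟨e1, e2, -, e4⟩ := affineG₂Coxeter_eq_mul
  have hs := affineG₂.simple_mem_reflections
  have := @isIntervalEdge_one_of_mul_mul_eq _ _ _ _ h wordLength_affineG₂Coxeter
  fin_cases i
  exacts [this (hs _) (hs _) (hs _) e1,
    this (hs _) (h.conj_inv_mem (hs _)) (h.conj_inv_mem (hs _)) e4,
    this (hs _) (hs _) (hs _) rfl]

/-- The element of the dual Artin group represented by an element of the Coxeter group. -/
noncomputable def affineG₂Simple (u : affineG₂.Group) : affineG₂.DualArtinGroup affineG₂Coxeter :=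
  intervalGroupElement affineG₂.reflections affineG₂Coxeter u

theorem affineG₂_dual_comm :
    affineG₂Simple (affineG₂.simple 0) * affineG₂Simple (affineG₂.simple 2) =
      affineG₂Simple (affineG₂.simple 2) * affineG₂Simple (affineG₂.simple 0) := by
  have h := affineG₂.isConjGenerating_reflections
  have hw := wordLength_affineG₂Coxeter
  have hs := affineG₂.simple_mem_reflections
  simp only [affineG₂Simple]
  rw [intervalGroupElement_mul_of_mul_mul_eq h hw (hs _) (hs _) (hs _) affineG₂Coxeter_eq_mul.1,
    intervalGroupElement_mul_of_mul_mul_eq h hw (hs _) (hs _) (hs 1) rfl, affineG₂_simple_comm]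

/-- Write A, B, X for the classes of s₂, s₁ and s₂s₁s₂. Two Hurwitz moves give BA = AX = XB, whence
BAB = AXB = A(AX) = ABA. -/
theorem affineG₂_dual_braid₃ :
    affineG₂Simple (affineG₂.simple 0) * affineG₂Simple (affineG₂.simple 1) *
      affineG₂Simple (affineG₂.simple 0) =
    affineG₂Simple (affineG₂.simple 1) * affineG₂Simple (affineG₂.simple 0) *
      affineG₂Simple (affineG₂.simple 1) := by
  have h := affineG₂.isConjGenerating_reflections
  have hw := wordLength_affineG₂Coxeter
  have hs := affineG₂.simple_mem_reflections
  obtain ⟨-, -, e3, e4⟩ := affineG₂Coxeter_eq_mul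
  simp only [affineG₂Simple]
  have h1 := intervalGroupElement_hurwitz h hw (hs _) (hs _) (h.conj_inv_mem (hs _)) e3
  have h2 := intervalGroupElement_hurwitz h hw (hs _) (h.conj_inv_mem (hs _))
    (h.conj_inv_mem (hs _)) e4
  have e5 : (affineG₂.simple 1)⁻¹ * affineG₂.simple 0 * affineG₂.simple 1 *
      affineG₂.simple 0 = affineG₂.simple 0 * affineG₂.simple 1 := by
    rw [mul_assoc, mul_assoc, inv_mul_eq_iff_eq_mul, ← mul_assoc, affineG₂_simple_braid₃,
      mul_assoc]
  have e6 : ((affineG₂.simple 1)⁻¹ * affineG₂.simple 0 * affineG₂.simple 1)⁻¹ *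
      affineG₂.simple 1 * ((affineG₂.simple 1)⁻¹ * affineG₂.simple 0 * affineG₂.simple 1) =
      affineG₂.simple 0 := by
    rw [mul_assoc, inv_mul_eq_iff_eq_mul, e5]; group
  rw [e6] at h2
  rw [h1, mul_assoc, ← h2, ← h1, mul_assoc]

/-- In the Coxeter group (s₃s₂)³ commutes with s₃. This lifts to C(CA)³ = (CA)³C for the classes C,
A of s₃, s₂, and cancelling C on the left gives the relation. -/
theorem affineG₂_dual_braid₆ :
    affineG₂Simple (affineG₂.simple 2) * affineG₂Simple (affineG₂.simple 1) *
      affineG₂Simple (affineG₂.simple 2) * affineG₂Simple (affineG₂.simple 1) *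
      affineG₂Simple (affineG₂.simple 2) * affineG₂Simple (affineG₂.simple 1) =
    affineG₂Simple (affineG₂.simple 1) * affineG₂Simple (affineG₂.simple 2) *
      affineG₂Simple (affineG₂.simple 1) * affineG₂Simple (affineG₂.simple 2) *
      affineG₂Simple (affineG₂.simple 1) * affineG₂Simple (affineG₂.simple 2) := by
  have h := affineG₂.isConjGenerating_reflections
  have hw := wordLength_affineG₂Coxeter
  have hs := affineG₂.simple_mem_reflections
  obtain ⟨-, e2, -, -⟩ := affineG₂Coxeter_eq_mul
  have h1 := intervalGroupElement_mul_pow h hw (hs _) (hs _) (h.conj_inv_mem (hs _)) e2 3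
  have e5 : affineG₂.simple 2 * (affineG₂.simple 2 * affineG₂.simple 1) ^ 3 =
      (affineG₂.simple 2 * affineG₂.simple 1) ^ 3 * affineG₂.simple 2 := by
    have := affineG₂_simple_braid₆
    simp only [pow_succ, pow_zero, one_mul, mul_assoc] at this ⊢
    rw [this]
  rw [inv_pow, mul_assoc, e5, inv_mul_cancel_left,
    ← intervalGroupElement_mul_of_mul_mul_eq h hw (hs _) (hs _) (h.conj_inv_mem (hs _)) e2] at h1
  simp only [affineG₂Simple]
  simp only [pow_succ, pow_zero, one_mul, mul_assoc] at h1 ⊢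
  exact mul_left_cancel h1

/-- The homomorphism from the Artin group to the dual Artin group. -/
noncomputable def affineG₂ToDual :
    affineG₂.ArtinGroup →* affineG₂.DualArtinGroup affineG₂Coxeter :=
  affineG₂ArtinLift (fun i => affineG₂Simple (affineG₂.simple i)) affineG₂_dual_comm
    affineG₂_dual_braid₃ affineG₂_dual_braid₆

theorem affineG₂ToDual_artin (i : Fin 3) :
    affineG₂ToDual (affineG₂Artin i) = affineG₂Simple (affineG₂.simple i) :=
  affineG₂ArtinLift_of _ _ _ _ i

theorem exists_affineG₂Dual_hom : ∃ ψ : affineG₂.DualArtinGroup affineG₂Coxeter →*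
    affineG₂.ArtinGroup, ∀ i, ψ (affineG₂Simple (affineG₂.simple i)) = affineG₂Artin i := by
  classical
  have h := affineG₂.isConjGenerating_reflections
  -- The value does not depend on the chosen coroot and level, since the label is determined by the
  -- action. The default 1 is never met on reflections.
  let ρ : affineG₂.Group → affineG₂.ArtinGroup := fun r =>
    if hr : ∃ v, ∃ n, affineG₂Action r = affineReflection v n then
      dualValue (affineG₂Artin 1) (affineG₂Artin 0) (affineG₂Artin 2)
        (affineLabel hr.choose hr.choose_spec.choose) else 1
  have hρ : ∀ {r v n}, affineG₂Action r = affineReflection v n →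
      ρ r = dualValue (affineG₂Artin 1) (affineG₂Artin 0) (affineG₂Artin 2) (affineLabel v n) := by
    intro r v n e
    have hr : ∃ v, ∃ n, affineG₂Action r = affineReflection v n := ⟨v, n, e⟩
    simp only [ρ, dif_pos hr]
    rw [affineLabel_eq_of_affineReflection_eq (hr.choose_spec.choose_spec.symm.trans e)]
  obtain ⟨ψ, hψ⟩ := exists_intervalGroup_hom h wordLength_affineG₂Coxeter ρ
    (affineG₂Artin 2 * affineG₂Artin 0 * affineG₂Artin 1) (by
      intro r hr s hs t ht e
      obtain ⟨u, l, hu⟩ := exists_affineReflection hr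
      obtain ⟨v, m, hv⟩ := exists_affineReflection hs
      obtain ⟨w, n, hw⟩ := exists_affineReflection ht
      rw [hρ hu, hρ hv, hρ hw]
      exact dualValue_chain affineG₂_artin_comm affineG₂_artin_braid₃ affineG₂_artin_braid₆
        (dualChain_of_reflections e hu hv hw))
  refine ⟨ψ, fun i => ?_⟩
  let r : IntervalLabel affineG₂.reflections affineG₂Coxeter :=
    ⟨affineG₂.simple i, 1, simple_isIntervalEdge_affineG₂Coxeter i⟩
  refine (congrArg ψ (intervalGroupElement_label h r)).trans ((hψ r).trans ?_)
  fin_cases i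
  · refine (hρ affineG₂Action_simple_zero).trans ?_
    simp [affineLabel, dualValue]
  · refine (hρ affineG₂Action_simple_one).trans ?_
    simp [affineLabel, dualValue]
  · refine (hρ affineG₂Action_simple_two).trans ?_
    simp [affineLabel, dualValue]

/-- `x` is the label of the reflection by which `r` acts. -/
def HasDualLabel (r : affineG₂.Group) (x : DualLabel) : Prop :=
  ∃ v n, affineG₂Action r = affineReflection v n ∧ affineLabel v n = x

theorem HasDualLabel.eq {r s : affineG₂.Group} {x : DualLabel} (hr : HasDualLabel r x)
    (hs : HasDualLabel s x) : r = s := by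
  obtain ⟨v, n, e1, e2⟩ := hr
  obtain ⟨v', n', e1', e2'⟩ := hs
  obtain ⟨rfl, rfl⟩ := affineLabel_injective (e2.trans e2'.symm)
  exact affineG₂Action_injective (e1.trans e1'.symm)

theorem HasDualLabel.unique {r : affineG₂.Group} {x y : DualLabel} (hx : HasDualLabel r x)
    (hy : HasDualLabel r y) : x = y := by
  obtain ⟨v, n, e1, rfl⟩ := hx
  obtain ⟨v', n', e1', rfl⟩ := hy
  exact affineLabel_eq_of_affineReflection_eq (e1.symm.trans e1')

theorem HasDualLabel.conj_inv {r : affineG₂.Group} {x : DualLabel} (hr : HasDualLabel r x) :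
    HasDualLabel (affineG₂Coxeter⁻¹ * r * affineG₂Coxeter) x.succ := by
  obtain ⟨v, n, e, rfl⟩ := hr
  obtain ⟨v', n', e1, e2⟩ := exists_affineReflection_succ v n
  refine ⟨v', n', ?_, e2⟩
  rw [mul_assoc, map_mul, map_mul, map_inv, affineG₂Action_coxeter, e, e1, inv_mul_cancel_left]

theorem exists_hasDualLabel {r : affineG₂.Group} (hr : r ∈ affineG₂.reflections) :
    ∃ x, HasDualLabel r x := by
  obtain ⟨v, n, e⟩ := exists_affineReflection hr
  exact ⟨_, v, n, e, rfl⟩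

theorem HasDualLabel.conj {r : affineG₂.Group} {x : DualLabel} (hA : r ∈ affineG₂.reflections)
    (hr : HasDualLabel r x.succ) :
    HasDualLabel (affineG₂Coxeter * r * affineG₂Coxeter⁻¹) x := by
  obtain ⟨y, hy⟩ := exists_hasDualLabel
    (affineG₂.isConjGenerating_reflections.conj_mem affineG₂Coxeter r hA)
  have e : affineG₂Coxeter⁻¹ * (affineG₂Coxeter * r * affineG₂Coxeter⁻¹) * affineG₂Coxeter = r := by
    group
  have := hy.conj_inv
  rw [e] at this
  rwa [DualLabel.succ_injective (hr.unique this)]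

/-- The image K contains Δ and so is stable under conjugation by Δ, which shifts labels. From s₂,
s₁, s₃ it therefore captures all labels a, b, c. -/
theorem affineG₂ToDual_surjective : Function.Surjective affineG₂ToDual := by
  have h := affineG₂.isConjGenerating_reflections
  have hw := wordLength_affineG₂Coxeter
  set K := affineG₂ToDual.range
  have hK : ∀ i, affineG₂Simple (affineG₂.simple i) ∈ K := fun i => ⟨_, affineG₂ToDual_artin i⟩
  have hs := affineG₂.simple_mem_reflections
  have hD : affineG₂Simple affineG₂Coxeter ∈ K := by
    rw [affineG₂Simple, ← intervalGroupElement_mul_mul_eq h hw (hs 2) (hs 0) (hs 1) rfl]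
    exact K.mul_mem (K.mul_mem (hK 2) (hK 0)) (hK 1)
  have hconj : ∀ r, PrefixLE affineG₂.reflections r affineG₂Coxeter →
      (affineG₂Simple r ∈ K ↔ affineG₂Simple (affineG₂Coxeter⁻¹ * r * affineG₂Coxeter) ∈ K) := by
    intro r hr
    rw [← K.mul_mem_cancel_right hD, ← K.mul_mem_cancel_left hD (y := affineG₂Simple _)]
    simp only [affineG₂Simple]
    rw [intervalGroupElement_mul_of_le h hr (.refl _ _)]
  let Q : DualLabel → Prop := fun x => ∀ r ∈ affineG₂.reflections,
    PrefixLE affineG₂.reflections r affineG₂Coxeter → HasDualLabel r x → affineG₂Simple r ∈ K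
  have hQ : ∀ x, Q x ↔ Q x.succ := by
    intro x
    constructor
    · intro hx r hrA hr hrx
      have e1 : affineG₂Coxeter⁻¹ * (affineG₂Coxeter * r * affineG₂Coxeter⁻¹) * affineG₂Coxeter =
        r := by group
      have hr' := hr.conj h affineG₂Coxeter
      rw [mul_inv_cancel_right] at hr'
      have := hx _ (h.conj_mem _ _ hrA) hr' (hrx.conj hrA)
      rwa [hconj _ hr', e1] at this
    · intro hx r hrA hr hrx
      have hr' := hr.conj h affineG₂Coxeter⁻¹
      rw [inv_inv, inv_mul_cancel, one_mul] at hr'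
      exact (hconj r hr).2 (hx _ (h.conj_inv_mem hrA) hr' hrx.conj_inv)
  have hQZ : ∀ f : ℤ → DualLabel, (∀ k, (f k).succ = f (k + 1)) → Q (f 0) → ∀ k, Q (f k) := by
    intro f hf h0 k
    induction k with
    | zero => exact h0
    | succ k ih => rw [← hf]; exact (hQ _).1 ih
    | pred k ih =>
      refine (hQ _).2 ?_
      rw [hf, sub_add_cancel]
      exact ih
  have hbase : ∀ i x, HasDualLabel (affineG₂.simple i) x → Q x := by
    intro i x hx r _ _ hr
    rw [hr.eq hx]
    exact hK i
  have hQa : ∀ k, Q (.a k) := hQZ _ (fun _ => rfl)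
    (hbase 1 _ ⟨_, _, affineG₂Action_simple_one, by simp [affineLabel]⟩)
  have hQb : ∀ k, Q (.b k) := hQZ _ (fun _ => rfl)
    (hbase 0 _ ⟨_, _, affineG₂Action_simple_zero, by simp [affineLabel]⟩)
  have hQc : ∀ k, Q (.c k) := hQZ _ (fun _ => rfl)
    (hbase 2 _ ⟨_, _, affineG₂Action_simple_two, by simp [affineLabel]⟩)
  -- No standard generator has a label h. Instead, r·y·z = Δ with r labelled h forces y and z to
  -- carry labels b, so r lies in K because y, z and Δ do.
  have hQh : ∀ k, Q (.h k) := by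
    intro k r hrA hr hrx
    have hr1 : wordLength affineG₂.reflections r ≤ 1 := wordLength_le_one hrA
    have hr0 : wordLength affineG₂.reflections r ≠ 0 := by
      intro h0
      have e := h.eq_one_of_wordLength_eq_zero h0
      obtain ⟨v, n, e1, e2⟩ := hrx
      rw [e, map_one] at e1
      have := Equiv.congr_fun e1 (0, 1)
      have h2 := Equiv.congr_fun e1 (0, 0)
      cases v <;> simp only [affineLabel, reduceCtorEq] at e2
      simp [affineReflection_apply, affineReflectionFun] at this h2
      omega
    have hr2 : wordLength affineG₂.reflections (r⁻¹ * affineG₂Coxeter) = 1 + 1 := by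
      simp only [PrefixLE] at hr
      omega
    obtain ⟨y, z, hz, e, hy⟩ := h.exists_eq_mul_of_wordLength_eq_succ hr2
    have hyA := h.mem_of_wordLength_eq_one hy
    have e1 : r * y * z = affineG₂Coxeter := by rw [mul_assoc, ← e, mul_inv_cancel_left]
    have e2 : y * z * ((y * z)⁻¹ * r * (y * z)) = affineG₂Coxeter := by rw [← e1]; group
    set t := (y * z)⁻¹ * r * (y * z)
    have htA : t ∈ affineG₂.reflections := h.conj_inv_mem hrA
    have e3 : z * t * ((z * t)⁻¹ * y * (z * t)) = affineG₂Coxeter := by rw [← e2]; group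
    obtain ⟨y1, y2⟩ := prefixLE_of_mul_mul_eq h hw hyA hz htA e2
    obtain ⟨z1, z2⟩ := prefixLE_of_mul_mul_eq h hw hz htA (h.conj_inv_mem hyA) e3
    obtain ⟨v, n, er, hk⟩ := hrx
    obtain ⟨v', n', ey⟩ := exists_affineReflection hyA
    obtain ⟨u, m, ez⟩ := exists_affineReflection hz
    have hchain := dualChain_of_reflections e1 er ey ez
    rw [hk] at hchain
    have hy' : affineG₂Simple y ∈ K := by
      cases hy' : affineLabel v' n' <;> rw [hy'] at hchain <;> simp only [DualChain] at hchain
      exact hQb _ y hyA (y1.trans h y2) ⟨_, _, ey, hy'⟩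
    have hz' : affineG₂Simple z ∈ K := by
      cases hz' : affineLabel u m <;> rw [hz'] at hchain <;>
        cases hy' : affineLabel v' n' <;> rw [hy'] at hchain <;> simp only [DualChain] at hchain
      exact hQb _ z hz (z1.trans h z2) ⟨_, _, ez, hz'⟩
    rw [affineG₂Simple, ← intervalGroupElement_mul_mul_eq h hw hrA hyA hz e1] at hD
    exact (K.mul_mem_cancel_right hy').1 ((K.mul_mem_cancel_right hz').1 hD)
  have hall : ∀ x, Q x := by
    rintro (k | k | k | k)
    exacts [hQa k, hQb k, hQc k, hQh k]
  rw [← MonoidHom.range_eq_top, eq_top_iff, ← PresentedGroup.closure_range_of,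
    Subgroup.closure_le]
  rintro _ ⟨r, rfl⟩
  obtain ⟨x, hx⟩ := exists_hasDualLabel r.mem
  have := hall x r.1 r.mem (r.prefixLE h) hx
  rwa [affineG₂Simple, intervalGroupElement_label h] at this

theorem encodesDualPresentation_affineG₂Coxeter :
    affineG₂.EncodesDualPresentation affineG₂Coxeter := by
  obtain ⟨ψ, hψ⟩ := exists_affineG₂Dual_hom
  have hid : ψ.comp affineG₂ToDual = MonoidHom.id _ := PresentedGroup.ext fun i => by
    change ψ (affineG₂ToDual (affineG₂Artin i)) = affineG₂Artin i
    rw [affineG₂ToDual_artin, hψ]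
  exact encodesDualPresentation_of_mulEquiv
    (fun i => ⟨1, simple_isIntervalEdge_affineG₂Coxeter i⟩)
    (MulEquiv.ofBijective affineG₂ToDual ⟨Function.LeftInverse.injective (g := ψ)
      fun x => DFunLike.congr_fun hid x, affineG₂ToDual_surjective⟩) affineG₂ToDual_artin

end CoxeterMatrix

/-! ### All Coxeter elements of type `G̃₂` -/

namespace CoxeterMatrix

theorem affineG₂_exists_of_isCoxeterElement {w : affineG₂.Group} (hw : affineG₂.IsCoxeterElement w) :
    ∃ i j k : Fin 3, [i, j, k].Nodup ∧
      w = affineG₂.simple i * affineG₂.simple j * affineG₂.simple k := by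
  obtain ⟨l, hl, hmem, rfl⟩ := hw
  have hlen : l.length = 3 := by
    rw [← List.toFinset_card_of_nodup hl, show l.toFinset = Finset.univ by ext i; simp [hmem]]
    rfl
  obtain ⟨i, j, k, rfl⟩ := List.length_eq_three.1 hlen
  refine ⟨i, j, k, hl, ?_⟩
  change (List.map affineG₂.simple [i, j, k]).prod = _
  simp [mul_assoc]

/-- The properties of Coxeter elements that are invariant under rotation. -/
structure IsGoodCoxeter (w : affineG₂.Group) : Prop where
  isConj : IsConj affineG₂Coxeter w
  encodes : affineG₂.EncodesDualPresentation w

theorem IsGoodCoxeter.rotate {i j k : Fin 3} (hij : [i, j, k].Nodup)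
    (H : IsGoodCoxeter (affineG₂.simple i * affineG₂.simple j * affineG₂.simple k)) :
    IsGoodCoxeter (affineG₂.simple j * affineG₂.simple k * affineG₂.simple i) := by
  have hlen : wordLength affineG₂.reflections
      (affineG₂.simple i * affineG₂.simple j * affineG₂.simple k) = 3 := by
    obtain ⟨c, hc⟩ := isConj_iff.1 H.isConj
    rw [← hc, affineG₂.isConjGenerating_reflections.wordLength_conj, wordLength_affineG₂Coxeter]
  have hcover : ∀ x, x = i ∨ x = j ∨ x = k := by
    clear H hlen
    revert hij i j k
    decide
  refine ⟨H.isConj.trans (isConj_iff.2 ⟨(affineG₂.simple i)⁻¹, by group⟩),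
    H.encodes.rotate hlen hcover rfl rfl⟩

/-- The six orders form two cyclic rotation classes, joined by the relation s₁s₃ = s₃s₁. -/
theorem isGoodCoxeter_of_isCoxeterElement {w : affineG₂.Group}
    (hw : affineG₂.IsCoxeterElement w) : IsGoodCoxeter w := by
  have h201 : IsGoodCoxeter (affineG₂.simple 2 * affineG₂.simple 0 * affineG₂.simple 1) :=
    ⟨IsConj.refl _, encodesDualPresentation_affineG₂Coxeter⟩
  have h021 : IsGoodCoxeter (affineG₂.simple 0 * affineG₂.simple 2 * affineG₂.simple 1) := by
    rwa [← affineG₂_simple_comm]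
  have h012 := h201.rotate (by decide)
  have h120 := h012.rotate (by decide)
  have h210 := h021.rotate (by decide)
  have h102 := h210.rotate (by decide)
  obtain ⟨i, j, k, hl, rfl⟩ := affineG₂_exists_of_isCoxeterElement hw
  fin_cases i <;> fin_cases j <;> fin_cases k <;> first
    | exact absurd hl (by decide)
    | assumption

theorem isLatticePoset_of_isCoxeterElement {w : affineG₂.Group}
    (hw : affineG₂.IsCoxeterElement w) : IsLatticePoset (affineG₂.DualInterval w) := by
  obtain ⟨c, hc⟩ := isConj_iff.1 (isGoodCoxeter_of_isCoxeterElement hw).isConj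
  exact isLatticePoset_conj affineG₂.isConjGenerating_reflections hc.symm
    isLatticePoset_affineG₂Coxeter

end CoxeterMatrix

theorem mainTheorem5 :
    (∀ w w' : CoxeterMatrix.affineG₂.Group, CoxeterMatrix.affineG₂.IsCoxeterElement w →
      CoxeterMatrix.affineG₂.IsCoxeterElement w' → IsConj w w') ∧
    ∀ w : CoxeterMatrix.affineG₂.Group, CoxeterMatrix.affineG₂.IsCoxeterElement w →
      IsLatticePoset (CoxeterMatrix.affineG₂.DualInterval w) ∧
      CoxeterMatrix.affineG₂.EncodesDualPresentation w ∧
      IsGarsideInterval CoxeterMatrix.affineG₂.reflections w := by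
  refine ⟨fun w w' hw hw' => ?_, fun w hw => ?_⟩
  · exact (CoxeterMatrix.isGoodCoxeter_of_isCoxeterElement hw).isConj.symm.trans
      (CoxeterMatrix.isGoodCoxeter_of_isCoxeterElement hw').isConj
  · have hL := CoxeterMatrix.isLatticePoset_of_isCoxeterElement hw
    exact ⟨hL, (CoxeterMatrix.isGoodCoxeter_of_isCoxeterElement hw).encodes,
      isGarsideInterval_of_isLatticePoset
        CoxeterMatrix.affineG₂.isConjGenerating_reflections hL⟩
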